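/- Let $\mathcal B_1\subset\mathbb R^2$ be the open unit disc. For $\varepsilon,\Omega>0$ let $\vec A(x,y)=\frac{\Omega}{2}(-y,x)$ and $$\mathcal E^{\rm GP}[\Psi]=\int_{\mathcal B_1}\Big\{|(\nabla-i\vec A)\Psi|^2-\tfrac14\Omega^2r^2|\Psi|^2+\varepsilon^{-2}|\Psi|^4\Big\}\,d\vec r,\qquad E^{\rm GP}=\inf\{\mathcal E^{\rm GP}[\Psi]:\Psi\in H^1(\mathcal B_1;\mathbb C),\ \|\Psi\|_2=1\},$$ where $r=|\vec r|$, and let $$\mathcal E^{\rm TF}[\rho]=\frac1{\varepsilon^{2}}\int_{\mathcal B_1}\Big\{\rho^2-\tfrac14\varepsilon^2\Omega^2r^2\rho\Big\}\,d\vec r,\qquad E^{\rm TF}=\inf\{\mathcal E^{\rm TF}[\rho]:\rho\in L^2(\mathcal B_1),\ \rho\ge0,\ \|\rho\|_1=1\}.$$ (i) If $\varepsilon\to0$ and $1\ll\Omega\lesssim1/\varepsilon$, then $$E^{\rm GP}\le E^{\rm TF}+\tfrac12\Omega|\log(\varepsilon^2\Omega)|+O(\Omega).$$ That is: for every $C>0$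 there are $K,\varepsilon_0,\Omega_0>0$ such that $E^{\rm GP}\le E^{\rm TF}+\frac12\Omega|\log(\varepsilon^2\Omega)|+K\Omega$ whenever $0<\varepsilon<\varepsilon_0$ and $\Omega_0\le\Omega\le C/\varepsilon$. (ii) If $\varepsilon\to0$ and $1/\varepsilon\lesssim\Omega\ll1/\varepsilon^2$, then $$E^{\rm GP}\le E^{\rm TF}+\tfrac12\Omega|\log\varepsilon|+O(\Omega)+O\big(\Omega(\varepsilon^2\Omega)^{1/2}|\log\varepsilon|\big).$$ That is: for every $c>0$ there are $K,\varepsilon_0,\delta>0$ such that $E^{\rm GP}\le E^{\rm TF}+\frac12\Omega|\log\varepsilon|+K\Omega+K\Omega(\varepsilon^2\Omega)^{1/2}|\log\varepsilon|$ whenever $0<\varepsilon<\varepsilon_0$ and $c/\varepsilon\le\Omega\le\delta/\varepsilon^2$. -/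

import Mathlib

open MeasureTheory Metric
open scoped ContDiff

noncomputable section

namespace RotatingBEC

/-- The open unit disc `𝓑₁`. The plane `ℝ²` is identified with `ℂ` through `ζ = x + i y`;
integrals over `ℂ` are with respect to planar Lebesgue measure. -/
def disc : Set ℂ := ball (0 : ℂ) 1

/-- `G` is a weak derivative of `Ψ` on the unit disc in the direction `v`:
`∫ Ψ ∂ᵥφ = -∫ φ G` for every test function `φ ∈ C_c^∞(𝓑₁)`. -/
def HasWeakDeriv (v : ℂ) (Ψ G : ℂ → ℂ) : Prop :=
  ∀ φ : ℂ → ℝ, ContDiff ℝ ∞ φ → HasCompactSupport φ → tsupport φ ⊆ disc →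
    ∫ z in disc, ((fderiv ℝ φ z v : ℝ) : ℂ) * Ψ z = -∫ z in disc, (φ z : ℂ) * G z

/-- `Ψ ∈ H¹(𝓑₁)` with weak gradient `(G₁, G₂) = (∂ₓΨ, ∂_yΨ)`. The weak gradient is determined by
`Ψ` up to a null set. -/
structure IsH1 (Ψ G₁ G₂ : ℂ → ℂ) : Prop where
  memLp : MemLp Ψ 2 (volume.restrict disc)
  memLp_x : MemLp G₁ 2 (volume.restrict disc)
  memLp_y : MemLp G₂ 2 (volume.restrict disc)
  weak_x : HasWeakDeriv 1 Ψ G₁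
  weak_y : HasWeakDeriv Complex.I Ψ G₂

/-- First component of the vector potential `A = (Ω/2) e_z ∧ r = (Ω/2) (-y, x)`. -/
def potX (Ω : ℝ) (z : ℂ) : ℝ := -(Ω / 2) * z.im

/-- Second component of the vector potential `A = (Ω/2) e_z ∧ r = (Ω/2) (-y, x)`. -/
def potY (Ω : ℝ) (z : ℂ) : ℝ := (Ω / 2) * z.re

/-- The Gross-Pitaevskii functional
`∫_{𝓑₁} |(∇ - iA)Ψ|² - Ω² r² |Ψ|² / 4 + |Ψ|⁴ / ε²` of `Ψ` with weak gradient `(G₁, G₂)`. -/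
def gpFunctional (ε Ω : ℝ) (Ψ G₁ G₂ : ℂ → ℂ) : ℝ :=
  ∫ z in disc,
    ((‖G₁ z - Complex.I * (potX Ω z : ℂ) * Ψ z‖ ^ 2
        + ‖G₂ z - Complex.I * (potY Ω z : ℂ) * Ψ z‖ ^ 2)
      - Ω ^ 2 * ‖z‖ ^ 2 * ‖Ψ z‖ ^ 2 / 4
      + ‖Ψ z‖ ^ 4 / ε ^ 2)

/-- The Gross-Pitaevskii ground state energy: the infimum of the functional over
`Ψ ∈ H¹(𝓑₁)` with `‖Ψ‖₂ = 1`. -/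
def gpEnergy (ε Ω : ℝ) : ℝ :=
  sInf {E : ℝ | ∃ Ψ G₁ G₂ : ℂ → ℂ, IsH1 Ψ G₁ G₂ ∧ ∫ z in disc, ‖Ψ z‖ ^ 2 = 1 ∧
    E = gpFunctional ε Ω Ψ G₁ G₂}

/-- The Thomas-Fermi functional `ε⁻² ∫_{𝓑₁} ρ² - ω² r² ρ / 4` with `ω = ε Ω`. -/
def tfFunctional (ε Ω : ℝ) (ρ : ℂ → ℝ) : ℝ :=
  (1 / ε ^ 2) * ∫ z in disc, (ρ z ^ 2 - (ε * Ω) ^ 2 * ‖z‖ ^ 2 * ρ z / 4)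

/-- The Thomas-Fermi ground state energy: the infimum of the functional over the densities `ρ ≥ 0`
with `‖ρ‖₁ = 1`. Square integrability of `ρ` says that the functional is finite at `ρ`. -/
def tfEnergy (ε Ω : ℝ) : ℝ :=
  sInf {E : ℝ | ∃ ρ : ℂ → ℝ, (∀ z, 0 ≤ ρ z) ∧ MemLp ρ 2 (volume.restrict disc) ∧
    ∫ z in disc, ρ z = 1 ∧ E = tfFunctional ε Ω ρ}

end RotatingBEC

end

/-! ### Smooth trial functions on the disc and the energy they bound. -/

noncomputable section

namespace RotatingBEC

/-! The bound comes from a trial function: a slowly varying amplitude times a lattice of unit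
vortices times a gauge phase.

The amplitude is the square root of a regularised Thomas-Fermi density. Replacing the positive part
of `s` by the positive root of `ρ (ρ - s) = κ² / 4` makes it smooth and positive, costs at most `π
κ² / (2 ε²)` in Thomas-Fermi energy (`tfFunctional_dens_le`), and makes the gradient energy of its
square root an explicit `arsinh` integral (`integral_gradSq_le`).

The lattice is built from modes `exp (-i k v)` in Landau gauge, each localised in a strip of heights
`η`. Only two neighbouring modes overlap, with weights `cos` and `sin` of one angle, so the squared
modulus is `1 + cos (π/2 cos η) cos v`, with one zero per cell of area `2π²`. The scaling is chosen
so that a cell has physical area `2π / Ω`, one vortex per flux quantum of the constant field `Ω`;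
the field and the winding then compensate, and only the local energy of the cores remains.

Multiplying by `reg T M`, with `M` the squared modulus, makes the modulus almost 1 outside cores of
squared size `T`. This removes nearly all of the radial gradient, and the energy density falls to
about `1 / (2 M)` (`cell_ineq`, `normSq_regDir_add_le`). As `M` is half a squared distance near a
vortex, a cell contributes `2 log (1/T) + O(1)` (`integral_cap_cellSq_le`), that is `Ω/2 log (1/T) +
O(Ω)` per unit mass. The mass lost in the cores is only `O(T)`.

The density is not periodic, so lattice averages are not available directly. Averaging over
translations of the lattice instead yields one position where the kinetic energy plus `Λ` times the
lost mass is at most its mean (`exists_lattice_shift`). For `Λ` at least six times the Thomas-Fermi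
energy (with its minimum shifted to nonnegative densities of energy) this penalty pays for
normalisation (`normalized_le`).

With `σ = ε √Ω`, the choices `κ = δ = σ` and `T = σ² / (1 + ε Ω)` give `gpEnergy_le`, valid in both
regimes. There `T / Ω` is the squared healing length `ε² / (1 + ε Ω)` of a density of order `1 + ε
Ω`. The two claims differ only in how `log (1/T)` is simplified. -/

lemma measurableSet_disc : MeasurableSet disc := measurableSet_ball

lemma volume_disc_lt_top : volume disc < ⊤ := measure_ball_lt_top

instance : IsFiniteMeasure (volume.restrict disc) :=
  ⟨by simpa using volume_disc_lt_top⟩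

lemma norm_lt_one_of_mem_disc {z : ℂ} (hz : z ∈ disc) : ‖z‖ < 1 := by
  simpa [disc] using hz

lemma norm_sq_le_one_of_mem_disc {z : ℂ} (hz : z ∈ disc) : ‖z‖ ^ 2 ≤ 1 :=
  pow_le_one₀ (norm_nonneg z) (norm_lt_one_of_mem_disc hz).le

/-- Continuous functions are integrable on the disc. -/
lemma integrableOn_disc {E : Type*} [NormedAddCommGroup E] {f : ℂ → E} (hf : Continuous f) :
    IntegrableOn f disc :=
  (hf.continuousOn.integrableOn_compact (isCompact_closedBall (0 : ℂ) 1)).mono_set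
    ball_subset_closedBall

lemma exists_bound_disc {E : Type*} [NormedAddCommGroup E] {f : ℂ → E} (hf : Continuous f) :
    ∃ B, ∀ z ∈ disc, ‖f z‖ ≤ B := by
  obtain ⟨B, hB⟩ := (isCompact_closedBall (0 : ℂ) 1).exists_bound_of_continuousOn hf.continuousOn
  exact ⟨B, fun z hz => hB z (ball_subset_closedBall hz)⟩

lemma memLp_disc {E : Type*} [NormedAddCommGroup E] [SecondCountableTopology E]
    {f : ℂ → E} (hf : Continuous f) : MemLp f 2 (volume.restrict disc) := by
  obtain ⟨B, hB⟩ := exists_bound_disc hf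
  exact MemLp.of_bound hf.aestronglyMeasurable B
    ((ae_restrict_iff' measurableSet_disc).2 (Filter.Eventually.of_forall hB))

/-- The classical derivative of a `C¹` function is its weak derivative. -/
lemma HasWeakDeriv.of_contDiff {Ψ : ℂ → ℂ} (h : ContDiff ℝ 1 Ψ) (v : ℂ) :
    HasWeakDeriv v Ψ (fun z => fderiv ℝ Ψ z v) := by
  intro φ hφ hc hs
  have hφ1 : ContDiff ℝ 1 φ := hφ.of_le (by exact_mod_cast le_top)
  have hdφ : Continuous fun z => fderiv ℝ φ z v := (hφ1.continuous_fderiv one_ne_zero).clm_apply (continuous_const (y := (v : ℂ)))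
  have hdΨ : Continuous fun z => fderiv ℝ Ψ z v := (h.continuous_fderiv one_ne_zero).clm_apply (continuous_const (y := (v : ℂ)))
  have hcd : HasCompactSupport fun z => fderiv ℝ φ z v := by
    refine hc.mono' fun z hz => ?_
    by_contra hn
    apply hz
    have := support_fderiv_subset ℝ (f := φ)
    have h0 : fderiv ℝ φ z = 0 := by
      by_contra hne
      exact hn (this hne)
    simp [h0]
  have e1 : ∫ z in disc, ((fderiv ℝ φ z v : ℝ) : ℂ) * Ψ z
      = ∫ z, (fderiv ℝ φ z v) • Ψ z := by
    simp only [← Complex.real_smul]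
    apply setIntegral_eq_integral_of_forall_compl_eq_zero
    intro z hz
    have h0 : fderiv ℝ φ z = 0 := by
      by_contra hne
      exact hz (hs (support_fderiv_subset ℝ (f := φ) hne))
    simp [h0]
  have e2 : ∫ z in disc, (φ z : ℂ) * fderiv ℝ Ψ z v = ∫ z, (φ z) • fderiv ℝ Ψ z v := by
    simp only [← Complex.real_smul]
    apply setIntegral_eq_integral_of_forall_compl_eq_zero
    intro z hz
    have h0 : φ z = 0 := by
      by_contra hne
      exact hz (hs (subset_tsupport φ hne))
    simp [h0]
  rw [e1, e2, eq_comm, neg_eq_iff_eq_neg]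
  refine integral_smul_fderiv_eq_neg_fderiv_smul_of_integrable ?_ ?_ ?_
    (fun z _ => (hφ1.differentiable one_ne_zero) z) (fun z _ => (h.differentiable one_ne_zero) z)
  · exact (hdφ.smul h.continuous).integrable_of_hasCompactSupport hcd.smul_right
  · exact (hφ1.continuous.smul hdΨ).integrable_of_hasCompactSupport hc.smul_right
  · exact (hφ1.continuous.smul h.continuous).integrable_of_hasCompactSupport hc.smul_right

lemma IsH1.of_contDiff {Ψ : ℂ → ℂ} (h : ContDiff ℝ 1 Ψ) :
    IsH1 Ψ (fun z => fderiv ℝ Ψ z 1) (fun z => fderiv ℝ Ψ z Complex.I) where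
  memLp := memLp_disc h.continuous
  memLp_x := memLp_disc ((h.continuous_fderiv one_ne_zero).clm_apply (continuous_const (y := (1 : ℂ))))
  memLp_y := memLp_disc ((h.continuous_fderiv one_ne_zero).clm_apply (continuous_const (y := (Complex.I : ℂ))))
  weak_x := .of_contDiff h 1
  weak_y := .of_contDiff h Complex.I

/-- The magnetic kinetic energy density `|(∇ - iA)Ψ|²`. -/
def kin (Ω : ℝ) (Ψ : ℂ → ℂ) (z : ℂ) : ℝ :=
  ‖fderiv ℝ Ψ z 1 - Complex.I * (potX Ω z : ℂ) * Ψ z‖ ^ 2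
    + ‖fderiv ℝ Ψ z Complex.I - Complex.I * (potY Ω z : ℂ) * Ψ z‖ ^ 2

lemma kin_nonneg (Ω : ℝ) (Ψ : ℂ → ℂ) (z : ℂ) : 0 ≤ kin Ω Ψ z := by
  unfold kin; positivity

lemma continuous_kin (Ω : ℝ) {Ψ : ℂ → ℂ} (h : ContDiff ℝ 1 Ψ) : Continuous (kin Ω Ψ) := by
  have h1 := (h.continuous_fderiv one_ne_zero).clm_apply (continuous_const (y := (1 : ℂ)))
  have h2 := (h.continuous_fderiv one_ne_zero).clm_apply (continuous_const (y := (Complex.I : ℂ)))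
  have h3 := h.continuous
  have h4 : Continuous Complex.re := Complex.continuous_re
  have h5 : Continuous Complex.im := Complex.continuous_im
  unfold kin potX potY
  fun_prop

/-- Needed because `sInf` of a set not bounded below carries no information. Only the centrifugal
term is negative, and it is at least `-Ω² / 4` times the mass. -/
lemma bddBelow_gp (ε Ω : ℝ) :
    BddBelow {E : ℝ | ∃ Ψ G₁ G₂ : ℂ → ℂ, IsH1 Ψ G₁ G₂ ∧ ∫ z in disc, ‖Ψ z‖ ^ 2 = 1 ∧
      E = gpFunctional ε Ω Ψ G₁ G₂} := by
  refine ⟨-(Ω ^ 2 / 4), ?_⟩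
  rintro E ⟨Ψ, G₁, G₂, h, hN, rfl⟩
  unfold gpFunctional
  by_cases hi : IntegrableOn (fun z => (‖G₁ z - Complex.I * (potX Ω z : ℂ) * Ψ z‖ ^ 2
        + ‖G₂ z - Complex.I * (potY Ω z : ℂ) * Ψ z‖ ^ 2)
      - Ω ^ 2 * ‖z‖ ^ 2 * ‖Ψ z‖ ^ 2 / 4
      + ‖Ψ z‖ ^ 4 / ε ^ 2) disc
  · have hi2 : IntegrableOn (fun z => -(Ω ^ 2 / 4) * ‖Ψ z‖ ^ 2) disc :=
      (h.memLp.integrable_norm_pow two_ne_zero).const_mul _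
    calc -(Ω ^ 2 / 4) = ∫ z in disc, -(Ω ^ 2 / 4) * ‖Ψ z‖ ^ 2 := by
          rw [integral_const_mul, hN, mul_one]
      _ ≤ _ := by
          refine setIntegral_mono_on hi2 hi measurableSet_disc fun z hz => ?_
          have h1 := norm_sq_le_one_of_mem_disc hz
          have h2 : Ω ^ 2 * ‖Ψ z‖ ^ 2 * ‖z‖ ^ 2 ≤ Ω ^ 2 * ‖Ψ z‖ ^ 2 * 1 :=
            mul_le_mul_of_nonneg_left h1 (by positivity)
          have h3 : 0 ≤ ‖Ψ z‖ ^ 4 / ε ^ 2 := by positivity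
          have h4 : 0 ≤ ‖G₁ z - Complex.I * (potX Ω z : ℂ) * Ψ z‖ ^ 2
            + ‖G₂ z - Complex.I * (potY Ω z : ℂ) * Ψ z‖ ^ 2 := by positivity
          linarith
  -- A non-integrable density has integral 0 by convention, which also lies above the bound.
  · rw [integral_undef hi]
    have : 0 ≤ Ω ^ 2 / 4 := by positivity
    linarith

/-- The Gross-Pitaevskii energy is bounded by the energy of any normalised `C¹` function, with
`Ω² r² / 4` rewritten as `Ω² / 4 - Ω² (1 - r²) / 4`. -/
lemma gpEnergy_le_of_contDiff (ε Ω : ℝ) {Ψ : ℂ → ℂ} (h : ContDiff ℝ 1 Ψ)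
    (hN : 0 < ∫ z in disc, ‖Ψ z‖ ^ 2) :
    gpEnergy ε Ω ≤ (∫ z in disc, kin Ω Ψ z) / (∫ z in disc, ‖Ψ z‖ ^ 2)
      + (∫ z in disc, Ω ^ 2 / 4 * (1 - ‖z‖ ^ 2) * ‖Ψ z‖ ^ 2) / (∫ z in disc, ‖Ψ z‖ ^ 2)
      + (∫ z in disc, ‖Ψ z‖ ^ 4 / ε ^ 2) / (∫ z in disc, ‖Ψ z‖ ^ 2) ^ 2
      - Ω ^ 2 / 4 := by
  set N := ∫ z in disc, ‖Ψ z‖ ^ 2 with hNdef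
  set a : ℝ := (Real.sqrt N)⁻¹ with ha
  have ha0 : 0 < a := inv_pos.2 (Real.sqrt_pos.2 hN)
  have ha2 : a ^ 2 = N⁻¹ := by rw [ha, inv_pow, Real.sq_sqrt hN.le]
  set Φ : ℂ → ℂ := fun z => (a : ℂ) * Ψ z with hΦ
  have hΦc : ContDiff ℝ 1 Φ := contDiff_const.mul h
  have hnorm : ∀ z, ‖Φ z‖ = a * ‖Ψ z‖ := fun z => by
    simp [hΦ, abs_of_pos ha0]
  have hder : ∀ z v, fderiv ℝ Φ z v = (a : ℂ) * fderiv ℝ Ψ z v := fun z v => by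
    rw [hΦ, fderiv_const_mul ((h.differentiable one_ne_zero) z)]
    simp
  have hkin : ∀ z, kin Ω Φ z = a ^ 2 * kin Ω Ψ z := fun z => by
    have e : ∀ X p w : ℂ, (a : ℂ) * X - Complex.I * p * ((a : ℂ) * w)
      = (a : ℂ) * (X - Complex.I * p * w) := fun X p w => by ring
    unfold kin
    rw [hder, hder]
    simp only [hΦ, e, norm_mul, Complex.norm_real, Real.norm_eq_abs, abs_of_pos ha0]
    ring
  have hnz : Continuous fun z : ℂ => ‖z‖ := continuous_norm
  have hΨc := h.continuous
  have i1 := integrableOn_disc (continuous_kin Ω h)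
  have i2 : IntegrableOn (fun z => Ω ^ 2 / 4 * (1 - ‖z‖ ^ 2) * ‖Ψ z‖ ^ 2) disc :=
    integrableOn_disc (by fun_prop)
  have i3 : IntegrableOn (fun z => ‖Ψ z‖ ^ 4 / ε ^ 2) disc :=
    integrableOn_disc (by fun_prop)
  have i4 : IntegrableOn (fun z => ‖Ψ z‖ ^ 2) disc := integrableOn_disc (by fun_prop)
  refine csInf_le (bddBelow_gp ε Ω) ⟨Φ, _, _, IsH1.of_contDiff hΦc, ?_, ?_⟩
  · simp only [hnorm, mul_pow]
    rw [integral_const_mul, ha2, ← hNdef, inv_mul_cancel₀ hN.ne']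
  · have : ∀ z, (‖fderiv ℝ Φ z 1 - Complex.I * (potX Ω z : ℂ) * Φ z‖ ^ 2
        + ‖fderiv ℝ Φ z Complex.I - Complex.I * (potY Ω z : ℂ) * Φ z‖ ^ 2)
      - Ω ^ 2 * ‖z‖ ^ 2 * ‖Φ z‖ ^ 2 / 4 + ‖Φ z‖ ^ 4 / ε ^ 2
      = a ^ 2 * kin Ω Ψ z + a ^ 2 * (Ω ^ 2 / 4 * (1 - ‖z‖ ^ 2) * ‖Ψ z‖ ^ 2)
        + (a ^ 2) ^ 2 * (‖Ψ z‖ ^ 4 / ε ^ 2) - Ω ^ 2 / 4 * a ^ 2 * ‖Ψ z‖ ^ 2 := fun z => by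
      rw [← hkin]
      unfold kin
      rw [hnorm]
      ring
    unfold gpFunctional
    simp only [this]
    have j1 := i1.const_mul (a ^ 2)
    have j2 := i2.const_mul (a ^ 2)
    have j3 := i3.const_mul ((a ^ 2) ^ 2)
    have j4 := i4.const_mul (Ω ^ 2 / 4 * a ^ 2)
    have j12 : IntegrableOn (fun z => a ^ 2 * kin Ω Ψ z
        + a ^ 2 * (Ω ^ 2 / 4 * (1 - ‖z‖ ^ 2) * ‖Ψ z‖ ^ 2)) disc := j1.add j2
    have j123 : IntegrableOn (fun z => a ^ 2 * kin Ω Ψ z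
        + a ^ 2 * (Ω ^ 2 / 4 * (1 - ‖z‖ ^ 2) * ‖Ψ z‖ ^ 2)
        + (a ^ 2) ^ 2 * (‖Ψ z‖ ^ 4 / ε ^ 2)) disc := j12.add j3
    rw [integral_sub j123 j4, integral_add j12 j3, integral_add j1 j2]
    simp only [integral_const_mul]
    rw [← hNdef, ha2]
    field_simp

/-- Integration of radial functions over the disc. -/
lemma integral_disc_radial {F : ℝ → ℝ} (hF : Continuous F) :
    ∫ z in disc, F (‖z‖ ^ 2) = Real.pi * ∫ p in (0 : ℝ)..1, F p := by
  have e1 : ∫ z in disc, F (‖z‖ ^ 2)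
      = ∫ z : ℂ, (Set.Iio (1 : ℝ)).indicator (fun r => F (r ^ 2)) ‖z‖ := by
    rw [← integral_indicator measurableSet_disc]
    refine integral_congr_ae (Filter.Eventually.of_forall fun z => ?_)
    by_cases hz : ‖z‖ < 1
    · have : z ∈ disc := by simpa [disc] using hz
      simp [this, hz]
    · have : z ∉ disc := by simpa [disc] using hz
      simp [this, hz]
  have e2 : ∫ y in Set.Ioi (0 : ℝ), y ^ (2 - 1) •
      (Set.Iio (1 : ℝ)).indicator (fun r => F (r ^ 2)) y
      = ∫ y in (0 : ℝ)..1, y * F (y ^ 2) := by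
    rw [intervalIntegral.integral_of_le zero_le_one, integral_Ioc_eq_integral_Ioo,
      ← integral_indicator measurableSet_Ioi, ← integral_indicator measurableSet_Ioo]
    refine integral_congr_ae (Filter.Eventually.of_forall fun y => ?_)
    by_cases h0 : 0 < y <;> by_cases h1 : y < 1 <;> simp [h0, h1]
  have e3 : ∫ y in (0 : ℝ)..1, F (y ^ 2) * (2 * y) = ∫ p in (0 : ℝ)..1, F p := by
    have := intervalIntegral.integral_comp_mul_deriv (a := 0) (b := 1) (f := fun y : ℝ => y ^ 2)
      (f' := fun y => 2 * y) (g := F) (fun y _ => by simpa using hasDerivAt_pow 2 y)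
      (by fun_prop) hF
    simpa using this
  have e4 : ∫ y in (0 : ℝ)..1, F (y ^ 2) * (2 * y) = 2 * ∫ y in (0 : ℝ)..1, y * F (y ^ 2) := by
    rw [← intervalIntegral.integral_const_mul]
    congr 1
    ext y
    ring
  rw [e1, integral_fun_norm_addHaar, Complex.finrank_real_complex, e2, ← e3, e4]
  have : (volume : Measure ℂ).real (ball 0 1) = Real.pi := by
    simp [Measure.real, Complex.volume_ball]
  rw [this]
  simp only [smul_eq_mul, nsmul_eq_mul]
  push_cast
  ring

lemma measureReal_disc : (volume : Measure ℂ).real disc = Real.pi := by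
  simp [Measure.real, disc, Complex.volume_ball]

/-! ### The regularised Thomas-Fermi density and its normalisation. -/

/-- A smooth strictly positive regularisation of the positive part, at scale `κ`. -/
def prof (κ s : ℝ) : ℝ := (s + Real.sqrt (s ^ 2 + κ ^ 2)) / 2

section prof

variable {κ : ℝ}

lemma sq_add_sq_pos (hκ : 0 < κ) (s : ℝ) : 0 < s ^ 2 + κ ^ 2 := by positivity

lemma abs_lt_sqrt (hκ : 0 < κ) (s : ℝ) : |s| < Real.sqrt (s ^ 2 + κ ^ 2) := by
  rw [← Real.sqrt_sq_eq_abs]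
  exact Real.sqrt_lt_sqrt (sq_nonneg s) (by nlinarith)

lemma prof_pos (hκ : 0 < κ) (s : ℝ) : 0 < prof κ s := by
  have h1 := abs_lt_sqrt hκ s
  have h2 := neg_abs_le s
  unfold prof
  linarith

lemma le_prof (hκ : 0 < κ) (s : ℝ) : s ≤ prof κ s := by
  have h1 := abs_lt_sqrt hκ s
  have h2 := le_abs_self s
  unfold prof
  linarith

lemma prof_le_sqrt (hκ : 0 < κ) (s : ℝ) : prof κ s ≤ Real.sqrt (s ^ 2 + κ ^ 2) := by
  have h1 := abs_lt_sqrt hκ s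
  have h2 := le_abs_self s
  unfold prof
  linarith

/-- This quadratic equation characterises the profile. It is the Euler-Lagrange equation of `ρ² - 2
s ρ` with a logarithmic barrier `-(κ² / 2) log ρ`, which explains positivity and the small energy
defect. -/
lemma prof_mul_sub (κ s : ℝ) : prof κ s * (prof κ s - s) = κ ^ 2 / 4 := by
  have h := Real.sq_sqrt (show 0 ≤ s ^ 2 + κ ^ 2 by positivity)
  unfold prof
  linear_combination h / 4

lemma prof_le (hκ : 0 < κ) {s S : ℝ} (hS : 0 ≤ S) (hs : s ≤ S) : prof κ s ≤ S + κ := by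
  have h : Real.sqrt (s ^ 2 + κ ^ 2) ≤ |s| + κ := by
    rw [Real.sqrt_le_left (by positivity)]
    have : 0 ≤ |s| * κ := by positivity
    nlinarith [sq_abs s]
  unfold prof
  rcases abs_cases s with ⟨h1, _⟩ | ⟨h1, _⟩ <;> linarith

lemma continuous_prof (κ : ℝ) : Continuous (prof κ) := by
  unfold prof
  fun_prop

lemma hasDerivAt_prof (hκ : 0 < κ) (s : ℝ) :
    HasDerivAt (prof κ) (prof κ s / Real.sqrt (s ^ 2 + κ ^ 2)) s := by
  have h0 := sq_add_sq_pos hκ s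
  have h1 : HasDerivAt (fun s : ℝ => s ^ 2 + κ ^ 2) (2 * s) s := by
    simpa using (hasDerivAt_pow 2 s).add_const (κ ^ 2)
  have h2 := ((hasDerivAt_id s).add (h1.sqrt h0.ne')).div_const 2
  refine h2.congr_deriv ?_
  have h3 : Real.sqrt (s ^ 2 + κ ^ 2) ≠ 0 := (Real.sqrt_pos.2 h0).ne'
  unfold prof
  field_simp
  ring

end prof

/-- The affine function of `p = r²` whose positive part is the Thomas-Fermi density. -/
def tfs (ϖ μ p : ℝ) : ℝ := ϖ ^ 2 * p / 8 + μ

/-- The trial density. -/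
def dens (κ ϖ μ : ℝ) (z : ℂ) : ℝ := prof κ (tfs ϖ μ (‖z‖ ^ 2))

lemma continuous_tfs (ϖ μ : ℝ) : Continuous (tfs ϖ μ) := by
  unfold tfs
  fun_prop

lemma hasDerivAt_tfs (ϖ μ p : ℝ) : HasDerivAt (tfs ϖ μ) (ϖ ^ 2 / 8) p := by
  unfold tfs
  simpa using (((hasDerivAt_id p).const_mul (ϖ ^ 2)).div_const 8).add_const μ

lemma continuous_dens (κ ϖ μ : ℝ) : Continuous (dens κ ϖ μ) :=
  (continuous_prof κ).comp ((continuous_tfs ϖ μ).comp (continuous_norm.pow 2))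

lemma integral_dens (κ ϖ μ : ℝ) :
    ∫ z in disc, dens κ ϖ μ z = Real.pi * ∫ p in (0 : ℝ)..1, prof κ (tfs ϖ μ p) :=
  integral_disc_radial ((continuous_prof κ).comp (continuous_tfs ϖ μ))

lemma integral_const_disc (c : ℝ) : ∫ _ in disc, c = Real.pi * c := by
  rw [setIntegral_const, measureReal_disc, smul_eq_mul]

lemma tfs_le_one {ϖ μ p : ℝ} (hp : p ≤ 1) : tfs ϖ μ p ≤ tfs ϖ μ 1 := by
  unfold tfs
  nlinarith [mul_le_mul_of_nonneg_left hp (sq_nonneg ϖ)]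

/-- Intermediate value theorem in the chemical potential `μ`. At the lower endpoint `s ≤ -κ²`, so
`prof_mul_sub` forces the density below `1/4`; at `μ = 1` it is at least 1. The disc has area `π`,
between 1 and 4. -/
lemma exists_normalized (κ ϖ : ℝ) (hκ : 0 < κ) :
    ∃ μ : ℝ, ∫ z in disc, dens κ ϖ μ z = 1 := by
  have hcont : Continuous fun μ : ℝ => Real.pi * ∫ p in (0 : ℝ)..1, prof κ (tfs ϖ μ p) := by
    refine continuous_const.mul ?_
    refine intervalIntegral.continuous_parametric_intervalIntegral_of_continuous' ?_ 0 1
    have := continuous_prof κ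
    unfold tfs
    fun_prop
  have hlo : Real.pi * ∫ p in (0 : ℝ)..1, prof κ (tfs ϖ (-κ ^ 2 - ϖ ^ 2 / 8) p) ≤ 1 := by
    rw [← integral_dens]
    calc ∫ z in disc, dens κ ϖ (-κ ^ 2 - ϖ ^ 2 / 8) z ≤ ∫ z in disc, (1 / 4 : ℝ) := by
          refine setIntegral_mono_on (integrableOn_disc (continuous_dens _ _ _))
            (integrableOn_disc continuous_const) measurableSet_disc fun z hz => ?_
          have h1 : tfs ϖ (-κ ^ 2 - ϖ ^ 2 / 8) (‖z‖ ^ 2) ≤ -κ ^ 2 := by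
            refine (tfs_le_one (norm_sq_le_one_of_mem_disc hz)).trans (le_of_eq ?_)
            unfold tfs
            ring
          unfold dens
          set s := tfs ϖ (-κ ^ 2 - ϖ ^ 2 / 8) (‖z‖ ^ 2)
          have h2 := prof_mul_sub κ s
          have h3 := prof_pos hκ s
          have hκ2 : 0 < κ ^ 2 := by positivity
          by_contra hcon
          push Not at hcon
          nlinarith
      _ ≤ 1 := by
          rw [integral_const_disc]
          linarith [Real.pi_le_four]
  have hhi : 1 ≤ Real.pi * ∫ p in (0 : ℝ)..1, prof κ (tfs ϖ 1 p) := by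
    rw [← integral_dens]
    calc (1 : ℝ) ≤ ∫ z in disc, (1 : ℝ) := by
          rw [integral_const_disc]
          linarith [Real.pi_gt_three]
      _ ≤ _ := by
          refine setIntegral_mono_on (integrableOn_disc continuous_const)
            (integrableOn_disc (continuous_dens _ _ _)) measurableSet_disc fun z hz => ?_
          refine le_trans ?_ (le_prof hκ _)
          unfold tfs
          have : 0 ≤ ϖ ^ 2 * ‖z‖ ^ 2 / 8 := by positivity
          linarith
  have hle : -κ ^ 2 - ϖ ^ 2 / 8 ≤ 1 := by nlinarith [sq_nonneg κ, sq_nonneg ϖ]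
  obtain ⟨μ, -, hμ⟩ := intermediate_value_Icc hle hcont.continuousOn ⟨hlo, hhi⟩
  exact ⟨μ, by rw [integral_dens]; exact hμ⟩

section normalized

variable {κ ϖ μ : ℝ}

/-- A larger boundary value would keep the density above `(1 + ϖ) / 2` for `p` in an interval of
length `1 / (1 + ϖ)` next to 1, hence a mass of at least `π / 2 > 1`. -/
lemma tfs_one_le (hκ : 0 < κ) (hϖ : 0 ≤ ϖ) (hn : ∫ z in disc, dens κ ϖ μ z = 1) :
    tfs ϖ μ 1 ≤ 2 + ϖ := by
  by_contra hcon
  push Not at hcon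
  have hc : Continuous fun p => prof κ (tfs ϖ μ p) :=
    (continuous_prof κ).comp (continuous_tfs ϖ μ)
  set θ : ℝ := 1 / (1 + ϖ) with hθ
  have hθ0 : 0 < θ := by positivity
  have hθ1 : θ ≤ 1 := by
    rw [hθ, div_le_one (by positivity)]
    linarith
  have hθϖ : θ * (1 + ϖ) = 1 := by rw [hθ]; field_simp
  have h1 : ∫ p in (1 - θ)..1, (1 + ϖ) / 2 ≤ ∫ p in (1 - θ)..1, prof κ (tfs ϖ μ p) := by
    refine intervalIntegral.integral_mono_on (by linarith) (by simp)
      (hc.intervalIntegrable _ _) fun p hp => ?_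
    refine le_trans ?_ (le_prof hκ _)
    have h2 : tfs ϖ μ p = tfs ϖ μ 1 - ϖ ^ 2 * (1 - p) / 8 := by
      unfold tfs
      ring
    have h3 : ϖ ^ 2 * (1 - p) ≤ ϖ := by
      have : ϖ ^ 2 * (1 - p) ≤ ϖ ^ 2 * θ :=
        mul_le_mul_of_nonneg_left (by linarith [hp.1]) (sq_nonneg ϖ)
      have h4 : ϖ * θ ≤ 1 := by nlinarith
      nlinarith
    rw [h2]
    linarith
  have h5 : ∫ p in (1 - θ)..1, prof κ (tfs ϖ μ p) ≤ ∫ p in (0 : ℝ)..1, prof κ (tfs ϖ μ p) :=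
    intervalIntegral.integral_mono_interval (by linarith) (by linarith) le_rfl
      (Filter.Eventually.of_forall fun p => (prof_pos hκ _).le) (hc.intervalIntegrable _ _)
  rw [intervalIntegral.integral_const, smul_eq_mul] at h1
  have h6 : (1 : ℝ) / 2 ≤ ∫ p in (0 : ℝ)..1, prof κ (tfs ϖ μ p) := by
    have : (1 - (1 - θ)) * ((1 + ϖ) / 2) = 1 / 2 := by linarith
    linarith
  rw [integral_dens] at hn
  nlinarith [Real.pi_gt_three]

/-- Otherwise `s ≤ 0` on the whole disc, the density is at most `κ`, and the mass is below 1. -/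
lemma tfs_one_pos (hκ : 0 < κ) (hκ1 : κ ≤ 1 / 10) (hn : ∫ z in disc, dens κ ϖ μ z = 1) :
    0 < tfs ϖ μ 1 := by
  by_contra hcon
  push Not at hcon
  have h : ∫ z in disc, dens κ ϖ μ z ≤ ∫ z in disc, (1 / 10 : ℝ) := by
    refine setIntegral_mono_on (integrableOn_disc (continuous_dens _ _ _))
      (integrableOn_disc continuous_const) measurableSet_disc fun z hz => ?_
    have := prof_le hκ le_rfl ((tfs_le_one (norm_sq_le_one_of_mem_disc hz)).trans hcon)
    unfold dens
    linarith
  rw [hn, integral_const_disc] at h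
  linarith [Real.pi_le_four]

end normalized

/-! ### Thomas-Fermi energy of the regularised density. -/

section energy

variable {κ ε Ω μ : ℝ}

/-- Convexity, pointwise: with `r (r - s) = κ² / 4`, the difference of `ρ² - 2 s ρ` and `r² - 2 s r`
is `(ρ - r)² + 2 ρ (r - s) - κ² / 2`, where the first two terms are nonnegative. The terms in `μ`
cancel because both masses are 1. -/
lemma tfFunctional_dens_le (hε : 0 < ε) (hκ : 0 < κ)
    (hn : ∫ z in disc, dens κ (ε * Ω) μ z = 1) {ρ : ℂ → ℝ} (h0 : ∀ z, 0 ≤ ρ z)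
    (h2 : MemLp ρ 2 (volume.restrict disc)) (h1 : ∫ z in disc, ρ z = 1) :
    tfFunctional ε Ω (dens κ (ε * Ω) μ)
      ≤ tfFunctional ε Ω ρ + Real.pi * κ ^ 2 / (2 * ε ^ 2) := by
  set r := dens κ (ε * Ω) μ with hr
  have hrc : Continuous r := continuous_dens _ _ _
  have i1 : IntegrableOn ρ disc := h2.integrable one_le_two
  have i2 : IntegrableOn (fun z => ρ z ^ 2) disc := h2.integrable_sq
  have i3 : IntegrableOn (fun z => (ε * Ω) ^ 2 * ‖z‖ ^ 2 * ρ z / 4) disc := by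
    have : IntegrableOn (fun z => ((ε * Ω) ^ 2 * ‖z‖ ^ 2 / 4) * ρ z) disc := by
      refine Integrable.bdd_mul (c := (ε * Ω) ^ 2 / 4) i1
        (by fun_prop : Continuous fun z : ℂ => (ε * Ω) ^ 2 * ‖z‖ ^ 2 / 4).aestronglyMeasurable
        ((ae_restrict_iff' measurableSet_disc).2 (Filter.Eventually.of_forall fun z hz => ?_))
      have hz1 := norm_sq_le_one_of_mem_disc hz
      rw [Real.norm_of_nonneg (by positivity)]
      nlinarith [mul_le_mul_of_nonneg_left hz1 (sq_nonneg (ε * Ω))]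
    refine this.congr_fun (fun z _ => ?_) measurableSet_disc
    ring
  have i4 : IntegrableOn (fun z => r z ^ 2 - (ε * Ω) ^ 2 * ‖z‖ ^ 2 * r z / 4) disc :=
    integrableOn_disc (by fun_prop)
  have i5 : IntegrableOn r disc := integrableOn_disc hrc
  have i6 : IntegrableOn (fun z => ρ z ^ 2 - (ε * Ω) ^ 2 * ‖z‖ ^ 2 * ρ z / 4) disc := i2.sub i3
  have i7 : IntegrableOn (fun z => 2 * μ * (r z - ρ z)) disc := (i5.sub i1).const_mul (2 * μ)
  have i8 : IntegrableOn (fun _ : ℂ => κ ^ 2 / 2) disc := integrableOn_disc continuous_const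
  have i67 : IntegrableOn (fun z => (ρ z ^ 2 - (ε * Ω) ^ 2 * ‖z‖ ^ 2 * ρ z / 4)
    + 2 * μ * (r z - ρ z)) disc := i6.add i7
  have key : ∫ z in disc, (r z ^ 2 - (ε * Ω) ^ 2 * ‖z‖ ^ 2 * r z / 4)
      ≤ ∫ z in disc, ((ρ z ^ 2 - (ε * Ω) ^ 2 * ‖z‖ ^ 2 * ρ z / 4)
        + 2 * μ * (r z - ρ z) + κ ^ 2 / 2) := by
    refine integral_mono i4 (i67.add i8) fun z => ?_
    have e1 := prof_mul_sub κ (tfs (ε * Ω) μ (‖z‖ ^ 2))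
    have e2 := le_prof hκ (tfs (ε * Ω) μ (‖z‖ ^ 2))
    have e3 : r z = prof κ (tfs (ε * Ω) μ (‖z‖ ^ 2)) := rfl
    rw [← e3] at e1 e2
    have e4 : tfs (ε * Ω) μ (‖z‖ ^ 2) = (ε * Ω) ^ 2 * ‖z‖ ^ 2 / 8 + μ := rfl
    rw [e4] at e1 e2
    have e5 := mul_nonneg (h0 z) (sub_nonneg.2 e2)
    have e6 := sq_nonneg (ρ z - r z)
    simp only
    nlinarith
  rw [integral_add i67 i8, integral_add i6 i7, integral_const_disc, integral_const_mul,
    integral_sub i5 i1, hn, h1] at key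
  unfold tfFunctional
  have hε2 : 0 < 1 / ε ^ 2 := by positivity
  have := mul_le_mul_of_nonneg_left key hε2.le
  generalize ∫ z in disc, (ρ z ^ 2 - (ε * Ω) ^ 2 * ‖z‖ ^ 2 * ρ z / 4) = J at *
  refine this.trans (le_of_eq ?_)
  field_simp
  ring

lemma tfFunctional_dens_le_tfEnergy (hε : 0 < ε) (hκ : 0 < κ)
    (hn : ∫ z in disc, dens κ (ε * Ω) μ z = 1) :
    tfFunctional ε Ω (dens κ (ε * Ω) μ) ≤ tfEnergy ε Ω + Real.pi * κ ^ 2 / (2 * ε ^ 2) := by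
  rw [← sub_le_iff_le_add]
  refine le_csInf ⟨_, dens κ (ε * Ω) μ, fun z => (prof_pos hκ _).le,
    memLp_disc (continuous_dens _ _ _), hn, rfl⟩ ?_
  rintro E ⟨ρ, h0, h2, h1, rfl⟩
  rw [sub_le_iff_le_add]
  exact tfFunctional_dens_le hε hκ hn h0 h2 h1

lemma integral_potential_add (hε : 0 < ε) (hn : ∫ z in disc, dens κ (ε * Ω) μ z = 1) :
    (∫ z in disc, Ω ^ 2 / 4 * (1 - ‖z‖ ^ 2) * dens κ (ε * Ω) μ z)
      + ∫ z in disc, dens κ (ε * Ω) μ z ^ 2 / ε ^ 2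
      = tfFunctional ε Ω (dens κ (ε * Ω) μ) + Ω ^ 2 / 4 := by
  set r := dens κ (ε * Ω) μ with hr
  have hrc : Continuous r := continuous_dens _ _ _
  have i1 : IntegrableOn (fun z => Ω ^ 2 / 4 * (1 - ‖z‖ ^ 2) * r z) disc :=
    integrableOn_disc (by fun_prop)
  have i2 : IntegrableOn (fun z => r z ^ 2 / ε ^ 2) disc := integrableOn_disc (by fun_prop)
  have i3 : IntegrableOn (fun z => 1 / ε ^ 2 * (r z ^ 2 - (ε * Ω) ^ 2 * ‖z‖ ^ 2 * r z / 4)) disc :=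
    integrableOn_disc (by fun_prop)
  have i4 : IntegrableOn (fun z => Ω ^ 2 / 4 * r z) disc := integrableOn_disc (by fun_prop)
  have : Ω ^ 2 / 4 = ∫ z in disc, Ω ^ 2 / 4 * r z := by
    rw [integral_const_mul, hn, mul_one]
  unfold tfFunctional
  rw [← integral_add i1 i2, this, ← integral_const_mul, ← integral_add i3 i4]
  congr 1
  ext z
  rw [← this]
  field_simp
  ring

/-- Bounds the nonnegative part of the energy that is rescaled on normalising the trial function; it
determines how large the mass penalty `Λ` has to be. -/
lemma integral_potential_add_le (hε : 0 < ε) (hn : ∫ z in disc, dens κ (ε * Ω) μ z = 1) :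
    (∫ z in disc, Ω ^ 2 / 4 * (1 - ‖z‖ ^ 2) * dens κ (ε * Ω) μ z)
      + ∫ z in disc, dens κ (ε * Ω) μ z ^ 2 / ε ^ 2
      ≤ (2 * tfs (ε * Ω) μ 1 + 2 * κ ^ 2) / ε ^ 2 := by
  set r := dens κ (ε * Ω) μ with hr
  set S := tfs (ε * Ω) μ 1 with hS
  have hrc : Continuous r := continuous_dens _ _ _
  have i1 : IntegrableOn (fun z => Ω ^ 2 / 4 * (1 - ‖z‖ ^ 2) * r z) disc :=
    integrableOn_disc (by fun_prop)
  have i2 : IntegrableOn (fun z => r z ^ 2 / ε ^ 2) disc := integrableOn_disc (by fun_prop)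
  have i3 : IntegrableOn (fun z => 2 * S / ε ^ 2 * r z) disc := integrableOn_disc (by fun_prop)
  have i4 : IntegrableOn (fun _ : ℂ => κ ^ 2 / 2 / ε ^ 2) disc :=
    integrableOn_disc continuous_const
  rw [← integral_add i1 i2]
  calc ∫ z in disc, (Ω ^ 2 / 4 * (1 - ‖z‖ ^ 2) * r z + r z ^ 2 / ε ^ 2)
      ≤ ∫ z in disc, (2 * S / ε ^ 2 * r z + κ ^ 2 / 2 / ε ^ 2) := by
        refine integral_mono (i1.add i2) (i3.add i4) fun z => ?_
        have e1 := prof_mul_sub κ (tfs (ε * Ω) μ (‖z‖ ^ 2))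
        have e3 : r z = prof κ (tfs (ε * Ω) μ (‖z‖ ^ 2)) := rfl
        rw [← e3] at e1
        have e4 : tfs (ε * Ω) μ (‖z‖ ^ 2) = S - (ε * Ω) ^ 2 * (1 - ‖z‖ ^ 2) / 8 := by
          rw [hS]
          unfold tfs
          ring
        rw [e4] at e1
        have e5 : 2 * S / ε ^ 2 * r z + κ ^ 2 / 2 / ε ^ 2
          - (Ω ^ 2 / 4 * (1 - ‖z‖ ^ 2) * r z + r z ^ 2 / ε ^ 2) = r z ^ 2 / ε ^ 2 := by
          field_simp
          linear_combination (-16) * e1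
        have e6 : 0 ≤ r z ^ 2 / ε ^ 2 := by positivity
        simp only
        linarith
    _ = 2 * S / ε ^ 2 + Real.pi * (κ ^ 2 / 2 / ε ^ 2) := by
        rw [integral_add i3 i4, integral_const_mul, hn, integral_const_disc, mul_one]
    _ ≤ _ := by
        have : Real.pi * (κ ^ 2 / 2 / ε ^ 2) ≤ 4 * (κ ^ 2 / 2 / ε ^ 2) :=
          mul_le_mul_of_nonneg_right Real.pi_le_four (by positivity)
        refine (add_le_add_right this _).trans (le_of_eq ?_)
        field_simp
        ring

end energy

/-! ### Gradient energy of the amplitude. -/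

/-- The amplitude of the trial function. -/
def amp (κ ϖ μ : ℝ) (z : ℂ) : ℝ := Real.sqrt (dens κ ϖ μ z)

section amp

variable {κ ϖ μ : ℝ}

lemma amp_sq (hκ : 0 < κ) (z : ℂ) : amp κ ϖ μ z ^ 2 = dens κ ϖ μ z :=
  Real.sq_sqrt (prof_pos hκ _).le

lemma contDiff_amp (hκ : 0 < κ) : ContDiff ℝ 1 (amp κ ϖ μ) := by
  have h1 : ContDiff ℝ 1 fun z : ℂ => tfs ϖ μ (‖z‖ ^ 2) := by
    have := contDiff_norm_sq ℝ (E := ℂ) (n := 1)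
    unfold tfs
    fun_prop
  have h2 : ContDiff ℝ 1 (dens κ ϖ μ) := by
    have : ContDiff ℝ 1 fun z : ℂ => Real.sqrt (tfs ϖ μ (‖z‖ ^ 2) ^ 2 + κ ^ 2) :=
      ((h1.pow 2).add contDiff_const).sqrt fun z => (sq_add_sq_pos hκ _).ne'
    unfold dens prof
    exact (h1.add this).div_const 2
  exact h2.sqrt fun z => (prof_pos hκ _).ne'

lemma fderiv_amp (hκ : 0 < κ) (z v : ℂ) :
    fderiv ℝ (amp κ ϖ μ) z v = Real.sqrt (dens κ ϖ μ z)
      / (2 * Real.sqrt (tfs ϖ μ (‖z‖ ^ 2) ^ 2 + κ ^ 2)) * (ϖ ^ 2 / 8) * (2 * inner ℝ z v) := by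
  have h1 : HasFDerivAt (fun z : ℂ => ‖z‖ ^ 2) (2 • innerSL ℝ z) z :=
    (hasStrictFDerivAt_norm_sq z).hasFDerivAt
  have h2 := hasDerivAt_tfs ϖ μ (‖z‖ ^ 2)
  have h3 := (((hasDerivAt_prof hκ _).comp _ h2).sqrt (prof_pos hκ _).ne').comp_hasFDerivAt z h1
  have h4 : HasFDerivAt (amp κ ϖ μ) _ z := h3
  rw [h4.fderiv]
  have h5 : Real.sqrt (prof κ (tfs ϖ μ (‖z‖ ^ 2))) ≠ 0 := (Real.sqrt_pos.2 (prof_pos hκ _)).ne'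
  have h6 := Real.sq_sqrt (prof_pos hκ (tfs ϖ μ (‖z‖ ^ 2))).le
  have h7 : Real.sqrt (tfs ϖ μ (‖z‖ ^ 2) ^ 2 + κ ^ 2) ≠ 0 :=
    (Real.sqrt_pos.2 (sq_add_sq_pos hκ _)).ne'
  simp only [smul_apply, innerSL_apply_apply, smul_eq_mul, nsmul_eq_mul,
    Function.comp_apply, dens, Nat.cast_ofNat]
  generalize Real.sqrt (tfs ϖ μ (‖z‖ ^ 2) ^ 2 + κ ^ 2) = q at *
  generalize Real.sqrt (prof κ (tfs ϖ μ (‖z‖ ^ 2))) = r at *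
  rw [← h6]
  field_simp

/-- The squared gradient of the amplitude. -/
def gradSq (κ ϖ μ : ℝ) (z : ℂ) : ℝ :=
  fderiv ℝ (amp κ ϖ μ) z 1 ^ 2 + fderiv ℝ (amp κ ϖ μ) z Complex.I ^ 2

lemma continuous_gradSq (hκ : 0 < κ) : Continuous (gradSq κ ϖ μ) := by
  have h := contDiff_amp (ϖ := ϖ) (μ := μ) hκ
  have h1 := (h.continuous_fderiv one_ne_zero).clm_apply (continuous_const (y := (1 : ℂ)))
  have h2 := (h.continuous_fderiv one_ne_zero).clm_apply (continuous_const (y := Complex.I))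
  unfold gradSq
  fun_prop

/-- As the profile has logarithmic derivative `1 / q`, with `q = √(s² + κ²)`, the squared gradient
equals `ϖ⁴ |z|² / 64` times `r / q²`. Then `r ≤ q` and `|z| ≤ 1`. -/
lemma gradSq_le (hκ : 0 < κ) {z : ℂ} (hz : z ∈ disc) :
    gradSq κ ϖ μ z ≤ ϖ ^ 4 / 64 / Real.sqrt (tfs ϖ μ (‖z‖ ^ 2) ^ 2 + κ ^ 2) := by
  unfold gradSq
  rw [fderiv_amp hκ, fderiv_amp hκ]
  have h0 : inner ℝ z 1 ^ 2 + inner ℝ z Complex.I ^ 2 = ‖z‖ ^ 2 := by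
    rw [Complex.sq_norm, Complex.normSq_apply]
    simp [Complex.inner]
    ring
  have h1 := prof_le_sqrt hκ (tfs ϖ μ (‖z‖ ^ 2))
  have h2 : 0 < Real.sqrt (tfs ϖ μ (‖z‖ ^ 2) ^ 2 + κ ^ 2) := Real.sqrt_pos.2 (sq_add_sq_pos hκ _)
  have h3 := Real.sq_sqrt (prof_pos hκ (tfs ϖ μ (‖z‖ ^ 2))).le
  have h4 := norm_sq_le_one_of_mem_disc hz
  unfold dens
  generalize Real.sqrt (tfs ϖ μ (‖z‖ ^ 2) ^ 2 + κ ^ 2) = q at *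
  generalize Real.sqrt (prof κ (tfs ϖ μ (‖z‖ ^ 2))) = r at *
  rw [← h3] at h1
  generalize inner ℝ z 1 = a at *
  generalize inner ℝ z Complex.I = b at *
  have e : (r / (2 * q) * (ϖ ^ 2 / 8) * (2 * a)) ^ 2 + (r / (2 * q) * (ϖ ^ 2 / 8) * (2 * b)) ^ 2
      = ϖ ^ 4 / 64 / q * (r ^ 2 / q * (a ^ 2 + b ^ 2)) := by
    field_simp
    ring
  rw [e]
  have h5 : r ^ 2 / q ≤ 1 := (div_le_one h2).2 h1
  refine mul_le_of_le_one_right (by positivity) ?_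
  rw [h0]
  exact mul_le_one₀ h5 (by positivity) h4

lemma arsinh_le {x : ℝ} (hx : 0 ≤ x) : Real.arsinh x ≤ Real.log (1 + 2 * x) := by
  unfold Real.arsinh
  refine Real.log_le_log (by positivity) ?_
  have : Real.sqrt (1 + x ^ 2) ≤ 1 + x := by
    rw [Real.sqrt_le_left (by positivity)]
    nlinarith
  linarith

/-- In `p = r²` the argument `s` is affine with slope `ϖ² / 8`, so integrating the bound of
`gradSq_le` gives `arsinh` of the boundary values of `s / κ`: a logarithm instead of a power of `1 /
κ`. -/
lemma integral_gradSq_le (hκ : 0 < κ) (hκ1 : κ ≤ 1 / 10) (hϖ : 0 < ϖ)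
    (hn : ∫ z in disc, dens κ ϖ μ z = 1) :
    ∫ z in disc, gradSq κ ϖ μ z ≤ Real.pi * (ϖ ^ 2 / 8)
      * (Real.log (1 + 2 * ((2 + ϖ) / κ)) + Real.log (1 + 2 * (ϖ ^ 2 / (8 * κ)))) := by
  have hq : ∀ p, 0 < Real.sqrt (tfs ϖ μ p ^ 2 + κ ^ 2) := fun p =>
    Real.sqrt_pos.2 (sq_add_sq_pos hκ _)
  have hc : Continuous fun p => ϖ ^ 4 / 64 / Real.sqrt (tfs ϖ μ p ^ 2 + κ ^ 2) := by
    have := continuous_tfs ϖ μ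
    exact continuous_const.div (by fun_prop) fun p => (hq p).ne'
  have hc' : Continuous fun p => ϖ ^ 2 / 8 / Real.sqrt (tfs ϖ μ p ^ 2 + κ ^ 2) := by
    have := continuous_tfs ϖ μ
    exact continuous_const.div (by fun_prop) fun p => (hq p).ne'
  have h1 : ∫ z in disc, gradSq κ ϖ μ z
      ≤ ∫ z in disc, ϖ ^ 4 / 64 / Real.sqrt (tfs ϖ μ (‖z‖ ^ 2) ^ 2 + κ ^ 2) :=
    setIntegral_mono_on (integrableOn_disc (continuous_gradSq hκ))
      (integrableOn_disc (hc.comp (continuous_norm.pow 2))) measurableSet_disc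
      fun z hz => gradSq_le hκ hz
  rw [integral_disc_radial hc] at h1
  have h2 : ∫ p in (0 : ℝ)..1, ϖ ^ 2 / 8 / Real.sqrt (tfs ϖ μ p ^ 2 + κ ^ 2)
      = Real.arsinh (tfs ϖ μ 1 / κ) - Real.arsinh (tfs ϖ μ 0 / κ) := by
    refine intervalIntegral.integral_eq_sub_of_hasDerivAt
      (f := fun p => Real.arsinh (tfs ϖ μ p / κ)) (fun p _ => ?_) (hc'.intervalIntegrable _ _)
    have h2 := hasDerivAt_tfs ϖ μ p
    refine ((h2.div_const κ).arsinh).congr_deriv ?_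
    have : Real.sqrt (tfs ϖ μ p ^ 2 + κ ^ 2) = κ * Real.sqrt (1 + (tfs ϖ μ p / κ) ^ 2) := by
      rw [← Real.sqrt_sq hκ.le, ← Real.sqrt_mul (by positivity), Real.sqrt_sq hκ.le]
      congr 1
      field_simp
      ring
    rw [this, smul_eq_mul]
    field_simp
  have h3 : ∫ p in (0 : ℝ)..1, ϖ ^ 4 / 64 / Real.sqrt (tfs ϖ μ p ^ 2 + κ ^ 2)
      = ϖ ^ 2 / 8 * (Real.arsinh (tfs ϖ μ 1 / κ) - Real.arsinh (tfs ϖ μ 0 / κ)) := by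
    rw [← h2, ← intervalIntegral.integral_const_mul]
    congr 1
    ext p
    ring
  rw [h3] at h1
  refine h1.trans ?_
  rw [mul_assoc]
  refine mul_le_mul_of_nonneg_left (mul_le_mul_of_nonneg_left ?_ (by positivity)) Real.pi_pos.le
  have hS := tfs_one_le hκ hϖ.le hn
  have hS0 := tfs_one_pos hκ hκ1 hn
  have h4 : Real.arsinh (tfs ϖ μ 1 / κ) ≤ Real.log (1 + 2 * ((2 + ϖ) / κ)) :=
    (Real.arsinh_le_arsinh.2 (by gcongr)).trans (arsinh_le (by positivity))
  -- At the centre `s` may be very negative, but not below `-ϖ² / 8`, since it is positive at the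
  -- boundary.
  have h5 : -Real.arsinh (tfs ϖ μ 0 / κ) ≤ Real.log (1 + 2 * (ϖ ^ 2 / (8 * κ))) := by
    rw [← Real.arsinh_neg]
    refine (Real.arsinh_le_arsinh.2 ?_).trans (arsinh_le (by positivity))
    have e : tfs ϖ μ 1 = ϖ ^ 2 / 8 + tfs ϖ μ 0 := by unfold tfs; ring
    rw [← neg_div, div_le_div_iff₀ hκ (by positivity)]
    have : -tfs ϖ μ 0 ≤ ϖ ^ 2 / 8 := by linarith
    nlinarith
  linarith

end amp

/-! ### The single mode and the vortex lattice. -/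

section cutoff

variable {R : ℝ} {F F' : ℝ → ℝ}

/-- At `|x| = R` both the value and the derivative of `F` vanish, so `F` is `o(|y - x|)`, and
cutting off only decreases its absolute value. -/
lemma hasDerivAt_ite_abs_le (hF : ∀ x, HasDerivAt F (F' x) x)
    (h0 : ∀ x, |x| = R → F x = 0) (h1 : ∀ x, |x| = R → F' x = 0) (x : ℝ) :
    HasDerivAt (fun y => if |y| ≤ R then F y else 0) (if |x| ≤ R then F' x else 0) x := by
  rcases lt_trichotomy |x| R with h | h | h
  · rw [if_pos h.le]
    refine (hF x).congr_of_eventuallyEq ?_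
    filter_upwards [continuous_abs.continuousAt.eventually_lt continuousAt_const h] with y hy
    rw [if_pos hy.le]
  · rw [if_pos h.le, h1 x h, hasDerivAt_iff_isLittleO]
    have h2 := hF x
    rw [h1 x h, hasDerivAt_iff_isLittleO] at h2
    refine Asymptotics.IsBigO.trans_isLittleO (Asymptotics.isBigO_of_le _ fun y => ?_) h2
    simp only [h0 x h, h.le, if_true, smul_zero, sub_zero]
    split_ifs
    · exact le_rfl
    · simp
  · rw [if_neg h.not_ge]
    refine (hasDerivAt_const x (0 : ℝ)).congr_of_eventuallyEq ?_
    filter_upwards [continuousAt_const.eventually_lt continuous_abs.continuousAt h] with y hy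
    rw [if_neg hy.not_ge]

lemma continuous_ite_abs_le (hF : Continuous F) (h0 : ∀ x, |x| = R → F x = 0) :
    Continuous fun x => if |x| ≤ R then F x else 0 :=
  Continuous.if_le hF continuous_const continuous_abs continuous_const h0

end cutoff

/-- The interpolation angle between neighbouring modes. -/
def ang (η : ℝ) : ℝ := Real.pi / 4 * (1 - Real.cos η)

/-- The profile of a single mode. -/
def bump (η : ℝ) : ℝ := if |η| ≤ Real.pi then Real.cos (ang η) else 0

/-- The derivative of the profile of a single mode. -/
def bumpDeriv (η : ℝ) : ℝ :=
  if |η| ≤ Real.pi then -Real.sin (ang η) * (Real.pi / 4 * Real.sin η) else 0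

lemma hasDerivAt_ang (η : ℝ) : HasDerivAt ang (Real.pi / 4 * Real.sin η) η := by
  exact (((Real.hasDerivAt_cos η).const_sub 1).const_mul (Real.pi / 4)).congr_deriv (by ring)

lemma cos_of_abs_eq_pi {x : ℝ} (hx : |x| = Real.pi) : Real.cos x = -1 := by
  rw [← Real.cos_abs, hx, Real.cos_pi]

lemma sin_of_abs_eq_pi {x : ℝ} (hx : |x| = Real.pi) : Real.sin x = 0 := by
  rcases eq_or_eq_neg_of_abs_eq hx with rfl | rfl <;> simp

lemma continuous_ang : Continuous ang := by
  unfold ang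
  fun_prop

lemma hasDerivAt_bump (η : ℝ) : HasDerivAt bump (bumpDeriv η) η := by
  refine hasDerivAt_ite_abs_le (F := fun η => Real.cos (ang η))
    (F' := fun η => -Real.sin (ang η) * (Real.pi / 4 * Real.sin η))
    (fun x => (hasDerivAt_ang x).cos) (fun x hx => ?_) (fun x hx => ?_) η
  · have : ang x = Real.pi / 2 := by
      rw [ang, cos_of_abs_eq_pi hx]
      ring
    simp [this]
  · simp [sin_of_abs_eq_pi hx]

lemma continuous_bumpDeriv : Continuous bumpDeriv := by
  have := continuous_ang
  refine continuous_ite_abs_le (F := fun η => -Real.sin (ang η) * (Real.pi / 4 * Real.sin η))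
    (by fun_prop) fun x hx => ?_
  simp [sin_of_abs_eq_pi hx]

lemma contDiff_bump : ContDiff ℝ 1 bump := by
  rw [contDiff_one_iff_deriv]
  refine ⟨fun η => (hasDerivAt_bump η).differentiableAt, ?_⟩
  have : deriv bump = bumpDeriv := funext fun η => (hasDerivAt_bump η).deriv
  rw [this]
  exact continuous_bumpDeriv

lemma bump_of_pi_le {η : ℝ} (h : Real.pi ≤ |η|) : bump η = 0 := by
  unfold bump
  split_ifs with h1
  · have : ang η = Real.pi / 2 := by
      rw [ang, cos_of_abs_eq_pi (le_antisymm h1 h)]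
      ring
    simp [this]
  · rfl

lemma bumpDeriv_of_pi_le {η : ℝ} (h : Real.pi ≤ |η|) : bumpDeriv η = 0 := by
  unfold bumpDeriv
  split_ifs with h1
  · simp [sin_of_abs_eq_pi (le_antisymm h1 h)]
  · rfl

/-- A function with one zero per lattice cell and doubly periodic modulus. -/
def vort (N : ℕ) (v η : ℝ) : ℂ :=
  ∑ k ∈ Finset.Icc (-(N : ℤ)) N,
    (bump (η - k * Real.pi) : ℂ) * Complex.exp (-(Complex.I * k * v))

/-- The derivative of `vort` in `v`; `vortE` is the one in `η`. -/
def vortV (N : ℕ) (v η : ℝ) : ℂ :=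
  ∑ k ∈ Finset.Icc (-(N : ℤ)) N,
    (bump (η - k * Real.pi) : ℂ) * (Complex.exp (-(Complex.I * k * v)) * -(Complex.I * k))

def vortE (N : ℕ) (v η : ℝ) : ℂ :=
  ∑ k ∈ Finset.Icc (-(N : ℤ)) N,
    (bumpDeriv (η - k * Real.pi) : ℂ) * Complex.exp (-(Complex.I * k * v))

lemma hasDerivAt_vort_left (N : ℕ) (v η : ℝ) :
    HasDerivAt (fun v => vort N v η) (vortV N v η) v := by
  unfold vort vortV
  refine HasDerivAt.fun_sum fun k _ => ?_
  refine HasDerivAt.const_mul _ (HasDerivAt.cexp ?_)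
  exact (((Complex.ofRealCLM.hasDerivAt (x := v)).const_mul (Complex.I * (k : ℂ))).neg).congr_deriv
    (by simp)

lemma hasDerivAt_vort_right (N : ℕ) (v η : ℝ) :
    HasDerivAt (fun η => vort N v η) (vortE N v η) η := by
  unfold vort vortE
  refine HasDerivAt.fun_sum fun k _ => ?_
  refine HasDerivAt.mul_const ?_ _
  exact ((hasDerivAt_bump _).comp_sub_const η (k * Real.pi)).ofReal_comp

lemma contDiff_vort (N : ℕ) {f g : ℂ → ℝ} (hf : ContDiff ℝ 1 f) (hg : ContDiff ℝ 1 g) :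
    ContDiff ℝ 1 fun z => vort N (f z) (g z) := by
  unfold vort
  refine ContDiff.sum fun k _ => ?_
  have h1 : ContDiff ℝ 1 fun z => (bump (g z - k * Real.pi) : ℂ) :=
    Complex.ofRealCLM.contDiff.comp (contDiff_bump.comp (hg.sub contDiff_const))
  have h2 : ContDiff ℝ 1 fun z => (f z : ℂ) := Complex.ofRealCLM.contDiff.comp hf
  exact h1.mul (contDiff_const.mul h2).neg.cexp

/-- Only two modes are present at each height. -/
lemma sum_modes {N : ℕ} {n : ℤ} (h1 : -(N : ℤ) ≤ n) (h2 : n + 1 ≤ N) {η : ℝ}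
    (h3 : n * Real.pi ≤ η) (h4 : η ≤ (n + 1) * Real.pi) {h : ℤ → ℂ}
    (h0 : ∀ k : ℤ, Real.pi ≤ |η - k * Real.pi| → h k = 0) :
    ∑ k ∈ Finset.Icc (-(N : ℤ)) N, h k = h n + h (n + 1) := by
  rw [← Finset.sum_pair (show n ≠ n + 1 by lia)]
  symm
  refine Finset.sum_subset (fun k hk => ?_) fun k _ hk => ?_
  · simp only [Finset.mem_insert, Finset.mem_singleton] at hk
    rw [Finset.mem_Icc]
    lia
  · simp only [Finset.mem_insert, Finset.mem_singleton, not_or] at hk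
    apply h0
    have hπ := Real.pi_pos
    rcases lt_or_gt_of_ne hk.1 with h | h
    · have : (k : ℝ) + 1 ≤ n := by exact_mod_cast h
      refine le_trans ?_ (le_abs_self _)
      nlinarith
    · have h5 : n + 2 ≤ k := by lia
      have : (n : ℝ) + 2 ≤ k := by exact_mod_cast h5
      refine le_trans ?_ (neg_le_abs _)
      nlinarith

/-- The squared modulus of `vort`. -/
def vortSq (v η : ℝ) : ℝ := 1 + Real.cos (Real.pi / 2 * Real.cos η) * Real.cos v

lemma vortSq_nonneg (v η : ℝ) : 0 ≤ vortSq v η := by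
  unfold vortSq
  nlinarith [Real.neg_one_le_cos v, Real.cos_le_one v,
    Real.neg_one_le_cos (Real.pi / 2 * Real.cos η), Real.cos_le_one (Real.pi / 2 * Real.cos η)]

/-! ### Regularising the vortex cores. -/

/-- Upper bound for the kinetic energy density of the regularised vortex lattice. -/
def cap (T M : ℝ) : ℝ := 1 / (2 * (M + T)) + 5 * T / (2 * (M + T) ^ 2) + 1 / 4

/-- The regularising factor. -/
def reg (T M : ℝ) : ℝ := Real.sqrt (M + 2 * T) / (M + T)

def regDeriv (T M : ℝ) : ℝ := -(M + 3 * T) / (2 * (M + T) ^ 2 * Real.sqrt (M + 2 * T))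

section reg

variable {T M : ℝ}

lemma hasDerivAt_reg (hT : 0 < T) (hM : 0 ≤ M) : HasDerivAt (reg T) (regDeriv T M) M := by
  have h0 : 0 < M + 2 * T := by linarith
  have h1 : 0 < M + T := by linarith
  have h2 := (((hasDerivAt_id M).add_const (2 * T)).sqrt h0.ne').div
    ((hasDerivAt_id M).add_const T) h1.ne'
  refine HasDerivAt.congr_deriv (f := reg T) h2 ?_
  have h3 : Real.sqrt (M + 2 * T) ≠ 0 := (Real.sqrt_pos.2 h0).ne'
  have h4 := Real.sq_sqrt h0.le
  unfold regDeriv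
  simp only [id]
  generalize Real.sqrt (M + 2 * T) = q at *
  have h5 : M = q ^ 2 - 2 * T := by linarith
  field_simp
  rw [h5]
  ring

lemma reg_sq (hT : 0 < T) (hM : 0 ≤ M) : reg T M ^ 2 = (M + 2 * T) / (M + T) ^ 2 := by
  unfold reg
  rw [div_pow, Real.sq_sqrt (by linarith)]

lemma reg_mul_regDeriv (hT : 0 < T) (hM : 0 ≤ M) :
    reg T M * regDeriv T M = -(M + 3 * T) / (2 * (M + T) ^ 3) := by
  have h0 : 0 < M + 2 * T := by linarith
  have h1 : 0 < M + T := by linarith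
  have h3 : Real.sqrt (M + 2 * T) ≠ 0 := (Real.sqrt_pos.2 h0).ne'
  unfold reg regDeriv
  field_simp

lemma regDeriv_sq (hT : 0 < T) (hM : 0 ≤ M) :
    regDeriv T M ^ 2 = (M + 3 * T) ^ 2 / (4 * (M + T) ^ 4 * (M + 2 * T)) := by
  unfold regDeriv
  rw [div_pow, mul_pow, Real.sq_sqrt (by linarith)]
  ring

/-- The regularised squared modulus misses 1 by `T² / (M + T)²`, which integrates to `O(T)` over a
cell. The simpler `M / (M + T)` would lose `T log (1/T)`, and after multiplication by a penalty of
order `Ω / T` this would spoil the leading term. -/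
lemma reg_sq_mul (hT : 0 < T) (hM : 0 ≤ M) :
    reg T M ^ 2 * M = 1 - T ^ 2 / (M + T) ^ 2 := by
  have h1 : 0 < M + T := by linarith
  rw [reg_sq hT hM]
  field_simp
  ring

end reg

/-- The coefficient of the squared radial derivative in the energy density. -/
def radCoeff (T M : ℝ) : ℝ :=
  (M + 3 * T) * ((M + T) ^ 2 + (M + T) * T + 2 * T ^ 2) / (4 * (M + T) ^ 4 * (M + 2 * T))

section radCoeff

variable {T M : ℝ}

lemma radCoeff_nonneg (hT : 0 < T) (hM : 0 ≤ M) : 0 ≤ radCoeff T M := by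
  unfold radCoeff
  positivity

/-- Up to a term concentrated in the core, `4 radCoeff T M * M` is `reg T M ^ 2`. Thus the
correction in `normSq_regDir` removes almost all of the gradient component along `g`. -/
lemma radCoeff_mul (hT : 0 < T) (hM : 0 ≤ M) : radCoeff T M * M
    = (M + 2 * T) / (4 * (M + T) ^ 2) - T ^ 4 / ((M + T) ^ 4 * (M + 2 * T)) := by
  have h0 : 0 < M + 2 * T := by linarith
  have h1 : 0 < M + T := by linarith
  unfold radCoeff
  field_simp
  ring

lemma four_radCoeff_mul_le (hT : 0 < T) (hM : 0 ≤ M) :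
    4 * (radCoeff T M * M) ≤ (M + 2 * T) / (M + T) ^ 2 := by
  have h1 : 0 < M + T := by linarith
  have e : (M + 2 * T) / (M + T) ^ 2 - 4 * (radCoeff T M * M)
      = 4 * (T ^ 4 / ((M + T) ^ 4 * (M + 2 * T))) := by
    rw [radCoeff_mul hT hM]
    field_simp
    ring
  have : 0 ≤ T ^ 4 / ((M + T) ^ 4 * (M + 2 * T)) := by positivity
  linarith

/-- Subtracting half of the coefficient leaves half of `(M + 2T) / (M + T)²`, whose leading part is
`1 / (2 (M + T))`. The term in `T⁴` is absorbed by `5T / (2 (M + T)²)`. -/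
lemma sub_two_radCoeff_mul_le (hT : 0 < T) (hM : 0 ≤ M) :
    (M + 2 * T) / (M + T) ^ 2 - 2 * (radCoeff T M * M)
      ≤ 1 / (2 * (M + T)) + 5 * T / (2 * (M + T) ^ 2) := by
  have h1 : 0 < M + T := by linarith
  rw [radCoeff_mul hT hM]
  have e : T ^ 4 / ((M + T) ^ 4 * (M + 2 * T)) ≤ T / (M + T) ^ 2 := by
    rw [div_le_div_iff₀ (by positivity) (by positivity)]
    have h6 : T ^ 3 ≤ (M + T) ^ 2 * (M + 2 * T) := by
      have h8 : T ^ 2 ≤ (M + T) ^ 2 := pow_le_pow_left₀ hT.le (by linarith) 2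
      have h7 : T ≤ M + 2 * T := by linarith
      calc T ^ 3 = T ^ 2 * T := by ring
        _ ≤ _ := mul_le_mul h8 h7 hT.le (by positivity)
    have h9 : 0 ≤ T * (M + T) ^ 2 := by positivity
    calc T ^ 4 * (M + T) ^ 2 = T * (M + T) ^ 2 * T ^ 3 := by ring
      _ ≤ T * (M + T) ^ 2 * ((M + T) ^ 2 * (M + 2 * T)) := mul_le_mul_of_nonneg_left h6 h9
      _ = _ := by ring
  have e2 : 1 / (2 * (M + T)) + 5 * T / (2 * (M + T) ^ 2)
    - ((M + 2 * T) / (M + T) ^ 2 - 2 * ((M + 2 * T) / (4 * (M + T) ^ 2)))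
      = 2 * (T / (M + T) ^ 2) := by
    field_simp
    ring
  linarith

/-- The derivative of `reg T |g|² g` in a direction in which `g` has derivative `X`. -/
def regDir (T : ℝ) (g X : ℂ) : ℂ :=
  reg T (Complex.normSq g) * X
    + 2 * regDeriv T (Complex.normSq g) * (g.re * X.re + g.im * X.im) * g

lemma normSq_regDir (hT : 0 < T) (g X : ℂ) (hM : Complex.normSq g = M) :
    Complex.normSq (regDir T g X) = reg T M ^ 2 * Complex.normSq X
      - 4 * radCoeff T M * (g.re * X.re + g.im * X.im) ^ 2 := by
  have hM0 : 0 ≤ M := hM ▸ Complex.normSq_nonneg g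
  have h0 : 0 < M + 2 * T := by linarith
  have h1 : 0 < M + T := by linarith
  have e1 := reg_mul_regDeriv hT hM0
  have e2 := regDeriv_sq hT hM0
  have e3 : regDir T g X = ⟨reg T M * X.re
      + 2 * regDeriv T M * (g.re * X.re + g.im * X.im) * g.re, reg T M * X.im
      + 2 * regDeriv T M * (g.re * X.re + g.im * X.im) * g.im⟩ := by
    unfold regDir
    rw [hM]
    apply Complex.ext <;> simp
  have e4 : Complex.normSq (regDir T g X) = reg T M ^ 2 * Complex.normSq X
      + 4 * (reg T M * regDeriv T M) * (g.re * X.re + g.im * X.im) ^ 2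
      + 4 * M * regDeriv T M ^ 2 * (g.re * X.re + g.im * X.im) ^ 2 := by
    rw [e3, ← hM]
    simp only [Complex.normSq_apply]
    ring
  rw [e4, e1, e2]
  have e5 : 4 * (-(M + 3 * T) / (2 * (M + T) ^ 3))
      + 4 * M * ((M + 3 * T) ^ 2 / (4 * (M + T) ^ 4 * (M + 2 * T)))
      = -(4 * radCoeff T M) := by
    unfold radCoeff
    field_simp
    ring
  linear_combination (g.re * X.re + g.im * X.im) ^ 2 * e5

end radCoeff

/-! ### The energy density in one lattice cell. -/

/-- The algebraic inequality behind the energy estimate in a lattice cell. -/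
lemma cell_ineq {T M a b X Y β χ : ℝ} (hT : 0 < T) (hab : a ^ 2 + b ^ 2 = 1)
    (hXY : X ^ 2 + Y ^ 2 = 1) (hM : M = 1 + 2 * a * b * X) (hM0 : 0 ≤ M)
    (hχ : χ ^ 2 ≤ 1 / 4) (hβ : β * (a ^ 2 - b ^ 2) ≤ 0) (hβ2 : β ^ 2 ≤ 1 / 4) :
    ((M + 2 * T) / (M + T) ^ 2) * (((2 - M) / 4 + β * (a ^ 2 - b ^ 2) + β ^ 2 * M)
        + χ ^ 2 * (2 - M))
      - 4 * radCoeff T M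
        * (a ^ 2 * b ^ 2 * Y ^ 2 + χ ^ 2 * (a ^ 2 - b ^ 2) ^ 2 * X ^ 2) ≤ cap T M := by
  have h0 : 0 < M + 2 * T := by linarith
  have h1 : 0 < M + T := by linarith
  have hκ0 := radCoeff_nonneg hT hM0
  have hκq := four_radCoeff_mul_le hT hM0
  have s5 := sub_two_radCoeff_mul_le hT hM0
  have hqM : (M + 2 * T) / (M + T) ^ 2 * M ≤ 1 := by
    rw [div_mul_eq_mul_div, div_le_one (by positivity)]
    nlinarith
  have hq0 : 0 ≤ (M + 2 * T) / (M + T) ^ 2 := by positivity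
  unfold cap
  set p := 1 / (2 * (M + T)) + 5 * T / (2 * (M + T) ^ 2)
  generalize (M + 2 * T) / (M + T) ^ 2 = q at *
  generalize radCoeff T M = κ at *
  have hX : X ^ 2 = 1 - Y ^ 2 := by linarith
  have hS : (a ^ 2 - b ^ 2) ^ 2 = 1 - 4 * (a ^ 2 * b ^ 2) := by
    linear_combination (a ^ 2 + b ^ 2 + 1) * hab
  have hM2 : M ≤ 2 := by
    have : 2 - M = (a - b * X) ^ 2 + (b * Y) ^ 2 := by
      rw [hM]
      linear_combination (-1) * hab - b ^ 2 * hXY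
    linarith [sq_nonneg (a - b * X), sq_nonneg (b * Y)]
  have s2 : (a ^ 2 - b ^ 2) ^ 2 * X ^ 2 ≤ M * (2 - M) := by
    have : M * (2 - M) - (a ^ 2 - b ^ 2) ^ 2 * X ^ 2 = Y ^ 2 := by
      rw [hS, hM]
      linear_combination (-1) * hXY
    linarith [sq_nonneg Y]
  have s2' : 4 * κ * ((a ^ 2 - b ^ 2) ^ 2 * X ^ 2) ≤ q * (2 - M) := by
    calc 4 * κ * ((a ^ 2 - b ^ 2) ^ 2 * X ^ 2) ≤ 4 * κ * (M * (2 - M)) :=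
          mul_le_mul_of_nonneg_left s2 (by positivity)
      _ = 4 * (κ * M) * (2 - M) := by ring
      _ ≤ q * (2 - M) := mul_le_mul_of_nonneg_right hκq (by linarith)
  -- The bracket is nonnegative by `s2'`, so `χ²` can be replaced by its maximum `1/4`.
  have s2'' : χ ^ 2 * (q * (2 - M) - 4 * κ * ((a ^ 2 - b ^ 2) ^ 2 * X ^ 2))
      ≤ 1 / 4 * (q * (2 - M) - 4 * κ * ((a ^ 2 - b ^ 2) ^ 2 * X ^ 2)) :=
    mul_le_mul_of_nonneg_right hχ (by linarith)
  -- The cross term has a favourable sign because the nearer mode carries the larger weight.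
  have s1 : q * ((2 - M) / 4 + β * (a ^ 2 - b ^ 2) + β ^ 2 * M) ≤ q * ((2 - M) / 4 + M / 4) := by
    refine mul_le_mul_of_nonneg_left ?_ hq0
    have := mul_le_mul_of_nonneg_right hβ2 hM0
    linarith
  -- The radial parts of the two derivatives together are bounded below by `2 M (1 - M)`; the
  -- difference is the perfect square `(2ab + X)²`. This is what halves the leading term from `1 /
  -- M` to `1 / (2 M)`.
  have s3 : κ * (2 * M * (1 - M))
      ≤ κ * (4 * (a ^ 2 * b ^ 2 * Y ^ 2) + (a ^ 2 - b ^ 2) ^ 2 * X ^ 2) := by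
    refine mul_le_mul_of_nonneg_left ?_ hκ0
    have e : 4 * (a ^ 2 * b ^ 2 * Y ^ 2) + (a ^ 2 - b ^ 2) ^ 2 * X ^ 2 - 2 * M * (1 - M)
        = (2 * a * b + X) ^ 2 := by
      rw [hS, hM]
      linear_combination 4 * (a ^ 2 * b ^ 2) * hXY
    linarith [sq_nonneg (2 * a * b + X)]
  have s4 : 2 * (κ * M) * M ≤ q / 2 * M := by
    refine mul_le_mul_of_nonneg_right ?_ hM0
    linarith
  linarith

/-- A shift by `π` flips the sign of the inner cosine and the outer one is even: the modulus repeats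
from strip to strip although the modes change. -/
lemma cos_pi_div_two_mul_cos_sub_int (η : ℝ) (n : ℤ) :
    Real.cos (Real.pi / 2 * Real.cos (η - n * Real.pi))
      = Real.cos (Real.pi / 2 * Real.cos η) := by
  rw [Real.cos_sub_int_mul_pi]
  rcases Int.even_or_odd n with h | h
  · simp [h.neg_one_zpow]
  · simp [h.neg_one_zpow]

/-- `vort` and its covariant derivatives in the strip between two neighbouring modes. -/
lemma vort_eq {N : ℕ} {n : ℤ} (h1 : -(N : ℤ) ≤ n) (h2 : n + 1 ≤ N) {η : ℝ}
    (h3 : n * Real.pi ≤ η) (h4 : η ≤ (n + 1) * Real.pi) (v : ℝ) :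
    vort N v η = Complex.exp (-(Complex.I * n * v)) *
        (Real.cos (ang (η - n * Real.pi))
          + Real.sin (ang (η - n * Real.pi)) * Complex.exp (-(Complex.I * v))) ∧
    vortV N v η + Complex.I * (η / Real.pi : ℝ) * vort N v η
      = Complex.exp (-(Complex.I * n * v)) * (Complex.I *
        ((η / Real.pi - n : ℝ) * Real.cos (ang (η - n * Real.pi))
          + (η / Real.pi - n - 1 : ℝ) * Real.sin (ang (η - n * Real.pi))
            * Complex.exp (-(Complex.I * v)))) ∧
    vortE N v η = Complex.exp (-(Complex.I * n * v)) *
        ((Real.pi / 4 * Real.sin (η - n * Real.pi) : ℝ) * (-Real.sin (ang (η - n * Real.pi))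
          + Real.cos (ang (η - n * Real.pi)) * Complex.exp (-(Complex.I * v)))) := by
  have hπ := Real.pi_pos
  have ha : |η - n * Real.pi| ≤ Real.pi := by
    rw [abs_le]
    constructor <;> linarith
  have hb : |η - (n + 1 : ℤ) * Real.pi| ≤ Real.pi := by
    rw [abs_le]
    push_cast
    constructor <;> linarith
  have e0 : η - (n + 1 : ℤ) * Real.pi = η - n * Real.pi - Real.pi := by
    push_cast
    ring
  -- The angles of neighbouring modes are complementary, so their weights are the cosine and sine of
  -- one angle and have square sum 1.
  have e1 : ang (η - (n + 1 : ℤ) * Real.pi) = Real.pi / 2 - ang (η - n * Real.pi) := by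
    rw [e0]
    unfold ang
    rw [Real.cos_sub_pi]
    ring
  have b1 : bump (η - n * Real.pi) = Real.cos (ang (η - n * Real.pi)) := if_pos ha
  have b2 : bump (η - (n + 1 : ℤ) * Real.pi) = Real.sin (ang (η - n * Real.pi)) := by
    rw [bump, if_pos hb, e1, Real.cos_pi_div_two_sub]
  have b3 : bumpDeriv (η - n * Real.pi)
      = -Real.sin (ang (η - n * Real.pi)) * (Real.pi / 4 * Real.sin (η - n * Real.pi)) :=
    if_pos ha
  have b4 : bumpDeriv (η - (n + 1 : ℤ) * Real.pi)
      = Real.cos (ang (η - n * Real.pi)) * (Real.pi / 4 * Real.sin (η - n * Real.pi)) := by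
    rw [bumpDeriv, if_pos hb, e1, Real.sin_pi_div_two_sub, e0, Real.sin_sub_pi]
    ring
  have ee : Complex.exp (-(Complex.I * (n + 1 : ℤ) * v))
      = Complex.exp (-(Complex.I * n * v)) * Complex.exp (-(Complex.I * v)) := by
    rw [← Complex.exp_add]
    congr 1
    push_cast
    ring
  have g1 : vort N v η = Complex.exp (-(Complex.I * n * v)) *
        (Real.cos (ang (η - n * Real.pi))
          + Real.sin (ang (η - n * Real.pi)) * Complex.exp (-(Complex.I * v))) := by
    rw [vort, sum_modes h1 h2 h3 h4 fun k hk => by rw [bump_of_pi_le hk]; simp, b1, b2, ee]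
    ring
  refine ⟨g1, ?_, ?_⟩
  · rw [g1, vortV, sum_modes h1 h2 h3 h4 fun k hk => by rw [bump_of_pi_le hk]; simp, b1, b2, ee]
    push_cast
    ring
  · rw [vortE, sum_modes h1 h2 h3 h4 fun k hk => by rw [bumpDeriv_of_pi_le hk]; simp, b3, b4, ee]
    push_cast
    ring

lemma normSq_phase (t : ℝ) : Complex.normSq (Complex.exp (-(Complex.I * t))) = 1 := by
  rw [← Complex.sq_norm]
  have : -(Complex.I * t) = ((-t : ℝ) : ℂ) * Complex.I := by
    push_cast
    ring
  rw [this, Complex.norm_exp_ofReal_mul_I, one_pow]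

lemma phase_mul_re_add {E g X : ℂ} (hE : Complex.normSq E = 1) :
    (E * g).re * (E * X).re + (E * g).im * (E * X).im = g.re * X.re + g.im * X.im := by
  rw [Complex.normSq_apply] at hE
  simp only [Complex.mul_re, Complex.mul_im]
  linear_combination (g.re * X.re + g.im * X.im) * hE

lemma normSq_phase_mul {E : ℂ} (hE : Complex.normSq E = 1) (X : ℂ) :
    Complex.normSq (E * X) = Complex.normSq X := by
  rw [Complex.normSq_mul, hE, one_mul]

lemma exists_strip {N : ℕ} {η : ℝ} (h : |η| < N * Real.pi) :
    ∃ n : ℤ, -(N : ℤ) ≤ n ∧ n + 1 ≤ N ∧ n * Real.pi ≤ η ∧ η ≤ (n + 1) * Real.pi := by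
  have hπ := Real.pi_pos
  rw [abs_lt] at h
  have e1 : (⌊η / Real.pi⌋ : ℝ) * Real.pi ≤ η := by
    rw [← le_div_iff₀ hπ]
    exact Int.floor_le _
  have e2 : η ≤ ((⌊η / Real.pi⌋ : ℝ) + 1) * Real.pi := by
    rw [← div_le_iff₀ hπ]
    exact (Int.lt_floor_add_one _).le
  refine ⟨⌊η / Real.pi⌋, ?_, ?_, e1, e2⟩
  · rw [Int.le_floor, le_div_iff₀ hπ]
    push_cast
    linarith
  · rw [Int.add_one_le_iff, Int.floor_lt, div_lt_iff₀ hπ]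
    exact_mod_cast h.2

lemma cexp_neg_I_mul (v : ℝ) :
    Complex.exp (-(Complex.I * v)) = ⟨Real.cos v, -Real.sin v⟩ := by
  have : -(Complex.I * v) = ((-v : ℝ) : ℂ) * Complex.I := by
    push_cast
    ring
  rw [this, Complex.exp_mul_I]
  apply Complex.ext <;>
    simp [Complex.cos_ofReal_re, Complex.sin_ofReal_re, Complex.cos_ofReal_im,
      Complex.sin_ofReal_im]

lemma normSq_vort {N : ℕ} {η : ℝ} (h : |η| < N * Real.pi) (v : ℝ) :
    Complex.normSq (vort N v η) = vortSq v η := by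
  obtain ⟨n, h1, h2, h3, h4⟩ := exists_strip h
  have hE : Complex.normSq (Complex.exp (-(Complex.I * n * v))) = 1 := by
    have := normSq_phase (n * v)
    push_cast at this
    rwa [← mul_assoc] at this
  rw [(vort_eq h1 h2 h3 h4 v).1, Complex.normSq_mul, hE, one_mul, cexp_neg_I_mul]
  have hs : 2 * Real.sin (ang (η - n * Real.pi)) * Real.cos (ang (η - n * Real.pi))
      = Real.cos (Real.pi / 2 * Real.cos η) := by
    rw [← Real.sin_two_mul, ← cos_pi_div_two_mul_cos_sub_int η n, ← Real.sin_pi_div_two_sub]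
    congr 1
    unfold ang
    ring
  have hab := Real.sin_sq_add_cos_sq (ang (η - n * Real.pi))
  have hXY := Real.sin_sq_add_cos_sq v
  unfold vortSq
  rw [← hs]
  simp only [Complex.normSq_apply, Complex.add_re, Complex.add_im, Complex.re_ofReal_mul,
    Complex.im_ofReal_mul, Complex.ofReal_re, Complex.ofReal_im]
  linear_combination hab + Real.sin (ang (η - n * Real.pi)) ^ 2 * hXY

/-- The kinetic energy density of the regularised vortex lattice. -/
lemma normSq_regDir_add_le {T : ℝ} (hT : 0 < T) {N : ℕ} {η : ℝ} (h : |η| < N * Real.pi) (v : ℝ) :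
    Complex.normSq (regDir T (vort N v η)
        (vortV N v η + Complex.I * (η / Real.pi : ℝ) * vort N v η))
      + 4 / Real.pi ^ 2 * Complex.normSq (regDir T (vort N v η) (vortE N v η))
      ≤ cap T (vortSq v η) := by
  have hg := normSq_vort h v
  obtain ⟨n, h1, h2, h3, h4⟩ := exists_strip h
  have hE : Complex.normSq (Complex.exp (-(Complex.I * n * v))) = 1 := by
    have := normSq_phase (n * v)
    push_cast at this
    rwa [← mul_assoc] at this
  obtain ⟨e1, e2, e3⟩ := vort_eq h1 h2 h3 h4 v
  have hM0 := vortSq_nonneg v η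
  have hs : 2 * Real.sin (ang (η - n * Real.pi)) * Real.cos (ang (η - n * Real.pi))
      = Real.cos (Real.pi / 2 * Real.cos η) := by
    rw [← Real.sin_two_mul, ← cos_pi_div_two_mul_cos_sub_int η n, ← Real.sin_pi_div_two_sub]
    congr 1
    unfold ang
    ring
  have hd : Real.cos (ang (η - n * Real.pi)) ^ 2 - Real.sin (ang (η - n * Real.pi)) ^ 2
      = Real.sin (Real.pi / 2 * Real.cos (η - n * Real.pi)) := by
    rw [← Real.cos_two_mul', ← Real.cos_pi_div_two_sub]
    congr 1
    unfold ang
    ring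
  have hab := Real.cos_sq_add_sin_sq (ang (η - n * Real.pi))
  have hXY := Real.cos_sq_add_sin_sq v
  have hM : vortSq v η = 1 + 2 * Real.cos (ang (η - n * Real.pi))
      * Real.sin (ang (η - n * Real.pi)) * Real.cos v := by
    unfold vortSq
    rw [← hs]
    ring
  have hπ := Real.pi_pos
  set θ := η - n * Real.pi with hθ
  have hα : η / Real.pi - n = θ / Real.pi := by
    rw [hθ]
    field_simp
  have hθ0 : 0 ≤ θ := by linarith
  have hθ1 : θ ≤ Real.pi := by linarith
  -- Both factors change sign at mid-strip, `θ = π/2`, in opposite directions.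
  have hβ : (θ / Real.pi - 1 / 2) * (Real.cos (ang θ) ^ 2 - Real.sin (ang θ) ^ 2) ≤ 0 := by
    rw [hd]
    rcases le_total θ (Real.pi / 2) with hle | hle
    · refine mul_nonpos_of_nonpos_of_nonneg ?_ ?_
      · rw [sub_nonpos, div_le_iff₀ hπ]
        linarith
      · have := Real.cos_nonneg_of_neg_pi_div_two_le_of_le (x := θ) (by linarith) hle
        exact Real.sin_nonneg_of_nonneg_of_le_pi (by positivity)
          (by nlinarith [Real.cos_le_one θ])
    · refine mul_nonpos_of_nonneg_of_nonpos ?_ ?_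
      · rw [sub_nonneg, le_div_iff₀ hπ]
        linarith
      · have := Real.cos_nonpos_of_pi_div_two_le_of_le (x := θ) hle (by linarith)
        exact Real.sin_nonpos_of_nonpos_of_neg_pi_le (by nlinarith)
          (by nlinarith [Real.neg_one_le_cos θ])
  have hβ2 : (θ / Real.pi - 1 / 2) ^ 2 ≤ 1 / 4 := by
    have i1 : 0 ≤ θ / Real.pi := by positivity
    have i2 : θ / Real.pi ≤ 1 := (div_le_one hπ).2 hθ1
    nlinarith
  have hχ : (Real.sin θ / 2) ^ 2 ≤ 1 / 4 := by
    nlinarith [Real.sin_sq_le_one θ]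
  have key := cell_ineq hT hab hXY hM hM0 hχ hβ hβ2
  refine le_trans (le_of_eq ?_) key
  rw [normSq_regDir hT _ _ hg, normSq_regDir hT _ _ hg, e2, e3, e1, phase_mul_re_add hE,
    phase_mul_re_add hE, normSq_phase_mul hE, normSq_phase_mul hE, reg_sq hT hM0, hα]
  have hXY' : Real.sin v ^ 2 = 1 - Real.cos v ^ 2 := by linarith
  have hab' : Real.sin (ang θ) ^ 2 = 1 - Real.cos (ang θ) ^ 2 := by linarith
  rw [cexp_neg_I_mul]
  generalize (vortSq v η + 2 * T) / (vortSq v η + T) ^ 2 = q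
  generalize radCoeff T (vortSq v η) = κ
  rw [hM]
  generalize Real.cos (ang θ) = a at *
  generalize Real.sin (ang θ) = b at *
  generalize Real.cos v = X at *
  generalize Real.sin v = Y at *
  generalize Real.sin θ = σ at *
  have n1 : Complex.normSq (Complex.I * (((θ / Real.pi : ℝ) : ℂ) * (a : ℂ)
      + ((θ / Real.pi - 1 : ℝ) : ℂ) * (b : ℂ) * ⟨X, -Y⟩))
      = (2 - (1 + 2 * a * b * X)) / 4 + (θ / Real.pi - 1 / 2) * (a ^ 2 - b ^ 2)
        + (θ / Real.pi - 1 / 2) ^ 2 * (1 + 2 * a * b * X) := by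
    generalize θ / Real.pi = α
    rw [Complex.normSq_mul, Complex.normSq_I, one_mul, ← Complex.ofReal_mul, ← Complex.ofReal_mul]
    simp only [Complex.normSq_apply, Complex.add_re, Complex.add_im, Complex.re_ofReal_mul,
      Complex.im_ofReal_mul, Complex.ofReal_re, Complex.ofReal_im]
    linear_combination (1 / 4 + (α - 1 / 2) ^ 2) * hab + (α - 1) ^ 2 * b ^ 2 * hXY
  have n2 : 4 / Real.pi ^ 2 * Complex.normSq (((Real.pi / 4 * σ : ℝ) : ℂ) * (-(b : ℂ)
      + (a : ℂ) * ⟨X, -Y⟩)) = (σ / 2) ^ 2 * (2 - (1 + 2 * a * b * X)) := by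
    rw [Complex.normSq_mul, Complex.normSq_ofReal]
    simp only [Complex.normSq_apply, Complex.add_re, Complex.add_im, Complex.re_ofReal_mul,
      Complex.im_ofReal_mul, Complex.neg_re, Complex.neg_im, Complex.ofReal_re, Complex.ofReal_im]
    field_simp
    linear_combination 4 * σ ^ 2 * hab + 4 * σ ^ 2 * a ^ 2 * hXY
  have n3 : (((a : ℂ) + (b : ℂ) * ⟨X, -Y⟩).re * (Complex.I * (((θ / Real.pi : ℝ) : ℂ) * (a : ℂ)
      + ((θ / Real.pi - 1 : ℝ) : ℂ) * (b : ℂ) * ⟨X, -Y⟩)).re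
      + ((a : ℂ) + (b : ℂ) * ⟨X, -Y⟩).im * (Complex.I * (((θ / Real.pi : ℝ) : ℂ) * (a : ℂ)
      + ((θ / Real.pi - 1 : ℝ) : ℂ) * (b : ℂ) * ⟨X, -Y⟩)).im) ^ 2 = a ^ 2 * b ^ 2 * Y ^ 2 := by
    generalize θ / Real.pi = α
    rw [← Complex.ofReal_mul, ← Complex.ofReal_mul]
    simp only [Complex.I_mul_re, Complex.I_mul_im, Complex.add_re, Complex.add_im,
      Complex.re_ofReal_mul, Complex.im_ofReal_mul, Complex.ofReal_re, Complex.ofReal_im]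
    ring
  have n4 : 4 / Real.pi ^ 2 * (((a : ℂ) + (b : ℂ) * ⟨X, -Y⟩).re
      * (((Real.pi / 4 * σ : ℝ) : ℂ) * (-(b : ℂ) + (a : ℂ) * ⟨X, -Y⟩)).re
      + ((a : ℂ) + (b : ℂ) * ⟨X, -Y⟩).im
      * (((Real.pi / 4 * σ : ℝ) : ℂ) * (-(b : ℂ) + (a : ℂ) * ⟨X, -Y⟩)).im) ^ 2
      = (σ / 2) ^ 2 * (a ^ 2 - b ^ 2) ^ 2 * X ^ 2 := by
    have : ((a : ℂ) + (b : ℂ) * ⟨X, -Y⟩).re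
      * (((Real.pi / 4 * σ : ℝ) : ℂ) * (-(b : ℂ) + (a : ℂ) * ⟨X, -Y⟩)).re
      + ((a : ℂ) + (b : ℂ) * ⟨X, -Y⟩).im
      * (((Real.pi / 4 * σ : ℝ) : ℂ) * (-(b : ℂ) + (a : ℂ) * ⟨X, -Y⟩)).im
      = Real.pi / 4 * σ * ((a ^ 2 - b ^ 2) * X) := by
      simp only [Complex.add_re, Complex.add_im, Complex.re_ofReal_mul,
        Complex.im_ofReal_mul, Complex.neg_re, Complex.neg_im, Complex.ofReal_re,
        Complex.ofReal_im]
      linear_combination Real.pi / 4 * σ * (a * b) * hXY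
    rw [this]
    field_simp
    ring
  rw [n1, n3]
  linear_combination q * n2 - 4 * κ * n4

lemma continuous_cap_vortSq {T : ℝ} (hT : 0 < T) :
    Continuous fun p : ℝ × ℝ => cap T (vortSq p.1 p.2) := by
  have h : ∀ p : ℝ × ℝ, vortSq p.1 p.2 + T ≠ 0 := fun p => by
    have := vortSq_nonneg p.1 p.2
    linarith
  have hc : Continuous fun p : ℝ × ℝ => vortSq p.1 p.2 := by
    unfold vortSq
    fun_prop
  unfold cap
  refine ((continuous_const.div (by fun_prop) fun p => ?_).add
    (continuous_const.div (by fun_prop) fun p => ?_)).add continuous_const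
  · exact mul_ne_zero two_ne_zero (h p)
  · exact mul_ne_zero two_ne_zero (pow_ne_zero 2 (h p))

/-! ### The trial function and its kinetic energy. -/

/-- The covariant derivative of a product of an amplitude, a regularised function and a phase. -/
lemma hasDerivAt_trial {T : ℝ} (hT : 0 < T) {G : ℝ → ℂ} {f γ : ℝ → ℝ} {G' : ℂ} {f' γ' t : ℝ}
    (hG : HasDerivAt G G' t) (hf : HasDerivAt f f' t) (hγ : HasDerivAt γ γ' t) (A : ℝ) :
    HasDerivAt (fun t => (f t : ℂ) * (reg T (Complex.normSq (G t)) * G t)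
        * Complex.exp (Complex.I * γ t))
      (Complex.I * A * ((f t : ℂ) * (reg T (Complex.normSq (G t)) * G t)
        * Complex.exp (Complex.I * γ t))
        + Complex.exp (Complex.I * γ t) * (f' * (reg T (Complex.normSq (G t)) * G t)
          + f t * regDir T (G t) (G' + Complex.I * ((γ' - A : ℝ) : ℂ) * G t))) t := by
  have h1 : HasDerivAt (fun t => Complex.normSq (G t))
      (2 * ((G t).re * G'.re + (G t).im * G'.im)) t := by
    have hr : HasDerivAt (fun t => (G t).re) G'.re t :=
      Complex.reCLM.hasFDerivAt.comp_hasDerivAt t hG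
    have hi : HasDerivAt (fun t => (G t).im) G'.im t :=
      Complex.imCLM.hasFDerivAt.comp_hasDerivAt t hG
    simp only [Complex.normSq_apply]
    exact ((hr.mul hr).add (hi.mul hi)).congr_deriv (by ring)
  have h2 : HasDerivAt (fun t => reg T (Complex.normSq (G t)))
      (regDeriv T (Complex.normSq (G t)) * (2 * ((G t).re * G'.re + (G t).im * G'.im))) t :=
    HasDerivAt.comp t (hasDerivAt_reg hT (Complex.normSq_nonneg _)) h1
  have h3 : HasDerivAt (fun t => Complex.exp (Complex.I * γ t))
      (Complex.exp (Complex.I * γ t) * (Complex.I * γ')) t :=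
    (hγ.ofReal_comp.const_mul Complex.I).cexp
  refine ((hf.ofReal_comp.mul (h2.ofReal_comp.mul hG)).mul h3).congr_deriv ?_
  have h4 : (G t).re * (G' + Complex.I * ((γ' - A : ℝ) : ℂ) * G t).re
      + (G t).im * (G' + Complex.I * ((γ' - A : ℝ) : ℂ) * G t).im
      = (G t).re * G'.re + (G t).im * G'.im := by
    rw [mul_assoc]
    simp only [Complex.add_re, Complex.add_im, Complex.I_mul_re, Complex.I_mul_im,
      Complex.re_ofReal_mul, Complex.im_ofReal_mul]
    ring
  have h5 : ((G t).re : ℂ) * ((G' + Complex.I * ((γ' - A : ℝ) : ℂ) * G t).re : ℂ)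
      + ((G t).im : ℂ) * ((G' + Complex.I * ((γ' - A : ℝ) : ℂ) * G t).im : ℂ)
      = (G t).re * G'.re + (G t).im * G'.im := by
    exact_mod_cast h4
  unfold regDir
  rw [h5]
  simp only [Pi.mul_apply]
  push_cast
  ring

lemma norm_reg_mul_sq {T : ℝ} (hT : 0 < T) (g : ℂ) :
    ‖(reg T (Complex.normSq g) : ℂ) * g‖ ^ 2 = 1 - T ^ 2 / (Complex.normSq g + T) ^ 2 := by
  rw [norm_mul, mul_pow, Complex.norm_real, Real.norm_eq_abs, sq_abs, Complex.sq_norm,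
    reg_sq_mul hT (Complex.normSq_nonneg g)]

lemma norm_reg_mul_sq_le {T : ℝ} (hT : 0 < T) (g : ℂ) :
    ‖(reg T (Complex.normSq g) : ℂ) * g‖ ^ 2 ≤ 1 := by
  rw [norm_reg_mul_sq hT]
  have : 0 ≤ T ^ 2 / (Complex.normSq g + T) ^ 2 := by positivity
  linarith

/-- The weight `δ` is kept small: the lattice energy is leading and tolerates only a factor near 1,
while the amplitude gradient can afford `1 + 1/δ`. -/
lemma norm_add_sq_le_weighted {δ : ℝ} (hδ : 0 < δ) (x y : ℂ) :
    ‖x + y‖ ^ 2 ≤ (1 + 1 / δ) * ‖x‖ ^ 2 + (1 + δ) * ‖y‖ ^ 2 := by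
  have h1 : ‖x + y‖ ^ 2 ≤ (‖x‖ + ‖y‖) ^ 2 :=
    pow_le_pow_left₀ (norm_nonneg _) (norm_add_le x y) 2
  have h2 : (1 + 1 / δ) * ‖x‖ ^ 2 + (1 + δ) * ‖y‖ ^ 2 - (‖x‖ + ‖y‖) ^ 2
      = (‖x‖ - δ * ‖y‖) ^ 2 / δ := by
    field_simp
    ring
  have h3 : 0 ≤ (‖x‖ - δ * ‖y‖) ^ 2 / δ := by positivity
  linarith

/-- The density of `|(∇ - iA)Ψ|²` in one direction. -/
lemma norm_trial_deriv_sq_le {T δ : ℝ} (hT : 0 < T) (hδ : 0 < δ) (g X : ℂ) (f f' γ : ℝ) :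
    ‖Complex.exp (Complex.I * γ) * (f' * (reg T (Complex.normSq g) * g) + f * regDir T g X)‖ ^ 2
      ≤ (1 + 1 / δ) * f' ^ 2 + (1 + δ) * (f ^ 2 * Complex.normSq (regDir T g X)) := by
  have h0 : ‖Complex.exp (Complex.I * γ)‖ = 1 := by
    rw [mul_comm, Complex.norm_exp_ofReal_mul_I]
  rw [norm_mul, h0, one_mul]
  refine (norm_add_sq_le_weighted hδ _ _).trans ?_
  rw [norm_mul (f' : ℂ), mul_pow, norm_mul (f : ℂ), mul_pow, Complex.norm_real, Complex.norm_real,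
    Real.norm_eq_abs, Real.norm_eq_abs, sq_abs, sq_abs, Complex.sq_norm (regDir T g X)]
  have h1 := norm_reg_mul_sq_le hT g
  have h2 : f' ^ 2 * ‖(reg T (Complex.normSq g) : ℂ) * g‖ ^ 2 ≤ f' ^ 2 :=
    mul_le_of_le_one_right (sq_nonneg _) h1
  have h3 : 0 ≤ 1 + 1 / δ := by positivity
  have := mul_le_mul_of_nonneg_left h2 h3
  linarith

/-- The trial function: amplitude `f`, a regularised vortex lattice shifted by `(s, t)`, and the
phase that adapts the gauge. -/
def trial (T lam Ω s t : ℝ) (N : ℕ) (f : ℂ → ℝ) (z : ℂ) : ℂ :=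
  (f z : ℂ) * (reg T (Complex.normSq (vort N (lam * z.re - s) (2 / Real.pi * lam * z.im - t)))
      * vort N (lam * z.re - s) (2 / Real.pi * lam * z.im - t))
    * Complex.exp (Complex.I * ((Ω / 2 * z.re * z.im - lam * t / Real.pi * z.re : ℝ) : ℂ))

section trial

variable {T lam Ω s t δ : ℝ} {N : ℕ} {f : ℂ → ℝ}

lemma contDiff_trial (hT : 0 < T) (hf : ContDiff ℝ 1 f) :
    ContDiff ℝ 1 (trial T lam Ω s t N f) := by
  have hre : ContDiff ℝ 1 fun z : ℂ => z.re := Complex.reCLM.contDiff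
  have him : ContDiff ℝ 1 fun z : ℂ => z.im := Complex.imCLM.contDiff
  have hg : ContDiff ℝ 1 fun z : ℂ =>
      vort N (lam * z.re - s) (2 / Real.pi * lam * z.im - t) :=
    contDiff_vort N (by fun_prop) (by fun_prop)
  have hn : ContDiff ℝ 1 fun z : ℂ =>
      Complex.normSq (vort N (lam * z.re - s) (2 / Real.pi * lam * z.im - t)) := by
    have h1 := Complex.reCLM.contDiff.comp hg
    have h2 := Complex.imCLM.contDiff.comp hg
    simp only [Complex.normSq_apply]
    exact (h1.mul h1).add (h2.mul h2)
  have hr : ContDiff ℝ 1 fun z : ℂ =>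
      reg T (Complex.normSq (vort N (lam * z.re - s) (2 / Real.pi * lam * z.im - t))) := by
    unfold reg
    refine ((hn.add contDiff_const).sqrt fun z => ?_).div (hn.add contDiff_const) fun z => ?_
    · have := Complex.normSq_nonneg (vort N (lam * z.re - s) (2 / Real.pi * lam * z.im - t))
      positivity
    · have := Complex.normSq_nonneg (vort N (lam * z.re - s) (2 / Real.pi * lam * z.im - t))
      positivity
  have hγ : ContDiff ℝ 1 fun z : ℂ => Ω / 2 * z.re * z.im - lam * t / Real.pi * z.re := by
    fun_prop
  have hc : ∀ {h : ℂ → ℝ}, ContDiff ℝ 1 h → ContDiff ℝ 1 fun z => (h z : ℂ) :=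
    fun h => Complex.ofRealCLM.contDiff.comp h
  exact ((hc hf).mul ((hc hr).mul hg)).mul (contDiff_const.mul (hc hγ)).cexp

lemma norm_trial_sq (hT : 0 < T) (z : ℂ)
    (hz : |2 / Real.pi * lam * z.im - t| < N * Real.pi) :
    ‖trial T lam Ω s t N f z‖ ^ 2 = f z ^ 2
      * (1 - T ^ 2 / (vortSq (lam * z.re - s) (2 / Real.pi * lam * z.im - t) + T) ^ 2) := by
  unfold trial
  rw [norm_mul, mul_comm Complex.I, Complex.norm_exp_ofReal_mul_I, mul_one, norm_mul, mul_pow,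
    norm_reg_mul_sq hT, normSq_vort hz, Complex.norm_real, Real.norm_eq_abs, sq_abs]

lemma norm_trial_sq_le (hT : 0 < T) (z : ℂ) :
    ‖trial T lam Ω s t N f z‖ ^ 2 ≤ f z ^ 2 := by
  unfold trial
  rw [norm_mul, mul_comm Complex.I, Complex.norm_exp_ofReal_mul_I, mul_one, norm_mul, mul_pow,
    Complex.norm_real, Real.norm_eq_abs, sq_abs]
  exact mul_le_of_le_one_right (sq_nonneg _) (norm_reg_mul_sq_le hT _)

lemma fderiv_eq_of_hasDerivAt {E : Type*} [NormedAddCommGroup E] [NormedSpace ℝ E] {Φ : ℂ → E}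
    {z v : ℂ} {D : E} (hΦ : DifferentiableAt ℝ Φ z)
    (h : HasDerivAt (fun τ : ℝ => Φ (z + τ • v)) D 0) : fderiv ℝ Φ z v = D := by
  rw [← hΦ.lineDeriv_eq_fderiv]
  exact HasLineDerivAt.lineDeriv h

lemma hasDerivAt_line {E : Type*} [NormedAddCommGroup E] [NormedSpace ℝ E] {Φ : ℂ → E}
    {z v : ℂ} (hΦ : DifferentiableAt ℝ Φ z) :
    HasDerivAt (fun τ : ℝ => Φ (z + τ • v)) (fderiv ℝ Φ z v) 0 :=
  hΦ.hasFDerivAt.hasLineDerivAt v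

lemma regDir_real_mul (T : ℝ) (g X : ℂ) (c : ℝ) :
    regDir T g (c * X) = c * regDir T g X := by
  unfold regDir
  simp only [Complex.re_ofReal_mul, Complex.im_ofReal_mul]
  push_cast
  ring

/-- The phase `Ω/2 · x y - (λ t / π) x` turns the symmetric gauge into a Landau gauge: its gradient
minus `A` is `(λ η / π, 0)`, the potential matched to the modes of `vort`. This requires `λ² = π² Ω
/ 2`. The stretching `2 / π` of the second variable makes the vortex cores round. -/
lemma kin_trial_le (hT : 0 < T) (hδ : 0 < δ) (hlam : lam ^ 2 = Real.pi ^ 2 * Ω / 2)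
    (hf : ContDiff ℝ 1 f) (z : ℂ) (hz : |2 / Real.pi * lam * z.im - t| < N * Real.pi) :
    kin Ω (trial T lam Ω s t N f) z
      ≤ (1 + 1 / δ) * (fderiv ℝ f z 1 ^ 2 + fderiv ℝ f z Complex.I ^ 2)
        + (1 + δ) * (f z ^ 2 * (lam ^ 2
          * cap T (vortSq (lam * z.re - s) (2 / Real.pi * lam * z.im - t)))) := by
  have hπ := Real.pi_pos
  set v := lam * z.re - s with hv
  set η := 2 / Real.pi * lam * z.im - t with hη
  set γ := Ω / 2 * z.re * z.im - lam * t / Real.pi * z.re with hγ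
  have hΨ := (contDiff_trial (lam := lam) (Ω := Ω) (s := s) (t := t) (N := N) hT
    hf).differentiable one_ne_zero z
  have hfd := hf.differentiable one_ne_zero z
  have dx : fderiv ℝ (trial T lam Ω s t N f) z 1
      - Complex.I * (potX Ω z : ℂ) * trial T lam Ω s t N f z
      = Complex.exp (Complex.I * γ) * ((fderiv ℝ f z 1 : ℝ)
        * (reg T (Complex.normSq (vort N v η)) * vort N v η)
        + f z * regDir T (vort N v η)
          (lam * (vortV N v η + Complex.I * (η / Real.pi : ℝ) * vort N v η))) := by
    have h1 : HasDerivAt (fun τ : ℝ => vort N (lam * (z.re + τ) - s) η)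
        (lam * vortV N v η) 0 := by
      have h0 : HasDerivAt (fun τ : ℝ => lam * (z.re + τ) - s) lam 0 := by
        simpa using (((hasDerivAt_id (0 : ℝ)).const_add z.re).const_mul lam).sub_const s
      have := HasDerivAt.scomp (0 : ℝ) (by simpa using hasDerivAt_vort_left N v η) h0
      simpa [Function.comp_def] using this
    have h2 : HasDerivAt (fun τ : ℝ => Ω / 2 * (z.re + τ) * z.im
        - lam * t / Real.pi * (z.re + τ)) (Ω / 2 * z.im - lam * t / Real.pi) 0 := by
      have h0 := (hasDerivAt_id (0 : ℝ)).const_add z.re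
      exact (((h0.const_mul (Ω / 2)).mul_const z.im).sub
        (h0.const_mul (lam * t / Real.pi))).congr_deriv (by ring)
    have h3 := hasDerivAt_trial hT h1 (hasDerivAt_line (v := 1) hfd) h2 (potX Ω z)
    have h4 := fderiv_eq_of_hasDerivAt (v := 1) hΨ
      (h3.congr_of_eventuallyEq (Filter.Eventually.of_forall fun τ => by
        simp [trial, hη]))
    have e1 : Ω / 2 * z.im - lam * t / Real.pi - potX Ω z = lam * (η / Real.pi) := by
      have : lam * (η / Real.pi) = 2 / Real.pi ^ 2 * lam ^ 2 * z.im - lam * t / Real.pi := by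
        rw [hη]
        field_simp
      rw [this, hlam]
      unfold potX
      field_simp
      ring
    rw [h4, e1]
    simp only [add_zero, zero_smul, ← hv, ← hγ]
    have e2 : trial T lam Ω s t N f z = (f z : ℂ) * (reg T (Complex.normSq (vort N v η))
      * vort N v η) * Complex.exp (Complex.I * γ) := rfl
    have e3 : (lam : ℂ) * vortV N v η + Complex.I * ((lam * (η / Real.pi) : ℝ) : ℂ) * vort N v η
        = lam * (vortV N v η + Complex.I * (η / Real.pi : ℝ) * vort N v η) := by
      push_cast
      ring
    rw [e2, e3]
    ring
  have dy : fderiv ℝ (trial T lam Ω s t N f) z Complex.I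
      - Complex.I * (potY Ω z : ℂ) * trial T lam Ω s t N f z
      = Complex.exp (Complex.I * γ) * ((fderiv ℝ f z Complex.I : ℝ)
        * (reg T (Complex.normSq (vort N v η)) * vort N v η)
        + f z * regDir T (vort N v η) (((2 / Real.pi * lam : ℝ) : ℂ) * vortE N v η)) := by
    have h1 : HasDerivAt (fun τ : ℝ => vort N v (2 / Real.pi * lam * (z.im + τ) - t))
        (((2 / Real.pi * lam : ℝ) : ℂ) * vortE N v η) 0 := by
      have h0 : HasDerivAt (fun τ : ℝ => 2 / Real.pi * lam * (z.im + τ) - t)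
          (2 / Real.pi * lam) 0 := by
        simpa using (((hasDerivAt_id (0 : ℝ)).const_add z.im).const_mul
          (2 / Real.pi * lam)).sub_const t
      have := HasDerivAt.scomp (0 : ℝ) (by simpa using hasDerivAt_vort_right N v η) h0
      simpa [Function.comp_def] using this
    have h2 : HasDerivAt (fun τ : ℝ => Ω / 2 * z.re * (z.im + τ)
        - lam * t / Real.pi * z.re) (Ω / 2 * z.re) 0 := by
      have h0 := (hasDerivAt_id (0 : ℝ)).const_add z.im
      exact ((h0.const_mul (Ω / 2 * z.re)).sub_const _).congr_deriv (by ring)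
    have h3 := hasDerivAt_trial hT h1 (hasDerivAt_line (v := Complex.I) hfd) h2 (potY Ω z)
    have h4 := fderiv_eq_of_hasDerivAt (v := Complex.I) hΨ
      (h3.congr_of_eventuallyEq (Filter.Eventually.of_forall fun τ => by
        simp [trial, hv]))
    have e1 : Ω / 2 * z.re - potY Ω z = 0 := by
      unfold potY
      ring
    rw [h4, e1]
    simp only [add_zero, zero_smul, ← hη, ← hγ]
    have e2 : trial T lam Ω s t N f z = (f z : ℂ) * (reg T (Complex.normSq (vort N v η))
      * vort N v η) * Complex.exp (Complex.I * γ) := rfl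
    rw [e2]
    simp only [Complex.ofReal_zero, mul_zero, zero_mul, add_zero]
    ring
  unfold kin
  rw [dx, dy]
  have b1 := norm_trial_deriv_sq_le hT hδ (vort N v η)
    (lam * (vortV N v η + Complex.I * (η / Real.pi : ℝ) * vort N v η)) (f z) (fderiv ℝ f z 1) γ
  have b2 := norm_trial_deriv_sq_le hT hδ (vort N v η)
    (((2 / Real.pi * lam : ℝ) : ℂ) * vortE N v η) (f z) (fderiv ℝ f z Complex.I) γ
  rw [regDir_real_mul, Complex.normSq_mul, Complex.normSq_ofReal] at b1 b2
  rw [regDir_real_mul, regDir_real_mul]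
  have b3 := normSq_regDir_add_le hT hz v
  have b4 : 0 ≤ (1 + δ) * (f z ^ 2 * lam ^ 2) := by positivity
  have b5 := mul_le_mul_of_nonneg_left b3 b4
  refine (add_le_add b1 b2).trans ?_
  refine le_trans (le_of_eq ?_) (add_le_add_right b5
    ((1 + 1 / δ) * (fderiv ℝ f z 1 ^ 2 + fderiv ℝ f z Complex.I ^ 2))) |>.trans (le_of_eq ?_)
  · field_simp
    ring
  · ring

end trial

/-! ### Integrals over one lattice cell. -/

/-- The squared modulus of the vortex lattice, with the origin moved to a vortex. -/
def cellSq (v η : ℝ) : ℝ := 1 - Real.cos (Real.pi / 2 * Real.sin η) * Real.cos v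

lemma vortSq_add (v η : ℝ) : vortSq (v + Real.pi) (η + Real.pi / 2) = cellSq v η := by
  unfold vortSq cellSq
  rw [Real.cos_add_pi, Real.cos_add_pi_div_two, mul_neg (Real.pi / 2), Real.cos_neg]
  ring

lemma cellSq_nonneg (v η : ℝ) : 0 ≤ cellSq v η := by
  rw [← vortSq_add]
  exact vortSq_nonneg _ _

lemma cos_le_quartic (x : ℝ) : Real.cos x ≤ 1 - x ^ 2 / 2 + x ^ 4 := by
  rcases le_total |x| 1 with h | h
  · have h1 := (abs_le.1 (Real.cos_bound h)).2
    have h2 : |x| ^ 4 = x ^ 4 := by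
      rw [← abs_pow, abs_of_nonneg (by positivity)]
    have h3 : 0 ≤ x ^ 4 := by positivity
    rw [h2] at h1
    linarith
  · have h1 : 1 ≤ x ^ 2 := by
      rw [← sq_abs]
      nlinarith
    nlinarith [Real.cos_le_one x]

lemma pi_sq_le_ten : Real.pi ^ 2 ≤ 10 := by
  nlinarith [Real.pi_lt_d2, Real.pi_gt_three]

lemma nine_le_pi_sq : 9 ≤ Real.pi ^ 2 := by
  nlinarith [Real.pi_gt_three]

section cell

variable {v η : ℝ}

lemma cos_angle_nonneg (η : ℝ) : 0 ≤ Real.cos (Real.pi / 2 * Real.sin η) := by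
  have hπ := Real.pi_pos
  refine Real.cos_nonneg_of_neg_pi_div_two_le_of_le ?_ ?_
  · nlinarith [Real.neg_one_le_sin η]
  · nlinarith [Real.sin_le_one η]

/-- The origin is the only zero in the closed cell and it is nondegenerate. The constant is crude,
so this serves the error terms only. -/
lemma sq_le_cellSq (hv : |v| ≤ Real.pi) (hη : |η| ≤ Real.pi / 2) :
    (η ^ 2 + v ^ 2) / 20 ≤ cellSq v η := by
  have hπ := Real.pi_pos
  have hπ2 := pi_sq_le_ten
  have hB0 := cos_angle_nonneg η
  have hB1 := Real.cos_le_one (Real.pi / 2 * Real.sin η)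
  have hs : η ^ 2 ≤ (Real.pi / 2 * Real.sin η) ^ 2 := by
    have h1 : 2 / Real.pi * |η| ≤ |Real.sin η| := Real.mul_abs_le_abs_sin hη
    have h2 : |η| ≤ |Real.pi / 2 * Real.sin η| := by
      rw [abs_mul, abs_of_pos (by positivity : 0 < Real.pi / 2)]
      calc |η| = Real.pi / 2 * (2 / Real.pi * |η|) := by field_simp
        _ ≤ _ := mul_le_mul_of_nonneg_left h1 (by positivity)
    exact sq_le_sq.2 h2
  have hB : Real.cos (Real.pi / 2 * Real.sin η) ≤ 1 - η ^ 2 / 5 := by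
    have h1 : |Real.pi / 2 * Real.sin η| ≤ Real.pi := by
      rw [abs_mul, abs_of_pos (by positivity : 0 < Real.pi / 2)]
      nlinarith [Real.abs_sin_le_one η]
    have h2 := Real.cos_le_one_sub_mul_cos_sq h1
    have h3 : 1 / 5 ≤ 2 / Real.pi ^ 2 := by
      rw [div_le_div_iff₀ (by norm_num) (by positivity)]
      linarith
    have h4 : 1 / 5 * η ^ 2 ≤ 2 / Real.pi ^ 2 * (Real.pi / 2 * Real.sin η) ^ 2 :=
      mul_le_mul h3 hs (sq_nonneg _) (by positivity)
    linarith
  have hC : Real.cos v ≤ 1 - v ^ 2 / 5 := by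
    have h2 := Real.cos_le_one_sub_mul_cos_sq hv
    have h3 : 1 / 5 ≤ 2 / Real.pi ^ 2 := by
      rw [div_le_div_iff₀ (by norm_num) (by positivity)]
      linarith
    have h4 := mul_le_mul_of_nonneg_right h3 (sq_nonneg v)
    linarith
  have hC1 := Real.cos_le_one v
  have hC2 := Real.neg_one_le_cos v
  unfold cellSq
  generalize Real.cos (Real.pi / 2 * Real.sin η) = B at *
  generalize Real.cos v = c at *
  have h1 : B * c ≤ B := mul_le_of_le_one_right hB0 hC1
  have h2 : B * c ≤ (1 + c) / 2 := by
    rcases le_total 0 c with hc | hc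
    · nlinarith
    · nlinarith [mul_nonneg hB0 (neg_nonneg.2 hc)]
  nlinarith

/-- The exact quadratic part at the vortex, needed for the sharp coefficient of the logarithm. -/
lemma quadratic_sub_le_cellSq (v η : ℝ) :
    (Real.pi ^ 2 / 4 * η ^ 2 + v ^ 2) / 2 - 17 * (η ^ 2 + v ^ 2) ^ 2 ≤ cellSq v η := by
  have hπ := Real.pi_pos
  have hπ2 := pi_sq_le_ten
  have hπ4 : Real.pi ^ 4 ≤ 100 := by
    have : Real.pi ^ 4 = (Real.pi ^ 2) ^ 2 := by ring
    rw [this]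
    nlinarith [sq_nonneg Real.pi]
  have hsin : η ^ 2 - 8 * η ^ 4 ≤ Real.sin η ^ 2 := by
    have h1 := cos_le_quartic (2 * η)
    have h2 := Real.cos_two_mul η
    have h3 := Real.sin_sq_add_cos_sq η
    nlinarith
  have hsin' : Real.sin η ^ 2 ≤ η ^ 2 := sq_le_sq.2 Real.abs_sin_le_abs
  have hθ2 : (Real.pi / 2 * Real.sin η) ^ 2 ≤ 5 / 2 * η ^ 2 := by
    rw [mul_pow]
    exact mul_le_mul (by nlinarith) hsin' (sq_nonneg _) (by norm_num)
  have hθ4 : (Real.pi / 2 * Real.sin η) ^ 4 ≤ 25 / 4 * η ^ 4 := by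
    have h1 := pow_le_pow_left₀ (sq_nonneg _) hθ2 2
    calc (Real.pi / 2 * Real.sin η) ^ 4 = ((Real.pi / 2 * Real.sin η) ^ 2) ^ 2 := by ring
      _ ≤ (5 / 2 * η ^ 2) ^ 2 := h1
      _ = _ := by ring
  have hB : Real.pi ^ 2 / 8 * η ^ 2 - 17 * η ^ 4
      ≤ 1 - Real.cos (Real.pi / 2 * Real.sin η) := by
    have h1 := cos_le_quartic (Real.pi / 2 * Real.sin η)
    have h2 : (Real.pi / 2 * Real.sin η) ^ 2 / 2 = Real.pi ^ 2 / 8 * Real.sin η ^ 2 := by ring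
    have h3 : Real.pi ^ 2 / 8 * (η ^ 2 - 8 * η ^ 4) ≤ Real.pi ^ 2 / 8 * Real.sin η ^ 2 :=
      mul_le_mul_of_nonneg_left hsin (by positivity)
    have h4 : Real.pi ^ 2 * η ^ 4 ≤ 10 * η ^ 4 := mul_le_mul_of_nonneg_right hπ2 (by positivity)
    have h5 : 0 ≤ η ^ 4 := by positivity
    linarith
  have hB' : 1 - Real.cos (Real.pi / 2 * Real.sin η) ≤ 5 / 4 * η ^ 2 := by
    have h1 := Real.one_sub_sq_div_two_le_cos (x := Real.pi / 2 * Real.sin η)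
    linarith
  have hB0 := Real.cos_le_one (Real.pi / 2 * Real.sin η)
  have hC := cos_le_quartic v
  have hC' := Real.one_sub_sq_div_two_le_cos (x := v)
  have hC0 := Real.cos_le_one v
  unfold cellSq
  generalize Real.cos (Real.pi / 2 * Real.sin η) = B at *
  generalize Real.cos v = c at *
  have h1 : (1 - B) * (1 - c) ≤ 5 / 4 * η ^ 2 * (v ^ 2 / 2) :=
    mul_le_mul hB' (by linarith) (by linarith) (by positivity)
  have h2 : 0 ≤ η ^ 2 * v ^ 2 := by positivity
  have h3 : 0 ≤ v ^ 4 := by positivity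
  have h4 : 1 - B * c = (1 - B) + (1 - c) - (1 - B) * (1 - c) := by ring
  rw [h4]
  nlinarith

/-- The sharp expansion has error `17 ρ²` with `ρ = η² + v²`, and the denominators are at least of
order `ρ²` by `sq_le_cellSq`, so `1 / (2 (M + T))` differs from the model by a constant: `340 = 34 ·
20 / 2`. The core term is bounded by a product of functions of one variable each, ready for iterated
integration. -/
lemma cap_cellSq_le {T : ℝ} (hT : 0 < T) (hv : |v| ≤ Real.pi) (hη : |η| ≤ Real.pi / 2) :
    cap T (cellSq v η) ≤ 1 / (1 * v ^ 2 + (Real.pi ^ 2 / 4 * η ^ 2 + 2 * T)) + 341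
      + 5 / 2 * (T * (1 / (1 / 20 * η ^ 2 + T)) * (1 / (1 / 20 * v ^ 2 + T))) := by
  have h1 := sq_le_cellSq hv hη
  have h2 := quadratic_sub_le_cellSq v η
  have h9 := nine_le_pi_sq
  generalize cellSq v η = M at *
  have hM : 0 ≤ M := le_trans (by positivity) h1
  have e1 : 1 / (2 * (M + T)) ≤ 1 / (1 * v ^ 2 + (Real.pi ^ 2 / 4 * η ^ 2 + 2 * T)) + 340 := by
    set r := Real.pi ^ 2 / 4 * η ^ 2 + v ^ 2 with hr
    have hr0 : η ^ 2 + v ^ 2 ≤ r := by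
      rw [hr]
      nlinarith [sq_nonneg η]
    have hρ : 0 ≤ η ^ 2 + v ^ 2 := by positivity
    have e : 1 * v ^ 2 + (Real.pi ^ 2 / 4 * η ^ 2 + 2 * T) = r + 2 * T := by
      rw [hr]
      ring
    rw [e]
    have hrT : 0 < r + 2 * T := by linarith
    rw [div_add' _ _ _ hrT.ne', div_le_div_iff₀ (by positivity) hrT]
    have h3 : (η ^ 2 + v ^ 2) / 20 * (η ^ 2 + v ^ 2) ≤ M * r := mul_le_mul h1 hr0 hρ hM
    have h4 : M * r ≤ (M + T) * (r + 2 * T) :=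
      mul_le_mul (by linarith) (by linarith) (by linarith) (by linarith)
    nlinarith
  have e2 : T / (M + T) ^ 2
      ≤ T * (1 / (1 / 20 * η ^ 2 + T)) * (1 / (1 / 20 * v ^ 2 + T)) := by
    have h3 : (1 / 20 * η ^ 2 + T) * (1 / 20 * v ^ 2 + T) ≤ (M + T) ^ 2 := by
      rw [pow_two (M + T)]
      exact mul_le_mul (by nlinarith [sq_nonneg v]) (by nlinarith [sq_nonneg η])
        (by positivity) (by positivity)
    calc T / (M + T) ^ 2 ≤ T / ((1 / 20 * η ^ 2 + T) * (1 / 20 * v ^ 2 + T)) := by gcongr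
      _ = _ := by field_simp
  have e3 : 5 * T / (2 * (M + T) ^ 2) = 5 / 2 * (T / (M + T) ^ 2) := by field_simp
  unfold cap
  rw [e3]
  linarith

lemma sq_div_cellSq_le {T : ℝ} (hT : 0 < T) (hv : |v| ≤ Real.pi) (hη : |η| ≤ Real.pi / 2) :
    T ^ 2 / (cellSq v η + T) ^ 2
      ≤ T * (T * (1 / (1 / 20 * η ^ 2 + T)) * (1 / (1 / 20 * v ^ 2 + T))) := by
  have h1 := sq_le_cellSq hv hη
  generalize cellSq v η = M at *
  have hM : 0 ≤ M := le_trans (by positivity) h1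
  have h3 : (1 / 20 * η ^ 2 + T) * (1 / 20 * v ^ 2 + T) ≤ (M + T) ^ 2 := by
    rw [pow_two (M + T)]
    exact mul_le_mul (by nlinarith [sq_nonneg v]) (by nlinarith [sq_nonneg η])
      (by positivity) (by positivity)
  calc T ^ 2 / (M + T) ^ 2 ≤ T ^ 2 / ((1 / 20 * η ^ 2 + T) * (1 / 20 * v ^ 2 + T)) := by gcongr
    _ = _ := by field_simp

end cell

lemma continuous_one_div_quadratic {p q : ℝ} (hp : 0 < p) (hq : 0 < q) :
    Continuous fun x : ℝ => 1 / (p * x ^ 2 + q) :=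
  continuous_const.div (by fun_prop) fun x => by positivity

lemma integral_one_div_quadratic_le {p q : ℝ} (hp : 0 < p) (hq : 0 < q) (a : ℝ) :
    ∫ x in (-a)..a, 1 / (p * x ^ 2 + q) ≤ Real.pi / Real.sqrt (p * q) := by
  have hd : ∀ x, HasDerivAt (fun x => Real.arctan (x * (p / Real.sqrt (p * q)))
      / Real.sqrt (p * q)) (1 / (p * x ^ 2 + q)) x := fun x => by
    have h0 : 0 < Real.sqrt (p * q) := Real.sqrt_pos.2 (by positivity)
    have h1 := Real.sq_sqrt (by positivity : 0 ≤ p * q)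
    refine ((((hasDerivAt_id x).mul_const (p / Real.sqrt (p * q))).arctan).div_const
      (Real.sqrt (p * q))).congr_deriv ?_
    simp only [id]
    generalize Real.sqrt (p * q) = r at *
    have h2 : q = r ^ 2 / p := by
      rw [h1]
      field_simp
    rw [h2]
    field_simp
    ring
  rw [intervalIntegral.integral_eq_sub_of_hasDerivAt (fun x _ => hd x)
    ((continuous_one_div_quadratic hp hq).intervalIntegrable _ _)]
  rw [← sub_div]
  refine div_le_div_of_nonneg_right ?_ (Real.sqrt_nonneg _)
  have h1 := Real.arctan_lt_pi_div_two (a * (p / Real.sqrt (p * q)))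
  have h2 := Real.neg_pi_div_two_lt_arctan (-a * (p / Real.sqrt (p * q)))
  linarith

lemma continuous_pi_div_sqrt {T : ℝ} (hT : 0 < T) :
    Continuous fun η : ℝ => Real.pi / Real.sqrt (1 * (Real.pi ^ 2 / 4 * η ^ 2 + 2 * T)) :=
  continuous_const.div (by fun_prop) fun η => (Real.sqrt_pos.2 (by positivity)).ne'

/-- The source of the logarithm: the integrand is what the integral of `1 / (v² + Q)` over `v`
leaves behind. Its primitive is twice an `arsinh` at scale `√T`, and the two endpoints give `4 log
(1/√T) = 2 log (1/T)`. -/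
lemma integral_pi_div_sqrt_le {T : ℝ} (hT : 0 < T) (hT1 : T ≤ 1) :
    ∫ η in (-(Real.pi / 2))..(Real.pi / 2),
        Real.pi / Real.sqrt (1 * (Real.pi ^ 2 / 4 * η ^ 2 + 2 * T))
      ≤ 2 * Real.log (1 / T) + 8 := by
  have hπ := Real.pi_pos
  set τ := Real.sqrt (2 * T) with hτ
  have hτ0 : 0 < τ := Real.sqrt_pos.2 (by positivity)
  have hτ2 : τ ^ 2 = 2 * T := Real.sq_sqrt (by positivity)
  have hd : ∀ η, HasDerivAt (fun η => 2 * Real.arsinh (η * (Real.pi / (2 * τ))))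
      (Real.pi / Real.sqrt (1 * (Real.pi ^ 2 / 4 * η ^ 2 + 2 * T))) η := fun η => by
    refine ((((hasDerivAt_id η).mul_const (Real.pi / (2 * τ))).arsinh).const_mul 2).congr_deriv ?_
    have h1 : Real.sqrt (1 * (Real.pi ^ 2 / 4 * η ^ 2 + 2 * T))
        = τ * Real.sqrt (1 + (η * (Real.pi / (2 * τ))) ^ 2) := by
      conv_rhs => rw [← Real.sqrt_sq hτ0.le, ← Real.sqrt_mul (by positivity),
        Real.sqrt_sq hτ0.le]
      congr 1
      rw [← hτ2]
      field_simp
      ring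
    rw [h1]
    simp only [id, smul_eq_mul]
    field_simp
  rw [intervalIntegral.integral_eq_sub_of_hasDerivAt (fun x _ => hd x)
    ((continuous_pi_div_sqrt hT).intervalIntegrable _ _)]
  have h1 : -(Real.pi / 2) * (Real.pi / (2 * τ)) = -(Real.pi / 2 * (Real.pi / (2 * τ))) := by ring
  rw [h1, Real.arsinh_neg]
  have h2 := arsinh_le (x := Real.pi / 2 * (Real.pi / (2 * τ))) (by positivity)
  have hsT : 0 < Real.sqrt T := Real.sqrt_pos.2 hT
  have hsT1 : Real.sqrt T ≤ 1 := Real.sqrt_le_one.2 hT1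
  have hle : Real.sqrt T ≤ τ := Real.sqrt_le_sqrt (by linarith)
  have h3 : 1 + 2 * (Real.pi / 2 * (Real.pi / (2 * τ))) ≤ 6 / Real.sqrt T := by
    have e1 : 2 * (Real.pi / 2 * (Real.pi / (2 * τ))) = (Real.pi ^ 2 / 2) / τ := by
      field_simp
    have e2 : (Real.pi ^ 2 / 2) / τ ≤ 5 / Real.sqrt T := by
      refine div_le_div₀ (by norm_num) ?_ hsT hle
      linarith [pi_sq_le_ten]
    have e3 : 1 ≤ 1 / Real.sqrt T := by
      rw [le_div_iff₀ hsT]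
      linarith
    have e4 : 6 / Real.sqrt T = 1 / Real.sqrt T + 5 / Real.sqrt T := by ring
    rw [e1, e4]
    linarith
  have h4 : Real.log (6 / Real.sqrt T) ≤ 2 + 1 / 2 * Real.log (1 / T) := by
    rw [Real.log_div (by norm_num) hsT.ne', Real.log_sqrt hT.le, one_div T, Real.log_inv]
    have h5 : Real.log 6 ≤ 2 := by
      rw [Real.log_le_iff_le_exp (by norm_num)]
      have h7 := Real.exp_one_gt_d9
      have h8 : Real.exp 2 = Real.exp 1 * Real.exp 1 := by
        rw [← Real.exp_add]
        norm_num
      rw [h8]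
      nlinarith
    linarith
  have h5 := Real.log_le_log (by positivity) h3
  linarith

lemma continuous_cellSq : Continuous fun p : ℝ × ℝ => cellSq p.1 p.2 := by
  unfold cellSq
  fun_prop

lemma continuous_cap_cellSq {T : ℝ} (hT : 0 < T) :
    Continuous fun p : ℝ × ℝ => cap T (cellSq p.1 p.2) := by
  have := (continuous_cap_vortSq hT).comp
    (f := fun p : ℝ × ℝ => (p.1 + Real.pi, p.2 + Real.pi / 2)) (by fun_prop)
  simpa only [Function.comp_def, vortSq_add] using this

lemma continuous_sq_div_cellSq {T : ℝ} (hT : 0 < T) :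
    Continuous fun p : ℝ × ℝ => T ^ 2 / (cellSq p.1 p.2 + T) ^ 2 := by
  refine continuous_const.div ((continuous_cellSq.add continuous_const).pow 2) fun p => ?_
  have := cellSq_nonneg p.1 p.2
  positivity

/-- Integral of the product of two quadratic kernels. -/
lemma mul_integral_quadratic_le {T : ℝ} (hT : 0 < T) :
    ∫ η in (-(Real.pi / 2))..(Real.pi / 2), T * (1 / (1 / 20 * η ^ 2 + T))
      * (Real.pi / Real.sqrt (1 / 20 * T)) ≤ 200 := by
  have h := integral_one_div_quadratic_le (by norm_num : (0 : ℝ) < 1 / 20) hT (Real.pi / 2)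
  have hs : 0 < Real.sqrt (1 / 20 * T) := Real.sqrt_pos.2 (by positivity)
  have h2 : Real.sqrt (1 / 20 * T) ^ 2 = 1 / 20 * T := Real.sq_sqrt (by positivity)
  have e : ∀ η : ℝ, T * (1 / (1 / 20 * η ^ 2 + T)) * (Real.pi / Real.sqrt (1 / 20 * T))
      = T * (Real.pi / Real.sqrt (1 / 20 * T)) * (1 / (1 / 20 * η ^ 2 + T)) := fun η => by ring
  simp only [e]
  rw [intervalIntegral.integral_const_mul]
  have hπ := Real.pi_pos
  calc _ ≤ T * (Real.pi / Real.sqrt (1 / 20 * T)) * (Real.pi / Real.sqrt (1 / 20 * T)) :=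
        mul_le_mul_of_nonneg_left h (by positivity)
    _ = T * Real.pi ^ 2 / Real.sqrt (1 / 20 * T) ^ 2 := by field_simp
    _ = 20 * Real.pi ^ 2 := by
        rw [h2]
        field_simp
    _ ≤ 200 := by linarith [pi_sq_le_ten]

lemma continuous_slice {F : ℝ → ℝ → ℝ} (hF : Continuous fun p : ℝ × ℝ => F p.1 p.2) (η : ℝ) :
    Continuous fun v => F v η :=
  hF.comp (f := fun v => (v, η)) (by fun_prop)

lemma continuous_inner_integral {F : ℝ → ℝ → ℝ} (hF : Continuous fun p : ℝ × ℝ => F p.1 p.2)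
    (a : ℝ) : Continuous fun η => ∫ v in (-a)..a, F v η :=
  intervalIntegral.continuous_parametric_intervalIntegral_of_continuous'
    (f := fun η v => F v η) (hF.comp continuous_swap) (-a) a

lemma iterated_integral_le {F : ℝ → ℝ → ℝ} (hF : Continuous fun p : ℝ × ℝ => F p.1 p.2)
    {m : ℝ → ℝ} (hm : Continuous m) {a b : ℝ} (hb : 0 ≤ b)
    (h : ∀ η ∈ Set.Icc (-b) b, ∫ v in (-a)..a, F v η ≤ m η) :
    ∫ η in (-b)..b, ∫ v in (-a)..a, F v η ≤ ∫ η in (-b)..b, m η := by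
  exact intervalIntegral.integral_mono_on (by linarith)
    ((continuous_inner_integral hF a).intervalIntegrable _ _)
    (hm.intervalIntegrable _ _) h

lemma integral_le_quadratic {F : ℝ → ℝ} (hF : Continuous F) {T Q c d : ℝ} (hT : 0 < T)
    (hQ : 0 < Q) (hd : 0 ≤ d)
    (h : ∀ v, |v| ≤ Real.pi → F v ≤ 1 / (1 * v ^ 2 + Q) + c + d * (1 / (1 / 20 * v ^ 2 + T))) :
    ∫ v in (-Real.pi)..Real.pi, F v ≤ Real.pi / Real.sqrt (1 * Q) + c * (2 * Real.pi)
      + d * (Real.pi / Real.sqrt (1 / 20 * T)) := by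
  have hπ := Real.pi_pos
  have c1 := continuous_one_div_quadratic one_pos hQ
  have c3 := continuous_one_div_quadratic (by norm_num : (0 : ℝ) < 1 / 20) hT
  have i1 := c1.intervalIntegrable (μ := volume) (-Real.pi) Real.pi
  have i2 : IntervalIntegrable (fun _ : ℝ => c) volume (-Real.pi) Real.pi := by simp
  have i3 := (c3.intervalIntegrable (μ := volume) (-Real.pi) Real.pi).const_mul d
  have h1 := intervalIntegral.integral_mono_on (by linarith)
    (hF.intervalIntegrable (μ := volume) (-Real.pi) Real.pi) ((i1.add i2).add i3)
    fun v hv => h v (abs_le.2 hv)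
  have e : ∫ v in (-Real.pi)..Real.pi, (1 / (1 * v ^ 2 + Q) + c + d * (1 / (1 / 20 * v ^ 2 + T)))
      = (∫ v in (-Real.pi)..Real.pi, 1 / (1 * v ^ 2 + Q)) + (Real.pi - -Real.pi) * c
        + d * ∫ v in (-Real.pi)..Real.pi, 1 / (1 / 20 * v ^ 2 + T) := by
    rw [intervalIntegral.integral_add (i1.add i2) i3, intervalIntegral.integral_add i1 i2,
      intervalIntegral.integral_const_mul, intervalIntegral.integral_const, smul_eq_mul]
  have h2 := integral_one_div_quadratic_le one_pos hQ Real.pi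
  have h3 := mul_le_mul_of_nonneg_left
    (integral_one_div_quadratic_le (by norm_num : (0 : ℝ) < 1 / 20) hT Real.pi) hd
  refine (h1.trans (le_of_eq e)).trans ?_
  linarith

lemma integral_cap_cellSq_le {T : ℝ} (hT : 0 < T) (hT1 : T ≤ 1) :
    ∫ η in (-(Real.pi / 2))..(Real.pi / 2), ∫ v in (-Real.pi)..Real.pi, cap T (cellSq v η)
      ≤ 2 * Real.log (1 / T) + 8000 := by
  have hπ := Real.pi_pos
  have hc := continuous_cap_cellSq hT
  have hq := continuous_one_div_quadratic (by norm_num : (0 : ℝ) < 1 / 20) hT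
  have j1 := continuous_pi_div_sqrt hT
  have j3 : Continuous fun η : ℝ => T * (1 / (1 / 20 * η ^ 2 + T))
    * (Real.pi / Real.sqrt (1 / 20 * T)) := (continuous_const.mul hq).mul continuous_const
  have hm : Continuous fun η : ℝ =>
      Real.pi / Real.sqrt (1 * (Real.pi ^ 2 / 4 * η ^ 2 + 2 * T)) + 341 * (2 * Real.pi)
      + 5 / 2 * (T * (1 / (1 / 20 * η ^ 2 + T)) * (Real.pi / Real.sqrt (1 / 20 * T))) :=
    (j1.add continuous_const).add (j3.const_smul (5 / 2 : ℝ))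
  have inner : ∀ η ∈ Set.Icc (-(Real.pi / 2)) (Real.pi / 2),
      ∫ v in (-Real.pi)..Real.pi, cap T (cellSq v η)
        ≤ Real.pi / Real.sqrt (1 * (Real.pi ^ 2 / 4 * η ^ 2 + 2 * T)) + 341 * (2 * Real.pi)
          + 5 / 2 * (T * (1 / (1 / 20 * η ^ 2 + T)) * (Real.pi / Real.sqrt (1 / 20 * T))) := by
    intro η hη
    have hQ : 0 < Real.pi ^ 2 / 4 * η ^ 2 + 2 * T := by positivity
    have h4 : 0 ≤ 5 / 2 * (T * (1 / (1 / 20 * η ^ 2 + T))) := by positivity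
    have hF := continuous_slice (F := fun v η => cap T (cellSq v η)) hc η
    have hb : ∀ v, |v| ≤ Real.pi → cap T (cellSq v η)
        ≤ 1 / (1 * v ^ 2 + (Real.pi ^ 2 / 4 * η ^ 2 + 2 * T)) + 341
          + 5 / 2 * (T * (1 / (1 / 20 * η ^ 2 + T))) * (1 / (1 / 20 * v ^ 2 + T)) := fun v hv => by
      have := cap_cellSq_le hT hv (abs_le.2 hη)
      rwa [← mul_assoc (5 / 2 : ℝ)] at this
    have := integral_le_quadratic hF hT hQ h4 hb
    rwa [mul_assoc (5 / 2 : ℝ)] at this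
  have h1 := iterated_integral_le (F := fun v η => cap T (cellSq v η)) hc hm (by linarith) inner
  have k1 := j1.intervalIntegrable (μ := volume) (-(Real.pi / 2)) (Real.pi / 2)
  have k2 : IntervalIntegrable (fun _ : ℝ => 341 * (2 * Real.pi)) volume (-(Real.pi / 2))
    (Real.pi / 2) := by simp
  have k3 := (j3.intervalIntegrable (μ := volume) (-(Real.pi / 2)) (Real.pi / 2)).const_mul (5 / 2)
  rw [intervalIntegral.integral_add (k1.add k2) k3, intervalIntegral.integral_add k1 k2,
    intervalIntegral.integral_const_mul, intervalIntegral.integral_const, smul_eq_mul,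
    intervalIntegral.integral_const_mul] at h1
  have h2 := integral_pi_div_sqrt_le hT hT1
  have h3 := mul_integral_quadratic_le hT
  have h4 := pi_sq_le_ten
  refine h1.trans ?_
  have e : 341 * ((Real.pi / 2 - -(Real.pi / 2)) * (2 * Real.pi)) = 682 * Real.pi ^ 2 := by ring
  rw [e]
  linarith

/-- Each of the two one-dimensional integrals is of order `1 / √T`, against the prefactor `T²`. -/
lemma integral_sq_div_cellSq_le {T : ℝ} (hT : 0 < T) :
    ∫ η in (-(Real.pi / 2))..(Real.pi / 2), ∫ v in (-Real.pi)..Real.pi,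
      T ^ 2 / (cellSq v η + T) ^ 2 ≤ 200 * T := by
  have hπ := Real.pi_pos
  have hc := continuous_sq_div_cellSq hT
  have hq := continuous_one_div_quadratic (by norm_num : (0 : ℝ) < 1 / 20) hT
  have j3 : Continuous fun η : ℝ => T * (1 / (1 / 20 * η ^ 2 + T))
    * (Real.pi / Real.sqrt (1 / 20 * T)) := (continuous_const.mul hq).mul continuous_const
  have h1 := iterated_integral_le (F := fun v η => T ^ 2 / (cellSq v η + T) ^ 2) hc
    (m := fun η => T * (T * (1 / (1 / 20 * η ^ 2 + T)) * (Real.pi / Real.sqrt (1 / 20 * T))))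
    (continuous_const.mul j3) (a := Real.pi) (b := Real.pi / 2)
    (by linarith) fun η hη => by
      have h4 : 0 ≤ T * (T * (1 / (1 / 20 * η ^ 2 + T))) := by positivity
      have i3 := ((hq.intervalIntegrable (μ := volume) (-Real.pi) Real.pi).const_mul
        (T * (T * (1 / (1 / 20 * η ^ 2 + T)))))
      have := intervalIntegral.integral_mono_on (by linarith)
        ((continuous_slice (F := fun v η => T ^ 2 / (cellSq v η + T) ^ 2) hc η).intervalIntegrable
          (μ := volume) (-Real.pi) Real.pi) i3 fun v hv => by
          have := sq_div_cellSq_le hT (abs_le.2 hv) (abs_le.2 hη)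
          linarith
      rw [intervalIntegral.integral_const_mul] at this
      have h3 := mul_le_mul_of_nonneg_left
        (integral_one_div_quadratic_le (by norm_num : (0 : ℝ) < 1 / 20) hT Real.pi) h4
      refine this.trans (h3.trans (le_of_eq ?_))
      ring
  rw [intervalIntegral.integral_const_mul] at h1
  have h3 := mul_le_mul_of_nonneg_left (mul_integral_quadratic_le hT) hT.le
  linarith

/-! ### Choosing the position of the lattice by averaging. -/

lemma integrable_disc_prod {k : ℂ → ℝ → ℝ} (hk : Continuous fun p : ℂ × ℝ => k p.1 p.2) (L : ℝ) :
    Integrable (fun p : ℂ × ℝ => k p.1 p.2)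
      ((volume.restrict disc).prod (volume.restrict (Set.Ioc 0 L))) := by
  rw [Measure.prod_restrict, ← Measure.volume_eq_prod]
  exact (hk.continuousOn.integrableOn_compact
    ((isCompact_closedBall (0 : ℂ) 1).prod (isCompact_Icc (a := (0 : ℝ)) (b := L)))).mono_set
    (Set.prod_mono ball_subset_closedBall Set.Ioc_subset_Icc_self)

/-- Some parameter does at least as well as the average over all parameters. -/
lemma exists_integral_le_average {k : ℂ → ℝ → ℝ} (hk : Continuous fun p : ℂ × ℝ => k p.1 p.2)
    {L : ℝ} (hL : 0 < L) :
    ∃ s, ∫ z in disc, k z s ≤ (1 / L) * ∫ z in disc, ∫ s in (0 : ℝ)..L, k z s := by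
  have hi := integrable_disc_prod hk L
  have h1 := hi.integral_prod_right
  obtain ⟨s, -, hs⟩ := exists_le_setAverage (μ := (volume : Measure ℝ)) (s := Set.Ioc 0 L)
    (by simp [hL]) (by simp) h1
  refine ⟨s, hs.trans (le_of_eq ?_)⟩
  rw [setAverage_eq, integral_integral_swap (f := fun s z => k z s) hi.swap, smul_eq_mul]
  simp only [intervalIntegral.integral_of_le hL.le]
  simp [Measure.real, hL.le]

lemma integral_comp_sub_of_periodic {f : ℝ → ℝ} {L : ℝ} (hf : Function.Periodic f L) (x d : ℝ) :
    ∫ s in (0 : ℝ)..L, f (x - s) = ∫ v in (-(L / 2))..(L / 2), f (v + d) := by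
  rw [intervalIntegral.integral_comp_sub_left, intervalIntegral.integral_comp_add_right]
  have h1 := hf.intervalIntegral_add_eq (x - L) (-(L / 2) + d)
  rw [sub_add_cancel] at h1
  rw [sub_zero, h1]
  congr 1
  ring

/-- Translating a doubly periodic function suitably, its weighted integral over the disc is
at most its mean. -/
lemma exists_shift_le {F : ℝ → ℝ → ℝ} (hF : Continuous fun p : ℝ × ℝ => F p.1 p.2)
    (h1 : ∀ v η, F (v + 2 * Real.pi) η = F v η) (h2 : ∀ v η, F v (η + Real.pi) = F v η)
    {h : ℂ → ℝ} (hc : Continuous h) (a b : ℝ) :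
    ∃ s t, ∫ z in disc, h z * F (a * z.re - s) (b * z.im - t) ≤ 1 / (2 * Real.pi ^ 2)
      * (∫ z in disc, h z) * ∫ η in (-(Real.pi / 2))..(Real.pi / 2),
        ∫ v in (-Real.pi)..Real.pi, F (v + Real.pi) (η + Real.pi / 2) := by
  have hπ := Real.pi_pos
  set m : ℝ → ℝ := fun η => ∫ v in (-Real.pi)..Real.pi, F (v + Real.pi) η with hm
  have hmc : Continuous m := by
    refine intervalIntegral.continuous_parametric_intervalIntegral_of_continuous'
      (f := fun η v => F (v + Real.pi) η) ?_ (-Real.pi) Real.pi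
    exact hF.comp (f := fun p : ℝ × ℝ => (p.2 + Real.pi, p.1)) (by fun_prop)
  have hmp : Function.Periodic m Real.pi := fun η => by
    simp only [hm, h2]
  have hre : Continuous Complex.re := Complex.continuous_re
  have him : Continuous Complex.im := Complex.continuous_im
  -- First `t` is chosen for the function averaged over `v`; then `s` is chosen for this `t`.
  obtain ⟨t, ht⟩ := exists_integral_le_average (k := fun z t => h z * m (b * z.im - t))
    (by fun_prop) hπ
  obtain ⟨s, hs⟩ := exists_integral_le_average
    (k := fun z s => h z * F (a * z.re - s) (b * z.im - t))
    ((hc.comp continuous_fst).mul (hF.comp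
      (f := fun p : ℂ × ℝ => (a * p.1.re - p.2, b * p.1.im - t)) (by fun_prop)))
    (show 0 < 2 * Real.pi by positivity)
  refine ⟨s, t, hs.trans ?_⟩
  have e1 : ∀ z : ℂ, ∫ s in (0 : ℝ)..(2 * Real.pi), h z * F (a * z.re - s) (b * z.im - t)
      = h z * m (b * z.im - t) := fun z => by
    rw [intervalIntegral.integral_const_mul]
    have := integral_comp_sub_of_periodic (f := fun v => F v (b * z.im - t))
      (fun v => h1 v _) (a * z.re) Real.pi
    rw [mul_div_cancel_left₀ _ (two_ne_zero (α := ℝ))] at this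
    exact congrArg (h z * ·) this
  have e2 : ∀ z : ℂ, ∫ t in (0 : ℝ)..Real.pi, h z * m (b * z.im - t)
      = h z * ∫ η in (-(Real.pi / 2))..(Real.pi / 2), m (η + Real.pi / 2) := fun z => by
    rw [intervalIntegral.integral_const_mul, integral_comp_sub_of_periodic hmp _ (Real.pi / 2)]
  have e3 : ∫ η in (-(Real.pi / 2))..(Real.pi / 2), ∫ v in (-Real.pi)..Real.pi,
      F (v + Real.pi) (η + Real.pi / 2)
      = ∫ η in (-(Real.pi / 2))..(Real.pi / 2), m (η + Real.pi / 2) := rfl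
  rw [e3]
  simp only [e1]
  simp only [e2, integral_mul_const] at ht
  generalize ∫ η in (-(Real.pi / 2))..(Real.pi / 2), m (η + Real.pi / 2) = J at *
  refine (mul_le_mul_of_nonneg_left ht (by positivity)).trans (le_of_eq ?_)
  field_simp

lemma continuous_comp_shift {F : ℝ → ℝ → ℝ} (hF : Continuous fun p : ℝ × ℝ => F p.1 p.2)
    (a b s t : ℝ) : Continuous fun z : ℂ => F (a * z.re - s) (b * z.im - t) :=
  hF.comp (f := fun z : ℂ => (a * z.re - s, b * z.im - t))
    (((continuous_const.mul Complex.continuous_re).sub continuous_const).prodMk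
      ((continuous_const.mul Complex.continuous_im).sub continuous_const))

lemma integrableOn_disc_mul {f g : ℂ → ℝ} (hf : Continuous f) (hg : Continuous g) :
    IntegrableOn (fun z => f z * g z) disc :=
  integrableOn_disc (hf.mul hg)

lemma iterated_integral_add {F G : ℝ → ℝ → ℝ} (hF : Continuous fun p : ℝ × ℝ => F p.1 p.2)
    (hG : Continuous fun p : ℝ × ℝ => G p.1 p.2) (A B a b : ℝ) :
    ∫ η in (-b)..b, ∫ v in (-a)..a, (A * F v η + B * G v η)
      = A * (∫ η in (-b)..b, ∫ v in (-a)..a, F v η)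
        + B * ∫ η in (-b)..b, ∫ v in (-a)..a, G v η := by
  have e1 : ∀ η, ∫ v in (-a)..a, (A * F v η + B * G v η)
      = A * (∫ v in (-a)..a, F v η) + B * ∫ v in (-a)..a, G v η := fun η => by
    have k1 := (continuous_slice hF η).intervalIntegrable (μ := volume) (-a) a
    have k2 := (continuous_slice hG η).intervalIntegrable (μ := volume) (-a) a
    rw [intervalIntegral.integral_add (k1.const_mul _) (k2.const_mul _),
      intervalIntegral.integral_const_mul, intervalIntegral.integral_const_mul]
  simp only [e1]
  have k1 := (continuous_inner_integral hF a).intervalIntegrable (μ := volume) (-b) b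
  have k2 := (continuous_inner_integral hG a).intervalIntegrable (μ := volume) (-b) b
  rw [intervalIntegral.integral_add (k1.const_mul _) (k2.const_mul _),
    intervalIntegral.integral_const_mul, intervalIntegral.integral_const_mul]

/-- The translation in `exists_shift_le` can be chosen simultaneously for two functions, as far
as a combination of the two weighted integrals is concerned. -/
lemma exists_shift_add_le {F G : ℝ → ℝ → ℝ} (hF : Continuous fun p : ℝ × ℝ => F p.1 p.2)
    (hG : Continuous fun p : ℝ × ℝ => G p.1 p.2)
    (hF1 : ∀ v η, F (v + 2 * Real.pi) η = F v η) (hF2 : ∀ v η, F v (η + Real.pi) = F v η)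
    (hG1 : ∀ v η, G (v + 2 * Real.pi) η = G v η) (hG2 : ∀ v η, G v (η + Real.pi) = G v η)
    {h : ℂ → ℝ} (hc : Continuous h) (hn : ∫ z in disc, h z = 1) {A B : ℝ} (hA : 0 ≤ A)
    (hB : 0 ≤ B) {mF mG : ℝ}
    (hmF : ∫ η in (-(Real.pi / 2))..(Real.pi / 2), ∫ v in (-Real.pi)..Real.pi,
      F (v + Real.pi) (η + Real.pi / 2) ≤ mF)
    (hmG : ∫ η in (-(Real.pi / 2))..(Real.pi / 2), ∫ v in (-Real.pi)..Real.pi,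
      G (v + Real.pi) (η + Real.pi / 2) ≤ mG) (a b : ℝ) :
    ∃ s t, A * (∫ z in disc, h z * F (a * z.re - s) (b * z.im - t))
      + B * (∫ z in disc, h z * G (a * z.re - s) (b * z.im - t))
      ≤ 1 / (2 * Real.pi ^ 2) * (A * mF + B * mG) := by
  obtain ⟨s, t, hst⟩ := exists_shift_le (F := fun v η => A * F v η + B * G v η)
    ((continuous_const.mul hF).add (continuous_const.mul hG))
    (fun v η => by rw [hF1, hG1]) (fun v η => by rw [hF2, hG2]) hc a b
  refine ⟨s, t, ?_⟩
  have hs : Continuous fun p : ℝ × ℝ => (p.1 + Real.pi, p.2 + Real.pi / 2) := by fun_prop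
  rw [iterated_integral_add (F := fun v η => F (v + Real.pi) (η + Real.pi / 2))
    (G := fun v η => G (v + Real.pi) (η + Real.pi / 2)) (hF.comp hs) (hG.comp hs), hn,
    mul_one] at hst
  have iF := integrableOn_disc_mul hc (continuous_comp_shift hF a b s t)
  have iG := integrableOn_disc_mul hc (continuous_comp_shift hG a b s t)
  rw [← integral_const_mul, ← integral_const_mul,
    ← integral_add (iF.const_mul A) (iG.const_mul B)]
  have e : ∀ z : ℂ, A * (h z * F (a * z.re - s) (b * z.im - t))
      + B * (h z * G (a * z.re - s) (b * z.im - t))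
      = h z * (A * F (a * z.re - s) (b * z.im - t) + B * G (a * z.re - s) (b * z.im - t)) :=
    fun z => by ring
  simp only [e]
  refine hst.trans (mul_le_mul_of_nonneg_left ?_ (by positivity))
  exact add_le_add (mul_le_mul_of_nonneg_left hmF hA) (mul_le_mul_of_nonneg_left hmG hB)

lemma continuous_sq_div_vortSq {T : ℝ} (hT : 0 < T) :
    Continuous fun p : ℝ × ℝ => T ^ 2 / (vortSq p.1 p.2 + T) ^ 2 := by
  have hc : Continuous fun p : ℝ × ℝ => vortSq p.1 p.2 := by
    unfold vortSq
    fun_prop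
  refine continuous_const.div ((hc.add continuous_const).pow 2) fun p => ?_
  have := vortSq_nonneg p.1 p.2
  positivity

lemma vortSq_add_two_pi (v η : ℝ) : vortSq (v + 2 * Real.pi) η = vortSq v η := by
  unfold vortSq
  rw [Real.cos_add_two_pi]

lemma vortSq_add_pi_right (v η : ℝ) : vortSq v (η + Real.pi) = vortSq v η := by
  unfold vortSq
  rw [Real.cos_add_pi, mul_neg (Real.pi / 2), Real.cos_neg]

/-- The vortex lattice can be placed so that kinetic energy and loss of mass are controlled. -/
lemma exists_lattice_shift {T : ℝ} (hT : 0 < T) (hT1 : T ≤ 1) {h : ℂ → ℝ} (hc : Continuous h)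
    (hn : ∫ z in disc, h z = 1) {A B : ℝ} (hA : 0 ≤ A) (hB : 0 ≤ B) (a b : ℝ) :
    ∃ s t, A * (∫ z in disc, h z * cap T (vortSq (a * z.re - s) (b * z.im - t)))
      + B * (∫ z in disc, h z * (T ^ 2 / (vortSq (a * z.re - s) (b * z.im - t) + T) ^ 2))
      ≤ 1 / (2 * Real.pi ^ 2) * (A * (2 * Real.log (1 / T) + 8000) + B * (200 * T)) := by
  refine exists_shift_add_le (F := fun v η => cap T (vortSq v η))
    (G := fun v η => T ^ 2 / (vortSq v η + T) ^ 2) (continuous_cap_vortSq hT)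
    (continuous_sq_div_vortSq hT) (fun v η => congrArg (cap T) (vortSq_add_two_pi v η))
    (fun v η => congrArg (cap T) (vortSq_add_pi_right v η))
    (fun v η => congrArg (fun x => T ^ 2 / (x + T) ^ 2) (vortSq_add_two_pi v η))
    (fun v η => congrArg (fun x => T ^ 2 / (x + T) ^ 2) (vortSq_add_pi_right v η))
    hc hn hA hB ?_ ?_ a b
  · have := integral_cap_cellSq_le hT hT1
    simpa only [vortSq_add] using this
  · have := integral_sq_div_cellSq_le hT
    simpa only [vortSq_add] using this

/-! ### Trial functions with controlled kinetic energy and mass. -/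

section trial

variable {κ ϖ μ Ω T δ lam s t : ℝ} {N : ℕ}

lemma integral_kin_trial_le (hκ : 0 < κ) (hT : 0 < T) (hδ : 0 < δ)
    (hlam : lam ^ 2 = Real.pi ^ 2 * Ω / 2)
    (hz : ∀ z ∈ disc, |2 / Real.pi * lam * z.im - t| < N * Real.pi) :
    ∫ z in disc, kin Ω (trial T lam Ω s t N (amp κ ϖ μ)) z
      ≤ (1 + 1 / δ) * (∫ z in disc, gradSq κ ϖ μ z) + (1 + δ) * lam ^ 2 * ∫ z in disc,
        dens κ ϖ μ z * cap T (vortSq (lam * z.re - s) (2 / Real.pi * lam * z.im - t)) := by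
  have hf := contDiff_amp (ϖ := ϖ) (μ := μ) hκ
  have hE := continuous_comp_shift (F := fun v η => cap T (vortSq v η)) (continuous_cap_vortSq hT)
    lam (2 / Real.pi * lam) s t
  have iG : IntegrableOn (gradSq κ ϖ μ) disc := integrableOn_disc (continuous_gradSq hκ)
  have iE := integrableOn_disc_mul (continuous_dens κ ϖ μ) hE
  have hΨ := contDiff_trial (lam := lam) (Ω := Ω) (s := s) (t := t) (N := N) hT hf
  rw [← integral_const_mul, ← integral_const_mul,
    ← integral_add (iG.const_mul _) (iE.const_mul _)]
  refine setIntegral_mono_on (integrableOn_disc (continuous_kin Ω hΨ))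
    ((iG.const_mul _).add (iE.const_mul _)) measurableSet_disc fun z hzd => ?_
  refine (kin_trial_le hT hδ hlam hf z (hz z hzd)).trans (le_of_eq ?_)
  rw [amp_sq hκ, gradSq]
  ring

lemma one_sub_integral_trial_sq (hκ : 0 < κ) (hT : 0 < T)
    (hn : ∫ z in disc, dens κ ϖ μ z = 1)
    (hz : ∀ z ∈ disc, |2 / Real.pi * lam * z.im - t| < N * Real.pi) :
    1 - ∫ z in disc, ‖trial T lam Ω s t N (amp κ ϖ μ) z‖ ^ 2 = ∫ z in disc, dens κ ϖ μ z
      * (T ^ 2 / (vortSq (lam * z.re - s) (2 / Real.pi * lam * z.im - t) + T) ^ 2) := by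
  have hf := contDiff_amp (ϖ := ϖ) (μ := μ) hκ
  have hΨ := contDiff_trial (lam := lam) (Ω := Ω) (s := s) (t := t) (N := N) hT hf
  have i1 : IntegrableOn (dens κ ϖ μ) disc := integrableOn_disc (continuous_dens κ ϖ μ)
  have i2 : IntegrableOn (fun z => ‖trial T lam Ω s t N (amp κ ϖ μ) z‖ ^ 2) disc :=
    integrableOn_disc (hΨ.continuous.norm.pow 2)
  rw [← hn, ← integral_sub i1 i2]
  refine setIntegral_congr_fun measurableSet_disc fun z hzd => ?_
  have h1 := norm_trial_sq (s := s) (Ω := Ω) (f := amp κ ϖ μ) hT z (hz z hzd)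
  rw [amp_sq hκ] at h1
  change dens κ ϖ μ z - ‖trial T lam Ω s t N (amp κ ϖ μ) z‖ ^ 2 = _
  rw [h1]
  ring

/-- A trial function whose kinetic energy and loss of mass are controlled. -/
lemma exists_trial {Λ : ℝ} (hκ : 0 < κ) (hn : ∫ z in disc, dens κ ϖ μ z = 1)
    (hΩ : 0 < Ω) (hT : 0 < T) (hT1 : T ≤ 1) (hδ : 0 < δ) (hΛ : 0 < Λ) :
    ∃ Ψ : ℂ → ℂ, ContDiff ℝ 1 Ψ ∧ (∀ z, ‖Ψ z‖ ^ 2 ≤ dens κ ϖ μ z) ∧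
      (∫ z in disc, kin Ω Ψ z) + Λ * (1 - ∫ z in disc, ‖Ψ z‖ ^ 2)
        ≤ (1 + 1 / δ) * (∫ z in disc, gradSq κ ϖ μ z)
          + (1 + δ) * (1 / 2 * Ω * Real.log (1 / T) + 2000 * Ω) + 12 * Λ * T := by
  have hπ := Real.pi_pos
  obtain ⟨lam, hlam⟩ : ∃ lam : ℝ, lam ^ 2 = Real.pi ^ 2 * Ω / 2 :=
    ⟨Real.sqrt (Real.pi ^ 2 * Ω / 2), Real.sq_sqrt (by positivity)⟩
  -- One position must serve kinetic energy and mass, so the averaged quantity is their sum weighted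
  -- with `(1 + δ) λ²` and `Λ`.
  obtain ⟨s, t, hst⟩ := exists_lattice_shift hT hT1 (continuous_dens κ ϖ μ) hn
    (show 0 ≤ (1 + δ) * lam ^ 2 by positivity) hΛ.le lam (2 / Real.pi * lam)
  -- Enough modes for the whole disc to stay inside the strips where the truncated sum equals the
  -- full lattice.
  obtain ⟨N, hN⟩ := exists_nat_gt ((|2 / Real.pi * lam| + |t|) / Real.pi)
  rw [div_lt_iff₀ hπ] at hN
  have hz : ∀ z ∈ disc, |2 / Real.pi * lam * z.im - t| < N * Real.pi := fun z hz => by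
    refine lt_of_le_of_lt (abs_sub _ _) ?_
    rw [abs_mul]
    have h1 : |z.im| ≤ 1 := (Complex.abs_im_le_norm z).trans (norm_lt_one_of_mem_disc hz).le
    have := mul_le_of_le_one_right (abs_nonneg (2 / Real.pi * lam)) h1
    linarith
  refine ⟨trial T lam Ω s t N (amp κ ϖ μ), contDiff_trial hT (contDiff_amp hκ), fun z => ?_, ?_⟩
  · rw [← amp_sq hκ]
    exact norm_trial_sq_le hT z
  rw [one_sub_integral_trial_sq hκ hT hn hz]
  have h1 := integral_kin_trial_le (ϖ := ϖ) (μ := μ) (s := s) hκ hT hδ hlam hz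
  have e3 : 1 / (2 * Real.pi ^ 2) * ((1 + δ) * lam ^ 2 * (2 * Real.log (1 / T) + 8000)
      + Λ * (200 * T)) = (1 + δ) * (1 / 2 * Ω * Real.log (1 / T) + 2000 * Ω)
        + Λ * T * (100 / Real.pi ^ 2) := by
    rw [hlam]
    field_simp
    ring
  have e4 : Λ * T * (100 / Real.pi ^ 2) ≤ Λ * T * 12 := by
    refine mul_le_mul_of_nonneg_left ?_ (by positivity)
    rw [div_le_iff₀ (by positivity)]
    linarith [nine_le_pi_sq]
  rw [e3] at hst
  linarith

end trial

/-! ### Normalisation and choice of parameters. -/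

/-- The cost of normalising a trial function of mass `N` close to `1`. -/
lemma normalized_le {k p p' q q' M Λ N : ℝ} (hk : 0 ≤ k) (hp' : 0 ≤ p') (hp : p' ≤ p)
    (hq' : 0 ≤ q') (hq : q' ≤ q) (hN : N ≤ 1) (hΛ : 0 < Λ) (hM : k + Λ * (1 - N) ≤ M)
    (hMΛ : M ≤ Λ / 2) (hpq : 6 * (p + q) ≤ Λ) :
    1 / 2 ≤ N ∧ k / N + p' / N + q' / N ^ 2 ≤ p + q + M + 2 * M ^ 2 / Λ := by
  set n := 1 - N with hn
  have hn0 : 0 ≤ n := by linarith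
  have h1 : n ≤ M / Λ := by
    rw [le_div_iff₀ hΛ]
    linarith
  have h2 : M / Λ ≤ 1 / 2 := by
    rw [div_le_iff₀ hΛ]
    linarith
  have hM0 : 0 ≤ M := by nlinarith
  have hN2 : 1 / 2 ≤ N := by linarith
  have hN0 : 0 < N := by linarith
  refine ⟨hN2, ?_⟩
  have a1 : 1 / N ≤ 1 + 2 * n := by
    rw [div_le_iff₀ hN0]
    nlinarith
  have a2 : 1 / N ^ 2 ≤ 1 + 6 * n := by
    rw [div_le_iff₀ (by positivity)]
    have : N = 1 - n := by linarith
    rw [this]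
    nlinarith [mul_nonneg hn0 hn0, mul_nonneg hn0 (by linarith : 0 ≤ 1 / 2 - n)]
  have b1 : k / N ≤ k * (1 + 2 * n) := by
    rw [div_eq_mul_one_div]
    exact mul_le_mul_of_nonneg_left a1 hk
  have b2 : p' / N ≤ p * (1 + 2 * n) := by
    rw [div_eq_mul_one_div]
    exact mul_le_mul hp a1 (by positivity) (by linarith)
  have b3 : q' / N ^ 2 ≤ q * (1 + 6 * n) := by
    rw [div_eq_mul_one_div]
    exact mul_le_mul hq a2 (by positivity) (by linarith)
  -- The increase `2 n p + 6 n q` due to division by the mass is absorbed by the penalty `Λ n`. What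
  -- remains is `2 k n`, at most `2 M² / Λ` by `c2`.
  have c1 : n * (6 * (p + q)) ≤ n * Λ := mul_le_mul_of_nonneg_left hpq hn0
  have c2 : k * n ≤ M * (M / Λ) := by
    refine mul_le_mul ?_ h1 hn0 hM0
    have : 0 ≤ Λ * n := by positivity
    linarith
  have c3 : 2 * M ^ 2 / Λ = 2 * (M * (M / Λ)) := by ring
  have c4 : 0 ≤ n * p := mul_nonneg hn0 (by linarith)
  rw [c3]
  nlinarith

/-- An upper bound for the Gross-Pitaevskii energy by a regularised Thomas-Fermi profile
carrying a vortex lattice, before the parameters are chosen. -/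
lemma gpEnergy_le_of_params {ε Ω κ T δ Λ μ M : ℝ} (hε : 0 < ε) (hΩ : 0 < Ω) (hκ : 0 < κ)
    (hn : ∫ z in disc, dens κ (ε * Ω) μ z = 1)
    (hT : 0 < T) (hT1 : T ≤ 1) (hδ : 0 < δ) (hΛ : 0 < Λ)
    (hM : (1 + 1 / δ) * (∫ z in disc, gradSq κ (ε * Ω) μ z)
      + (1 + δ) * (1 / 2 * Ω * Real.log (1 / T) + 2000 * Ω) + 12 * Λ * T ≤ M)
    (hMΛ : M ≤ Λ / 2) (hΛ6 : 6 * ((2 * (2 + ε * Ω) + 2 * κ ^ 2) / ε ^ 2) ≤ Λ) :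
    gpEnergy ε Ω ≤ tfEnergy ε Ω + Real.pi * κ ^ 2 / (2 * ε ^ 2) + M + 2 * M ^ 2 / Λ := by
  obtain ⟨Ψ, hΨ, hle, hkin⟩ := exists_trial (Ω := Ω) hκ hn hΩ hT hT1 hδ hΛ
  have cΨ := hΨ.continuous
  have cd := continuous_dens κ (ε * Ω) μ
  have iΨ : IntegrableOn (fun z => ‖Ψ z‖ ^ 2) disc := integrableOn_disc (by fun_prop)
  have id : IntegrableOn (dens κ (ε * Ω) μ) disc := integrableOn_disc cd
  have hN1 : ∫ z in disc, ‖Ψ z‖ ^ 2 ≤ 1 := by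
    rw [← hn]
    exact setIntegral_mono_on iΨ id measurableSet_disc fun z _ => hle z
  have hk0 : 0 ≤ ∫ z in disc, kin Ω Ψ z :=
    setIntegral_nonneg measurableSet_disc fun z _ => kin_nonneg Ω Ψ z
  have hw : ∀ z ∈ disc, 0 ≤ Ω ^ 2 / 4 * (1 - ‖z‖ ^ 2) := fun z hz => by
    have := norm_sq_le_one_of_mem_disc hz
    have : 0 ≤ 1 - ‖z‖ ^ 2 := by linarith
    positivity
  have hp0 : 0 ≤ ∫ z in disc, Ω ^ 2 / 4 * (1 - ‖z‖ ^ 2) * ‖Ψ z‖ ^ 2 :=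
    setIntegral_nonneg measurableSet_disc fun z hz => mul_nonneg (hw z hz) (by positivity)
  have hp : ∫ z in disc, Ω ^ 2 / 4 * (1 - ‖z‖ ^ 2) * ‖Ψ z‖ ^ 2
      ≤ ∫ z in disc, Ω ^ 2 / 4 * (1 - ‖z‖ ^ 2) * dens κ (ε * Ω) μ z :=
    setIntegral_mono_on (integrableOn_disc (by fun_prop)) (integrableOn_disc (by fun_prop))
      measurableSet_disc fun z hz => mul_le_mul_of_nonneg_left (hle z) (hw z hz)
  have hq0 : 0 ≤ ∫ z in disc, ‖Ψ z‖ ^ 4 / ε ^ 2 :=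
    setIntegral_nonneg measurableSet_disc fun z hz => by positivity
  have hq : ∫ z in disc, ‖Ψ z‖ ^ 4 / ε ^ 2 ≤ ∫ z in disc, dens κ (ε * Ω) μ z ^ 2 / ε ^ 2 := by
    refine setIntegral_mono_on (integrableOn_disc (by fun_prop)) (integrableOn_disc (by fun_prop))
      measurableSet_disc fun z _ => div_le_div_of_nonneg_right ?_ (by positivity)
    calc ‖Ψ z‖ ^ 4 = (‖Ψ z‖ ^ 2) ^ 2 := by ring
      _ ≤ _ := pow_le_pow_left₀ (by positivity) (hle z) 2
  have hS := tfs_one_le hκ (by positivity : 0 ≤ ε * Ω) hn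
  have hpq := integral_potential_add_le hε hn
  have hpq2 := integral_potential_add hε hn
  have hle6 : 6 * ((2 * tfs (ε * Ω) μ 1 + 2 * κ ^ 2) / ε ^ 2)
      ≤ 6 * ((2 * (2 + ε * Ω) + 2 * κ ^ 2) / ε ^ 2) := by gcongr
  obtain ⟨hN, hE⟩ := normalized_le hk0 hp0 hp hq0 hq hN1 hΛ (hkin.trans hM) hMΛ (by linarith)
  have h1 := gpEnergy_le_of_contDiff ε Ω hΨ (by linarith)
  have h2 := tfFunctional_dens_le_tfEnergy hε hκ hn
  linarith

lemma log_one_div_le_two_div_sqrt {ε : ℝ} (hε : 0 < ε) :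
    Real.log (1 / ε) ≤ 2 / Real.sqrt ε := by
  have hs : 0 < Real.sqrt ε := Real.sqrt_pos.2 hε
  have h1 : 1 / ε = (1 / Real.sqrt ε) ^ 2 := by
    rw [div_pow, Real.sq_sqrt hε.le, one_pow]
  rw [h1, Real.log_pow]
  have h2 := Real.log_le_sub_one_of_pos (by positivity : 0 < 1 / Real.sqrt ε)
  have h3 : 2 / Real.sqrt ε = 2 * (1 / Real.sqrt ε) := by ring
  rw [h3]
  push_cast
  linarith

section parameters

variable {ε Ω σ ϖ μ l : ℝ}

/-- Both logarithms of `integral_gradSq_le` are at most `2 log (1/ε)`, and `ϖ² = Ω σ²`. -/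
lemma integral_gradSq_le_log (hε : 0 < ε) (hε1 : ε ≤ 1 / 1000) (hσ0 : 0 < σ) (hσε : ε ≤ σ)
    (hσ1 : σ ≤ 1 / 10) (hϖ0 : 0 < ϖ) (hϖε : ϖ * ε = σ ^ 2) (hϖσ : ϖ ^ 2 = Ω * σ ^ 2)
    (hn : ∫ z in disc, dens σ ϖ μ z = 1) :
    ∫ z in disc, gradSq σ ϖ μ z ≤ 2 * Ω * σ ^ 2 * Real.log (1 / ε) := by
  have hlog : ∀ x : ℝ, 0 < x → x * ε ^ 2 ≤ 1 → Real.log x ≤ 2 * Real.log (1 / ε) :=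
    fun x hx hx2 => by
      have : Real.log x ≤ Real.log ((1 / ε) ^ 2) := Real.log_le_log hx (by
        rw [div_pow, one_pow, le_div_iff₀ (by positivity)]
        exact hx2)
      rwa [Real.log_pow] at this
  refine (integral_gradSq_le hσ0 hσ1 hϖ0 hn).trans ?_
  have h1 : Real.log (1 + 2 * ((2 + ϖ) / σ)) ≤ 2 * Real.log (1 / ε) :=
    hlog _ (by positivity) (by
      have e : ε ^ 2 / σ ≤ ε := by
        rw [div_le_iff₀ hσ0]
        nlinarith
      have e2 : (1 + 2 * ((2 + ϖ) / σ)) * ε ^ 2 = ε ^ 2 + 4 * (ε ^ 2 / σ) + 2 * σ * ε := by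
        field_simp
        linear_combination 2 * hϖε
      rw [e2]
      nlinarith)
  have h2 : Real.log (1 + 2 * (ϖ ^ 2 / (8 * σ))) ≤ 2 * Real.log (1 / ε) :=
    hlog _ (by positivity) (by
      have e2 : (1 + 2 * (ϖ ^ 2 / (8 * σ))) * ε ^ 2 = ε ^ 2 + σ * σ ^ 2 / 4 := by
        field_simp
        linear_combination 8 * (ϖ * ε + σ ^ 2) * hϖε
      rw [e2]
      nlinarith)
  have h3 : Real.pi * (ϖ ^ 2 / 8) ≤ 4 * (ϖ ^ 2 / 8) :=
    mul_le_mul_of_nonneg_right Real.pi_le_four (by positivity)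
  calc _ ≤ 4 * (ϖ ^ 2 / 8) * (4 * Real.log (1 / ε)) := by
        refine mul_le_mul h3 (by linarith) ?_ (by positivity)
        refine add_nonneg (Real.log_nonneg ?_) (Real.log_nonneg ?_) <;>
        · rw [le_add_iff_nonneg_right]
          positivity
    _ = _ := by
        rw [hϖσ]
        ring

/-- A crude comparison with `ε⁻³`, used only where the logarithm multiplies a small factor or enters
a lower-order term. -/
lemma log_core_le (hε : 0 < ε) (hε1 : ε ≤ 1 / 1000) (hσ0 : 0 < σ) (hσε : ε ≤ σ)
    (hϖ0 : 0 < ϖ) (hϖε : ϖ * ε = σ ^ 2) :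
    Real.log ((1 + ϖ) / σ ^ 2) ≤ 3 * Real.log (1 / ε) := by
  have : Real.log ((1 + ϖ) / σ ^ 2) ≤ Real.log ((1 / ε) ^ 3) :=
    Real.log_le_log (by positivity) (by
      rw [div_pow, one_pow, div_le_div_iff₀ (by positivity) (by positivity)]
      have h1 : ε ^ 2 ≤ σ ^ 2 := pow_le_pow_left₀ hε.le hσε 2
      have h2 : (1 + ϖ) * ε ^ 3 = ε * ε ^ 2 + ε ^ 2 * (ϖ * ε) := by ring
      rw [h2, hϖε]
      have h3 : ε * ε ^ 2 ≤ 1 / 1000 * σ ^ 2 := mul_le_mul hε1 h1 (by positivity) (by norm_num)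
      have h4 : ε ^ 2 * σ ^ 2 ≤ 1 / 100 * σ ^ 2 :=
        mul_le_mul_of_nonneg_right (by nlinarith) (by positivity)
      linarith [sq_nonneg σ])
  rw [Real.log_pow] at this
  exact_mod_cast this

/-- The optimisation over the free parameters, with `σ = ε √Ω`, `ϖ = ε Ω`, core area `T`. -/
lemma gpEnergy_le_of_core {T L : ℝ} (hε : 0 < ε) (hε1 : ε ≤ 1 / 1000) (hΩ0 : 0 < Ω)
    (hσ0 : 0 < σ) (hσ1 : σ ≤ 1 / 10) (hϖ0 : 0 < ϖ) (hϖ : ϖ = ε * Ω) (hσ2 : σ ^ 2 = ε ^ 2 * Ω)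
    (hn : ∫ z in disc, dens σ ϖ μ z = 1)
    (hG : ∫ z in disc, gradSq σ ϖ μ z ≤ 2 * Ω * σ ^ 2 * l)
    (hT0 : 0 < T) (hTε : T ≤ ε) (hΩT : Ω / T = (1 + ϖ) / ε ^ 2)
    (hL : L = Real.log (1 / T)) (hL0 : 0 ≤ L) (hL3 : L ≤ 3 * l) (hl1 : ε * l ≤ 1)
    (hl2 : ε * l ^ 2 ≤ 4) (hl0 : 0 ≤ l) :
    gpEnergy ε Ω ≤ tfEnergy ε Ω + 1 / 2 * Ω * L + 20000 * Ω + 6 * (Ω * σ * l) := by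
  -- By `hΩT` this is `36 (1 + ϖ) / ε²`, large enough for normalisation, while the penalty `12 Λ T =
  -- 432 Ω` on the core mass stays `O(Ω)`.
  obtain ⟨Λ, hΛ⟩ : ∃ Λ : ℝ, Λ = 36 * (Ω / T) := ⟨_, rfl⟩
  have hΛ0 : 0 < Λ := by
    rw [hΛ]
    positivity
  have hΛT : Λ * T = 36 * Ω := by
    rw [hΛ]
    field_simp
  -- Taking `δ = σ` balances the costs: `σ² / δ` from the amplitude and `δ` from the lattice both
  -- become `σ`, giving the error `Ω σ log (1/ε)`.
  have hgrad : (1 + 1 / σ) * (∫ z in disc, gradSq σ ϖ μ z) ≤ 4 * (Ω * σ * l) := by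
    refine (mul_le_mul_of_nonneg_left hG (by positivity)).trans ?_
    have e : (1 + 1 / σ) * (2 * Ω * σ ^ 2 * l) = 2 * (Ω * σ * l) * (1 + σ) := by
      field_simp
      ring
    rw [e]
    have : 0 ≤ Ω * σ * l := by positivity
    nlinarith
  have hσL : Ω * σ * L ≤ 3 * (Ω * σ * l) := by
    have := mul_le_mul_of_nonneg_left hL3 (by positivity : 0 ≤ Ω * σ)
    linarith
  -- `2632 = 2000 · 1.1 + 432`, from the cell remainder with `1 + σ ≤ 1.1` and the mass penalty. The
  -- coefficient 6 covers `4 + 3/2`, from `hgrad` and `hσL`.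
  obtain ⟨M, hM⟩ : ∃ M : ℝ, M = 1 / 2 * Ω * L + 2632 * Ω + 6 * (Ω * σ * l) := ⟨_, rfl⟩
  have hMle : M ≤ Ω * (2632 + 3 * l) := by
    have h1 := mul_le_mul_of_nonneg_left hL3 hΩ0.le
    have h2 : Ω * σ * l ≤ Ω * (1 / 10) * l := by gcongr
    have h3 : 0 ≤ Ω * l := by positivity
    rw [hM]
    linarith
  have hM0 : 0 ≤ M := by
    rw [hM]
    positivity
  have hMub : (1 + 1 / σ) * (∫ z in disc, gradSq σ ϖ μ z)
      + (1 + σ) * (1 / 2 * Ω * Real.log (1 / T) + 2000 * Ω) + 12 * Λ * T ≤ M := by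
    rw [mul_assoc 12 Λ T, hΛT, ← hL, hM]
    have h1 : Ω * σ ≤ Ω * (1 / 10) := by gcongr
    have h2 : 0 ≤ Ω * σ * l := by positivity
    linarith
  have hMΛ : M ≤ Λ / 2 := by
    have e : Λ / 2 = Ω * (18 / T) := by
      rw [hΛ]
      ring
    rw [e]
    refine hMle.trans (mul_le_mul_of_nonneg_left ?_ hΩ0.le)
    rw [le_div_iff₀ hT0]
    have h1 : (2632 + 3 * l) * T ≤ (2632 + 3 * l) * ε := by gcongr
    linarith
  have hΛ6 : 6 * ((2 * (2 + ϖ) + 2 * σ ^ 2) / ε ^ 2) ≤ Λ := by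
    rw [hΛ, hΩT, ← mul_div_assoc, ← mul_div_assoc]
    refine div_le_div_of_nonneg_right ?_ (by positivity)
    nlinarith
  -- `M` is of order `Ω (1 + log (1/ε))` and `Λ` of order `Ω / T` with `T ≤ ε`, so boundedness of `ε
  -- log² (1/ε)` suffices.
  have hlast : 2 * M ^ 2 / Λ ≤ 8000 * Ω := by
    have h1 : M ^ 2 ≤ (Ω * (2632 + 3 * l)) ^ 2 := pow_le_pow_left₀ hM0 hMle 2
    have h4 : (2632 + 3 * l) ^ 2 * ε ≤ 30000 := by linarith
    rw [div_le_iff₀ hΛ0]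
    refine le_of_mul_le_mul_right ?_ hT0
    have h3 : M ^ 2 * T ≤ (Ω * (2632 + 3 * l)) ^ 2 * ε := by gcongr
    have h5 := mul_le_mul_of_nonneg_left h4 (sq_nonneg Ω)
    have e : 8000 * Ω * Λ * T = 288000 * Ω ^ 2 := by
      rw [mul_assoc _ Λ T, hΛT]
      ring
    rw [e]
    linarith [sq_nonneg Ω]
  -- With `κ = σ = ε √Ω` the cost of smoothing the density is exactly of order `Ω`.
  have hπ : Real.pi * σ ^ 2 / (2 * ε ^ 2) ≤ 2 * Ω := by
    have : Real.pi * σ ^ 2 / (2 * ε ^ 2) = Real.pi / 2 * Ω := by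
      rw [hσ2]
      field_simp
    rw [this]
    exact mul_le_mul_of_nonneg_right (by linarith [Real.pi_le_four]) hΩ0.le
  subst hϖ
  have key := gpEnergy_le_of_params hε hΩ0 hσ0 hn hT0 (by linarith) hσ0 hΛ0 hMub hMΛ hΛ6
  linarith

end parameters

/-- The upper bound in both regimes, with the explicit logarithm of the core area. -/
theorem gpEnergy_le {ε Ω : ℝ} (hε : 0 < ε) (hε1 : ε ≤ 1 / 1000) (hΩ : 1 ≤ Ω)
    (hs : ε ^ 2 * Ω ≤ 1 / 100) :
    gpEnergy ε Ω ≤ tfEnergy ε Ω + 1 / 2 * Ω * Real.log ((1 + ε * Ω) / (ε ^ 2 * Ω))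
      + 20000 * Ω + 6 * (Ω * Real.sqrt (ε ^ 2 * Ω) * Real.log (1 / ε)) := by
  have hΩ0 : 0 < Ω := by linarith
  have hσ0 : 0 < Real.sqrt (ε ^ 2 * Ω) := Real.sqrt_pos.2 (by positivity)
  have hσ2 : Real.sqrt (ε ^ 2 * Ω) ^ 2 = ε ^ 2 * Ω := Real.sq_sqrt (by positivity)
  have hσε : ε ≤ Real.sqrt (ε ^ 2 * Ω) :=
    Real.le_sqrt_of_sq_le (le_mul_of_one_le_right (by positivity) hΩ)
  generalize Real.sqrt (ε ^ 2 * Ω) = σ at *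
  have hσ1 : σ ≤ 1 / 10 := by nlinarith
  obtain ⟨ϖ, hϖ⟩ : ∃ ϖ : ℝ, ϖ = ε * Ω := ⟨_, rfl⟩
  have hϖ0 : 0 < ϖ := by
    rw [hϖ]
    positivity
  have hϖσ : ϖ ^ 2 = Ω * σ ^ 2 := by
    rw [hσ2, hϖ]
    ring
  have hϖε : ϖ * ε = σ ^ 2 := by
    rw [hσ2, hϖ]
    ring
  have hl0 : 0 ≤ Real.log (1 / ε) := Real.log_nonneg (by
    rw [le_div_iff₀ hε]
    linarith)
  have hl1 : ε * Real.log (1 / ε) ≤ 1 := by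
    have h1 := mul_le_mul_of_nonneg_left
      (Real.log_le_sub_one_of_pos (by positivity : 0 < 1 / ε)) hε.le
    have h2 : ε * (1 / ε - 1) = 1 - ε := by field_simp
    linarith
  have hl2 : ε * Real.log (1 / ε) ^ 2 ≤ 4 := by
    have h1 := pow_le_pow_left₀ hl0 (log_one_div_le_two_div_sqrt hε) 2
    rw [div_pow, Real.sq_sqrt hε.le, le_div_iff₀ hε] at h1
    linarith
  have hTε : σ ^ 2 / (1 + ϖ) ≤ ε := by
    rw [div_le_iff₀ (by positivity)]
    linarith
  have hT0 : 0 < σ ^ 2 / (1 + ϖ) := by positivity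
  have hL : Real.log ((1 + ϖ) / σ ^ 2) = Real.log (1 / (σ ^ 2 / (1 + ϖ))) := by
    rw [one_div_div]
  have hL0 : 0 ≤ Real.log ((1 + ϖ) / σ ^ 2) := by
    rw [hL]
    refine Real.log_nonneg ?_
    rw [le_div_iff₀ hT0]
    linarith
  have hΩT : Ω / (σ ^ 2 / (1 + ϖ)) = (1 + ϖ) / ε ^ 2 := by
    rw [hσ2]
    field_simp
  obtain ⟨μ, hn⟩ := exists_normalized σ ϖ hσ0
  have key := gpEnergy_le_of_core hε hε1 hΩ0 hσ0 hσ1 hϖ0 hϖ hσ2 hn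
    (integral_gradSq_le_log hε hε1 hσ0 hσε hσ1 hϖ0 hϖε hϖσ hn) hT0 hTε hΩT hL hL0
    (log_core_le hε hε1 hσ0 hσε hϖ0 hϖε) hl1 hl2 hl0
  rwa [hϖ, hσ2] at key

lemma abs_log_eq {ε : ℝ} (hε : 0 < ε) (h : ε ≤ 1) : |Real.log ε| = Real.log (1 / ε) := by
  rw [abs_of_nonpos (Real.log_nonpos hε.le h), one_div, Real.log_inv]

end RotatingBEC

end

/-! ### The two regimes. -/

theorem mainTheorem3 :
    (∀ C : ℝ, 0 < C → ∃ K > (0 : ℝ), ∃ ε₀ > (0 : ℝ), ∃ Ω₀ > (0 : ℝ), ∀ ε Ω : ℝ,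
      0 < ε → ε < ε₀ → Ω₀ ≤ Ω → Ω ≤ C / ε →
        RotatingBEC.gpEnergy ε Ω ≤ RotatingBEC.tfEnergy ε Ω
          + 1 / 2 * Ω * |Real.log (ε ^ 2 * Ω)| + K * Ω) ∧
    (∀ c : ℝ, 0 < c → ∃ K > (0 : ℝ), ∃ ε₀ > (0 : ℝ), ∃ δ > (0 : ℝ), ∀ ε Ω : ℝ,
      0 < ε → ε < ε₀ → c / ε ≤ Ω → Ω ≤ δ / ε ^ 2 →
        RotatingBEC.gpEnergy ε Ω ≤ RotatingBEC.tfEnergy ε Ω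
          + 1 / 2 * Ω * |Real.log ε| + K * Ω
          + K * (Ω * Real.sqrt (ε ^ 2 * Ω) * |Real.log ε|)) := by
  refine ⟨fun C hC => ?_, fun c hc => ?_⟩
  · have hlC : 0 < Real.log (1 + C) := Real.log_pos (by linarith)
    refine ⟨1 / 2 * Real.log (1 + C) + 20000 + 12 * Real.sqrt C, by positivity,
      min (1 / 1000) (1 / (100 * C)), by positivity, 1, one_pos, fun ε Ω hε hε0 hΩ hΩC => ?_⟩
    have hΩ0 : 0 < Ω := by linarith
    have h1 : ε * Ω ≤ C := by
      rw [le_div_iff₀ hε] at hΩC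
      linarith
    have hεC : ε * (100 * C) < 1 := by
      rw [← lt_div_iff₀ (by positivity)]
      exact hε0.trans_le (min_le_right _ _)
    have h2 : ε ^ 2 * Ω ≤ C * ε := by nlinarith
    have h3 : ε ^ 2 * Ω ≤ 1 / 100 := by linarith
    have key := RotatingBEC.gpEnergy_le hε (hε0.le.trans (min_le_left _ _)) hΩ h3
    -- For bounded `ε Ω` the numerator only contributes `O(Ω)` to the energy.
    have h4 : Real.log ((1 + ε * Ω) / (ε ^ 2 * Ω)) ≤ Real.log (1 + C) + |Real.log (ε ^ 2 * Ω)| := by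
      rw [Real.log_div (by positivity) (by positivity)]
      have := Real.log_le_log (by positivity) (by linarith : 1 + ε * Ω ≤ 1 + C)
      linarith [neg_abs_le (Real.log (ε ^ 2 * Ω))]
    -- Here `ε² Ω ≤ C ε`, so the extra error of `gpEnergy_le` is itself `O(Ω)`; six times this bound
    -- is the `12 √C` in `K`.
    have h5 : Real.sqrt (ε ^ 2 * Ω) * Real.log (1 / ε) ≤ 2 * Real.sqrt C := by
      have hs : 0 < Real.sqrt ε := Real.sqrt_pos.2 hε
      calc _ ≤ Real.sqrt (C * ε) * (2 / Real.sqrt ε) :=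
            mul_le_mul (Real.sqrt_le_sqrt h2) (RotatingBEC.log_one_div_le_two_div_sqrt hε)
              (Real.log_nonneg (by
                rw [le_div_iff₀ hε]
                linarith [hε0.le.trans (min_le_left _ _)])) (Real.sqrt_nonneg _)
        _ = _ := by
            rw [Real.sqrt_mul hC.le]
            field_simp
    have h6 := mul_le_mul_of_nonneg_left h4 hΩ0.le
    have h7 := mul_le_mul_of_nonneg_left h5 hΩ0.le
    linarith
  · refine ⟨|1 / 2 * Real.log ((1 + c) / c)| + 20000, by positivity, min (1 / 1000) c,
      by positivity, 1 / 100, by norm_num, fun ε Ω hε hε0 hΩ hΩ2 => ?_⟩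
    have hε1 : ε ≤ 1 / 1000 := hε0.le.trans (min_le_left _ _)
    have h1 : 1 ≤ Ω := le_trans (by
      rw [le_div_iff₀ hε, one_mul]
      exact hε0.le.trans (min_le_right _ _)) hΩ
    have hΩ0 : 0 < Ω := by linarith
    rw [div_le_iff₀ hε] at hΩ
    rw [le_div_iff₀ (by positivity)] at hΩ2
    have key := RotatingBEC.gpEnergy_le hε hε1 h1 (by linarith)
    rw [RotatingBEC.abs_log_eq hε (by linarith)]
    have hl0 : 0 ≤ Real.log (1 / ε) := Real.log_nonneg (by
      rw [le_div_iff₀ hε]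
      linarith)
    -- For `ε Ω ≥ c` the ratio `(1 + ε Ω) / (ε Ω)` is at most `(1 + c) / c`, which leaves `1 / ε`.
    have h4 : Real.log ((1 + ε * Ω) / (ε ^ 2 * Ω))
        ≤ Real.log ((1 + c) / c) + Real.log (1 / ε) := by
      rw [← Real.log_mul (by positivity) (by positivity)]
      refine Real.log_le_log (by positivity) ?_
      rw [div_mul_div_comm, div_le_div_iff₀ (by positivity) (by positivity)]
      nlinarith [sq_nonneg ε]
    have h6 := mul_le_mul_of_nonneg_left h4 hΩ0.le
    have h7 := mul_le_mul_of_nonneg_left (le_abs_self (1 / 2 * Real.log ((1 + c) / c))) hΩ0.le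
    have h8 : 0 ≤ Ω * Real.sqrt (ε ^ 2 * Ω) * Real.log (1 / ε) := by positivity
    have h9 := mul_nonneg (abs_nonneg (1 / 2 * Real.log ((1 + c) / c))) h8
    linarith
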